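/- Let $1<p<\infty$ and let $L_p=L_p(0,1)$ be the complex Lebesgue space; let $L_0=L_0(0,1)$ be the space of (classes of) measurable functions. If $p\ne 2$ let $G$ be the group $\mathrm{Isom}(L_p)$ of all surjective linear isometries of $L_p$; if $p=2$ let $G$ be the group of surjective linear isometries of $L_2$ which, together with their inverses, preserve disjointness of functions. Let $\mathcal K:L_p\to L_0$, $\mathcal K(f)=f\log(|f|/\|f\|_p)$, be the Kalton--Peck map, and let $Z_p(0,1)=\{(x,y)\in L_0\times L_p: x-\mathcal K(y)\in L_p\}$ be the Kalton--Peck space, with the quasi-norm $\|x-\mathcal K(y)\|_p+\|y\|_p$. Then: (1) Each $g\in G$ extends uniquely to a linear map of $L_0$, still denoted $g$, continuous for convergence in measure, and these extensions form an action of $G$ on $L_0$. (2) For each $g\in G$ the commutator $[g,\mathcal K]=g\mathcal K-\mathcal K g:L_p\to L_0$ is linear, and $d(g)=-[g,\mathcal K]$ is a derivation: $d(gh)=g\,d(h)+d(g)\,h$. The action of $G$ is compatible with $\mathcal K$ through $d$, where an action is called compatible with a quasi-linear map $\Omega: L_p\to L_0$ if there is a derivation $g\mapsto d(g)$ with values in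 the linear maps $L_p\to L_0$ such that the maps $[g,\Omega]+d(g)$, $g\in G$, take values in $L_p$ and are uniformly bounded, i.e. $\|[g,\Omega]f+d(g)f\|_p\le C\|f\|_p$ for all $g\in G$, $f\in L_p$. (3) The action of $G$ is also compatible with the differential of the scale of Lebesgue spaces $(L_\infty,L_1)_\theta=L_p$, $\theta=1/p$, that is, with $f\mapsto (B_f)'(\theta)$, for every homogeneous bounded selection $f\mapsto B_f$ (with $B_f(\theta)=f$) of the evaluation at $\theta$ on the Calderón space of functions $F$, continuous and bounded from $\{0\le \mathrm{Re}\,z\le1\}$ to $L_\infty+L_1=L_1$, analytic in the interior, with $F(it)$ bounded in $L_\infty$ and $F(1+it)$ bounded in $L_1$, uniformly in $t\in\mathbb R$. (4) Consequently $g\mapsto\begin{pmatrix} g & d(g)\\ 0& g\end{pmatrix}$ is a bounded action of $G$ on $Z_p(0,1)$, extending the action of $G$ on $L_p$. (5) However, $\mathcal K$ is not a linear perturbation of a $G$-centralizer: for every dense $G$-invariant linear subspace $Y_0$ of $L_p$ there is no linear map $L:Y_0\to L_0$ such that $\mathcal K+L$ is a $G$-centralizer on $Y_0$, i.e. is quasi-linear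 and satisfies $\|[g,\mathcal K+L]y\|_p\le C\|y\|_p$ for some $C$ and all $g\in G$, $y\in Y_0$. -/

import Mathlib

open MeasureTheory Filter
open scoped ENNReal Topology

noncomputable section

/-! ## Quasi-linear maps, centralizers and compatible actions

Throughout, `X` and `Y` are normed spaces, `E` is a vector space containing `X` through a linear
map `ι : X → E` (injective in all uses), and maps `Ω : Y → E` play the role of quasi-linear maps
from `Y` to `X`. A monoid `G` acts on `Y` by `v`, and on `E` by `U`; the action on `X` is the
restriction of `U`. A map defined only on a dense invariant subspace `Y₀` of a space is
covered by using `Y₀` itself, with the induced norm and action, in place of `Y`. -/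

section Abstract

variable {G : Type*} [Monoid G]
  {X : Type*} [NormedAddCommGroup X] [NormedSpace ℂ X]
  {Y : Type*} [NormedAddCommGroup Y] [NormedSpace ℂ Y]
  {E : Type*} [AddCommGroup E] [Module ℂ E]

/-- The vector `e` of the ambient space belongs to `X`, with norm at most `r`. -/
def NormLE (ι : X →ₗ[ℂ] E) (e : E) (r : ℝ) : Prop :=
  ∃ x : X, ι x = e ∧ ‖x‖ ≤ r

/-- Homogeneous, and additive up to an error in `X` controlled by the norms. -/
def IsQuasiLinear (ι : X →ₗ[ℂ] E) (Ω : Y → E) : Prop :=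
  (∀ (c : ℂ) (y : Y), Ω (c • y) = c • Ω y) ∧
    ∃ C : ℝ, ∀ y y' : Y, NormLE ι (Ω (y + y') - Ω y - Ω y') (C * (‖y‖ + ‖y'‖))

/-- The commutator `[U g, Ω, v g] = (U g) ∘ Ω - Ω ∘ (v g)`. -/
def actionCommutator (U : G →* Module.End ℂ E) (v : G →* Module.End ℂ Y) (Ω : Y → E)
    (g : G) (y : Y) : E :=
  U g (Ω y) - Ω (v g y)

/-- `Ω` is a `G`-centralizer: it is quasi-linear and its commutators with the elements of `G` are
uniformly bounded maps into `X`. -/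
def IsCentralizer (ι : X →ₗ[ℂ] E) (U : G →* Module.End ℂ E) (v : G →* Module.End ℂ Y)
    (Ω : Y → E) : Prop :=
  IsQuasiLinear ι Ω ∧
    ∃ C : ℝ, ∀ (g : G) (y : Y), NormLE ι (actionCommutator U v Ω g y) (C * ‖y‖)

/-- `Ω` becomes a `G`-centralizer after adding some linear map. -/
def IsLinearPerturbationOfCentralizer (ι : X →ₗ[ℂ] E) (U : G →* Module.End ℂ E)
    (v : G →* Module.End ℂ Y) (Ω : Y → E) : Prop :=
  ∃ L : Y →ₗ[ℂ] E, IsCentralizer ι U v (fun y => Ω y + L y)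

/-- Derivations: `d (g h) = U g ∘ d h + d g ∘ v h`, the `d g` being linear maps, with no
continuity required. -/
def IsActionDerivation (U : G →* Module.End ℂ E) (v : G →* Module.End ℂ Y)
    (d : G → (Y →ₗ[ℂ] E)) : Prop :=
  ∀ g h : G, d (g * h) = (U g).comp (d h) + (d g).comp (v h)

/-- The action is compatible with the quasi-linear map `Ω`, as witnessed by the derivation `d`:
the maps `[U g, Ω, v g] + d g` are uniformly bounded from `Y` into `X`. -/
def IsCompatibleVia (ι : X →ₗ[ℂ] E) (U : G →* Module.End ℂ E) (v : G →* Module.End ℂ Y)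
    (Ω : Y → E) (d : G → (Y →ₗ[ℂ] E)) : Prop :=
  IsQuasiLinear ι Ω ∧ IsActionDerivation U v d ∧
    ∃ C : ℝ, ∀ (g : G) (y : Y), NormLE ι (actionCommutator U v Ω g y + d g y) (C * ‖y‖)

/-- The action is compatible with `Ω`. -/
def IsCompatible (ι : X →ₗ[ℂ] E) (U : G →* Module.End ℂ E) (v : G →* Module.End ℂ Y)
    (Ω : Y → E) : Prop :=
  ∃ d : G → (Y →ₗ[ℂ] E), IsCompatibleVia ι U v Ω d

/-- The twisted sum `{(e, y) : e - Ω y ∈ X}`. (If `X` and `Y` are complete and `Ω` is defined on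
all of `Y`, it is already complete for its quasi-norm.) -/
def twistedSum (ι : X →ₗ[ℂ] E) (Ω : Y → E) (hΩ : IsQuasiLinear ι Ω) :
    Submodule ℂ (E × Y) where
  carrier := {z | z.1 - Ω z.2 ∈ LinearMap.range ι}
  zero_mem' := by
    have h : Ω 0 = 0 := by simpa using hΩ.1 0 0
    exact ⟨0, by simp [h]⟩
  add_mem' := by
    rintro ⟨e, y⟩ ⟨e', y'⟩ h h'
    obtain ⟨C, hC⟩ := hΩ.2
    obtain ⟨x, hx, -⟩ := hC y y'
    have hx' : Ω (y + y') - Ω y - Ω y' ∈ LinearMap.range ι := ⟨x, hx⟩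
    have := Submodule.sub_mem _ (Submodule.add_mem _ h h') hx'
    change e + e' - Ω (y + y') ∈ LinearMap.range ι
    convert this using 1
    dsimp only
    abel
  smul_mem' := by
    rintro c ⟨e, y⟩ h
    have h' : e - Ω y ∈ LinearMap.range ι := h
    change c • e - Ω (c • y) ∈ LinearMap.range ι
    rw [hΩ.1, ← smul_sub]
    exact Submodule.smul_mem _ c h'

/-- The quasi-norm `‖(e, y)‖ = ‖e - Ω y‖_X + ‖y‖_Y` of the twisted sum; the set under the infimum
is the singleton `{‖e - Ω y‖_X}` when `ι` is injective and `(e, y)` is in the twisted sum. -/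
def twistedNorm (ι : X →ₗ[ℂ] E) (Ω : Y → E) (z : E × Y) : ℝ :=
  sInf {r : ℝ | ∃ x : X, ι x = z.1 - Ω z.2 ∧ r = ‖x‖} + ‖z.2‖

/-- The action of `G` on an invariant subspace. -/
def restrictAction (v : G →* Module.End ℂ Y) (Y₀ : Submodule ℂ Y)
    (h : ∀ g : G, ∀ y ∈ Y₀, v g y ∈ Y₀) : G →* Module.End ℂ Y₀ where
  toFun g := (v g).restrict (h g)
  map_one' := by ext y; simp
  map_mul' g g' := by ext y; simp

end Abstract

/-! ## Lebesgue spaces on the unit interval and their isometries -/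

/-- Lebesgue measure on `(0, 1)`. -/
abbrev leb01 : Measure ℝ := volume.restrict (Set.Ioo (0 : ℝ) 1)

/-- The space `L₀(0, 1)` of classes of complex measurable functions. -/
abbrev L0 : Type := ℝ →ₘ[leb01] ℂ

/-- The complex space `L_p(0, 1)`. -/
abbrev LpI (p : ℝ≥0∞) : Type := Lp ℂ p leb01

/-- The inclusion of `L_p(0, 1)` in `L₀(0, 1)`. -/
def toL0 (p : ℝ≥0∞) : LpI p →ₗ[ℂ] L0 where
  toFun f := (f : L0)
  map_add' _ _ := rfl
  map_smul' _ _ := rfl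

/-- The group of surjective linear isometries of `L_p(0, 1)`. -/
abbrev IsomLp (p : ℝ≥0∞) [Fact (1 ≤ p)] : Type := LpI p ≃ₗᵢ[ℂ] LpI p

/-- Two functions are disjoint if their product vanishes almost everywhere. -/
def DisjointLp {p : ℝ≥0∞} (f g : LpI p) : Prop := ∀ᵐ x ∂leb01, f x * g x = 0

/-- The group of isometries `T` such that both `T` and its inverse preserve disjointness. -/
def disjointnessPreserving (p : ℝ≥0∞) [Fact (1 ≤ p)] : Subgroup (IsomLp p) where
  carrier := {T | ∀ f g : LpI p, DisjointLp (T f) (T g) ↔ DisjointLp f g}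
  one_mem' := fun _ _ => Iff.rfl
  mul_mem' := fun {S T} hS hT f g => (hS (T f) (T g)).trans (hT f g)
  inv_mem' := fun {T} hT f g => by
    have h := hT (T⁻¹ f) (T⁻¹ g)
    have e : ∀ k : LpI p, T (T⁻¹ k) = k := fun k => T.apply_symm_apply k
    rw [e, e] at h
    exact h.symm

/-- The natural action of a group of isometries on `L_p(0, 1)`. -/
def naturalAction {p : ℝ≥0∞} [Fact (1 ≤ p)] (G : Subgroup (IsomLp p)) :
    G →* Module.End ℂ (LpI p) where
  toFun g := (g : IsomLp p).toLinearEquiv.toLinearMap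
  map_one' := rfl
  map_mul' _ _ := rfl

/-- `V` is a linear extension of the isometry `T` to `L₀(0, 1)` which is continuous for convergence
in measure. -/
def IsContinuousExtension {p : ℝ≥0∞} [Fact (1 ≤ p)] (T : IsomLp p) (V : Module.End ℂ L0) :
    Prop :=
  (∀ f : LpI p, V (toL0 p f) = toL0 p (T f)) ∧
    ∀ (h : ℕ → L0) (k : L0), TendstoInMeasure leb01 (fun n x => h n x) atTop (fun x => k x) →
      TendstoInMeasure leb01 (fun n x => V (h n) x) atTop (fun x => V k x)

/-! ## The Kalton-Peck map and the Kalton-Peck space -/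

/-- The Kalton-Peck map `f ↦ f log (|f| / ‖f‖)` (with `0 log 0 = 0`), from `L_p` to `L₀`. -/
def kaltonPeck (p : ℝ≥0∞) (f : LpI p) : L0 :=
  AEEqFun.mk (fun x => f x * (Real.log (‖f x‖ / ‖f‖) : ℂ)) (by
    have h : Measurable f := (Lp.stronglyMeasurable f).measurable
    exact Measurable.aestronglyMeasurable (by fun_prop))

theorem abs_log_div_mul_le {N t : ℝ} (hN : 0 < N) (ht : 0 ≤ t) (htN : t ≤ N) :
    |Real.log (t / N)| * t ≤ N := by
  rcases ht.eq_or_lt with rfl | h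
  · simpa using hN.le
  · have h1 := Real.abs_log_mul_self_lt (t / N) (by positivity) ((div_le_one hN).2 htN)
    rw [abs_mul, abs_of_pos (show 0 < t / N by positivity)] at h1
    have h2 : |Real.log (t / N)| * t = |Real.log (t / N)| * (t / N) * N := by field_simp
    rw [h2]
    nlinarith

theorem mul_log_div_eq {M N : ℝ} (hM : 0 < M) (hN : 0 < N) (s : ℂ) :
    s * (Real.log (‖s‖ / N) : ℂ) =
      s * (Real.log (‖s‖ / M) : ℂ) + s * (Real.log (M / N) : ℂ) := by
  by_cases hs : s = 0
  · simp [hs]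
  · have hs' : 0 < ‖s‖ := norm_pos_iff.2 hs
    have : ‖s‖ / N = ‖s‖ / M * (M / N) := by field_simp
    rw [this, Real.log_mul (by positivity) (by positivity)]
    push_cast
    ring

theorem norm_mul_log_sub_le {N : ℝ} (hN : 0 < N) (s t : ℂ) :
    ‖(s + t) * (Real.log (‖s + t‖ / N) : ℂ) - s * (Real.log (‖s‖ / N) : ℂ)
      - t * (Real.log (‖t‖ / N) : ℂ)‖ ≤ 3 * (‖s‖ + ‖t‖) := by
  rcases (show 0 ≤ ‖s‖ + ‖t‖ by positivity).eq_or_lt with h | hM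
  · have hs : s = 0 := norm_eq_zero.1 (by linarith [norm_nonneg s, norm_nonneg t])
    have ht : t = 0 := norm_eq_zero.1 (by linarith [norm_nonneg s, norm_nonneg t])
    simp [hs, ht]
  set M := ‖s‖ + ‖t‖ with hMdef
  have key : ∀ r : ℂ, ‖r‖ ≤ M → ‖r * (Real.log (‖r‖ / M) : ℂ)‖ ≤ M := fun r hr => by
    rw [norm_mul, Complex.norm_real, Real.norm_eq_abs, mul_comm]
    exact abs_log_div_mul_le hM (norm_nonneg _) hr
  have e : (s + t) * (Real.log (‖s + t‖ / N) : ℂ) - s * (Real.log (‖s‖ / N) : ℂ)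
      - t * (Real.log (‖t‖ / N) : ℂ) =
      (s + t) * (Real.log (‖s + t‖ / M) : ℂ) - s * (Real.log (‖s‖ / M) : ℂ)
      - t * (Real.log (‖t‖ / M) : ℂ) := by
    rw [mul_log_div_eq hM hN (s + t), mul_log_div_eq hM hN s, mul_log_div_eq hM hN t]
    ring
  rw [e]
  have h1 := key (s + t) (norm_add_le _ _)
  have h2 := key s (by linarith [norm_nonneg t])
  have h3 := key t (by linarith [norm_nonneg s])
  have h4 := norm_sub_le ((s + t) * (Real.log (‖s + t‖ / M) : ℂ) - s * (Real.log (‖s‖ / M) : ℂ))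
    (t * (Real.log (‖t‖ / M) : ℂ))
  have h5 := norm_sub_le ((s + t) * (Real.log (‖s + t‖ / M) : ℂ)) (s * (Real.log (‖s‖ / M) : ℂ))
  linarith

/-- The Kalton-Peck map in terms of a normalization by another constant. -/
theorem kaltonPeck_ae {p : ℝ≥0∞} [Fact (1 ≤ p)] {N : ℝ} (hN : 0 < N) (f : LpI p) :
    ∀ᵐ x ∂leb01, kaltonPeck p f x =
      f x * (Real.log (‖f x‖ / N) : ℂ) - (Real.log (‖f‖ / N) : ℂ) * f x := by
  have h0 : ∀ᵐ x ∂leb01, ‖f‖ = 0 → f x = 0 := by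
    by_cases h : ‖f‖ = 0
    · have hf : f = 0 := norm_eq_zero.1 h
      subst hf
      filter_upwards [Lp.coeFn_zero ℂ p leb01] with x hx _
      simpa using hx
    · exact Eventually.of_forall fun x hx => absurd hx h
  have h1 : kaltonPeck p f =ᵐ[leb01] fun x => f x * (Real.log (‖f x‖ / ‖f‖) : ℂ) :=
    AEEqFun.coeFn_mk _ _
  filter_upwards [h0, h1] with x hx h1x
  rw [h1x]
  rcases (norm_nonneg f).eq_or_lt with h | h
  · simp [hx h.symm]
  · rw [mul_log_div_eq h hN (f x)]
    ring

theorem kaltonPeck_isQuasiLinear (p : ℝ≥0∞) [Fact (1 ≤ p)] :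
    IsQuasiLinear (toL0 p) (kaltonPeck p) := by
  refine ⟨fun c f => ?_, 6, fun f g => ?_⟩
  · apply AEEqFun.ext
    have h1 : kaltonPeck p (c • f) =ᵐ[leb01]
      fun x => (c • f : LpI p) x * (Real.log (‖(c • f : LpI p) x‖ / ‖c • f‖) : ℂ) :=
        AEEqFun.coeFn_mk _ _
    have h2 : kaltonPeck p f =ᵐ[leb01] fun x => f x * (Real.log (‖f x‖ / ‖f‖) : ℂ) :=
      AEEqFun.coeFn_mk _ _
    filter_upwards [h1, h2, AEEqFun.coeFn_smul c (kaltonPeck p f), Lp.coeFn_smul c f]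
      with x h1 h2 h3 h4
    rw [h1, h3, h4]
    simp only [Pi.smul_apply, smul_eq_mul, h2, norm_mul, norm_smul]
    by_cases hc : c = 0
    · simp [hc]
    · rw [mul_div_mul_left _ _ (norm_ne_zero_iff.2 hc), mul_assoc]
  · rcases (show 0 ≤ ‖f‖ + ‖g‖ by positivity).eq_or_lt with h | hN
    · have hf : f = 0 := norm_eq_zero.1 (by linarith [norm_nonneg f, norm_nonneg g])
      have hg : g = 0 := norm_eq_zero.1 (by linarith [norm_nonneg f, norm_nonneg g])
      have hz : kaltonPeck p (0 : LpI p) = 0 := by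
        apply AEEqFun.ext
        have h2 : kaltonPeck p (0 : LpI p) =ᵐ[leb01] fun x =>
            (0 : LpI p) x * (Real.log (‖(0 : LpI p) x‖ / ‖(0 : LpI p)‖) : ℂ) :=
          AEEqFun.coeFn_mk _ _
        filter_upwards [h2, AEEqFun.coeFn_zero (β := ℂ) (μ := leb01)] with x h2 h3
        rw [h2, h3]
        simp
      refine ⟨0, ?_, by simp [hf, hg]⟩
      simp [hf, hg, hz]
    set N := ‖f‖ + ‖g‖ with hNdef
    set P : ℝ → ℂ := fun x => (f x + g x) * (Real.log (‖f x + g x‖ / N) : ℂ)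
      - f x * (Real.log (‖f x‖ / N) : ℂ) - g x * (Real.log (‖g x‖ / N) : ℂ) with hP
    have mf : Measurable f := (Lp.stronglyMeasurable f).measurable
    have mg : Measurable g := (Lp.stronglyMeasurable g).measurable
    have hPm : AEStronglyMeasurable P leb01 := Measurable.aestronglyMeasurable (by fun_prop)
    have hR : MemLp (fun x => ‖f x‖ + ‖g x‖) p leb01 := (Lp.memLp f).norm.add (Lp.memLp g).norm
    have hle : ∀ᵐ x ∂leb01, ‖P x‖ ≤ 3 * ‖‖f x‖ + ‖g x‖‖ := Eventually.of_forall fun x => by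
      rw [Real.norm_of_nonneg (by positivity)]
      exact norm_mul_log_sub_le hN (f x) (g x)
    have hPL : MemLp P p leb01 := hR.of_le_mul hPm hle
    have hPn : ‖hPL.toLp P‖ ≤ 3 * N := by
      have h1 : ‖hPL.toLp P‖ ≤ 3 * ‖hR.toLp _‖ := by
        apply Lp.norm_le_mul_norm_of_ae_le_mul
        filter_upwards [hPL.coeFn_toLp, hR.coeFn_toLp, hle] with x h1 h2 h3
        rw [h1, h2]
        exact h3
      have h2 : hR.toLp _ = (Lp.memLp f).norm.toLp _ + (Lp.memLp g).norm.toLp _ := rfl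
      have h3 : ‖hR.toLp _‖ ≤ N := by
        rw [h2]
        refine (norm_add_le _ _).trans ?_
        rw [Lp.norm_toLp, Lp.norm_toLp, eLpNorm_norm, eLpNorm_norm]
        exact le_of_eq rfl
      linarith
    set c₁ : ℂ := (Real.log (‖f + g‖ / N) : ℂ)
    set c₂ : ℂ := (Real.log (‖f‖ / N) : ℂ)
    set c₃ : ℂ := (Real.log (‖g‖ / N) : ℂ)
    have hc : ∀ k : LpI p, ‖k‖ ≤ N → ‖(Real.log (‖k‖ / N) : ℂ) • k‖ ≤ N := fun k hk => by
      rw [norm_smul, Complex.norm_real, Real.norm_eq_abs]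
      exact abs_log_div_mul_le hN (norm_nonneg _) hk
    refine ⟨hPL.toLp P - c₁ • (f + g) + c₂ • f + c₃ • g, ?_, ?_⟩
    · apply AEEqFun.ext
      change ((hPL.toLp P - c₁ • (f + g) + c₂ • f + c₃ • g : LpI p) : ℝ → ℂ) =ᵐ[leb01] _
      filter_upwards [hPL.coeFn_toLp, Lp.coeFn_add (hPL.toLp P - c₁ • (f + g) + c₂ • f) (c₃ • g),
        Lp.coeFn_add (hPL.toLp P - c₁ • (f + g)) (c₂ • f), Lp.coeFn_sub (hPL.toLp P) (c₁ • (f + g)),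
        Lp.coeFn_smul c₁ (f + g), Lp.coeFn_smul c₂ f, Lp.coeFn_smul c₃ g, Lp.coeFn_add f g,
        AEEqFun.coeFn_sub (kaltonPeck p (f + g) - kaltonPeck p f) (kaltonPeck p g),
        AEEqFun.coeFn_sub (kaltonPeck p (f + g)) (kaltonPeck p f),
        kaltonPeck_ae hN (f + g), kaltonPeck_ae hN f, kaltonPeck_ae hN g]
        with x a1 a2 a3 a4 a5 a6 a7 a8 a9 a10 a11 a12 a13
      rw [a2, Pi.add_apply, a3, Pi.add_apply, a4, Pi.sub_apply, a5, a6, a7, a1, a9, Pi.sub_apply,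
        a10, Pi.sub_apply, a11, a12, a13]
      simp only [Pi.smul_apply, a8, Pi.add_apply, smul_eq_mul, hP]
      ring
    · have b1 := hc (f + g) (norm_add_le _ _)
      have b2 := hc f (by linarith [norm_nonneg g])
      have b3 := hc g (by linarith [norm_nonneg f])
      have d1 := norm_add_le (hPL.toLp P - c₁ • (f + g) + c₂ • f) (c₃ • g)
      have d2 := norm_add_le (hPL.toLp P - c₁ • (f + g)) (c₂ • f)
      have d3 := norm_sub_le (hPL.toLp P) (c₁ • (f + g))
      linarith

/-- The Kalton-Peck space `Z_p(0, 1)`, the twisted sum of `L_p` with itself defined by the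
Kalton-Peck map. -/
def KaltonPeckSpace (p : ℝ≥0∞) [Fact (1 ≤ p)] : Submodule ℂ (L0 × LpI p) :=
  twistedSum (toL0 p) (kaltonPeck p) (kaltonPeck_isQuasiLinear p)

/-! ## The differential of the scale of Lebesgue spaces

On `(0, 1)` one has `L_∞ + L_1 = L_1`, with the same norm. -/

/-- The closed unit strip. -/
def closedStrip : Set ℂ := {z | 0 ≤ z.re ∧ z.re ≤ 1}

/-- The open unit strip. -/
def openStrip : Set ℂ := {z | 0 < z.re ∧ z.re < 1}

/-- `F` (only its values on the closed strip matter) belongs to the Calderón space of the pair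
`(L_∞, L_1)` and has norm at most `r` there: it is continuous and bounded from the closed strip to
`L_∞ + L_1 = L_1`, analytic inside, bounded by `r` in `L_∞` on the line `Re z = 0`, and by
`r` in `L_1` on the line `Re z = 1`. Continuity of `t ↦ F (i t)` for the norm of `L_∞` is not
demanded, so that the class contains both the functions for which this is demanded and the
extremal functions `z ↦ f |f| ^ (p z - 1)`. -/
def CalderonNormLE (F : ℂ → LpI 1) (r : ℝ) : Prop :=
  ContinuousOn F closedStrip ∧ DifferentiableOn ℂ F openStrip ∧
    (∃ M : ℝ, ∀ z ∈ closedStrip, ‖F z‖ ≤ M) ∧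
    (∀ t : ℝ, ∀ᵐ x ∂leb01, ‖F (t * Complex.I) x‖ ≤ r) ∧
    (∀ t : ℝ, ‖F (1 + t * Complex.I)‖ ≤ r)

/-- A homogeneous bounded selection for the evaluation at `θ = 1 / p`, where the interpolation
space is `L_p`. -/
def IsCalderonSelection (p : ℝ≥0∞) (B : LpI p → ℂ → LpI 1) : Prop :=
  (∀ f : LpI p, toL0 1 (B f (1 / p.toReal : ℝ)) = toL0 p f) ∧
    (∀ (c : ℂ) (f : LpI p), ∀ z ∈ closedStrip, B (c • f) z = c • B f z) ∧
    ∃ C : ℝ, ∀ f : LpI p, CalderonNormLE (B f) (C * ‖f‖)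

/-- The differential `f ↦ (B f)' (θ)`, `θ = 1 / p`, defined by the selection `B`. -/
def scaleDifferential (p : ℝ≥0∞) (B : LpI p → ℂ → LpI 1) (f : LpI p) : L0 :=
  toL0 1 (deriv (B f) ((1 / p.toReal : ℝ) : ℂ))

end

/-!
Every `T` in `G` preserves disjointness, so it is a weighted composition `f ↦ W · (f ∘ φ)`: for
`p ≠ 2` because equality in Clarkson's inequalities characterizes disjointness (Banach, Lamperti).
The same formula extends `T` to `L₀`, and `[T, 𝒦] f = -log ‖W‖ · T f` is linear in `f`. The
differential of the scale is `p 𝒦` up to a bounded error: it equals `p 𝒦 f` for the extremal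
function `z ↦ sign f · (|f| / ‖f‖) ^ (p z) · ‖f‖`, and a Calderón function vanishing at `θ` can be
divided by `z - θ`, so that its derivative at `θ` is bounded in `L_p`.

For the last claim suppose that `𝒦 + L` has commutators bounded by `C`, let `y` be the indicator of
`H = (0, 1/2)`, and cut `H` into `N` pieces `Aᵢ` of equal measure.
* Averaging the commutators with multiplication by the characters of a group of order `N`, constant
  on each piece, gives `L y ≈ L 1_{Aᵢ}` on `Aᵢ`.
* An isometry carrying `H` to `Aᵢ` has weight `N ^ (1/p)` there, which gives
  `L y ∘ R ≈ L 1_{Aᵢ} + (1/p) log N` on `Aᵢ`, where `R` maps each piece onto `H`.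

Both errors are at most `C |H|` in `L₁(H)`. As `R` preserves the measure of `H`, the real part of
`L y ∘ R - L y` has mean zero on `H`, so `(1/p) log N ≤ 2 C` for every `N`.
-/

/-! ## Weighted composition operators on `L₀` -/

section WeightedComposition

variable {α : Type*} [MeasurableSpace α] {μ : Measure α}

/-- The weighted composition operator `h ↦ w · (h ∘ φ)` on classes of measurable functions. -/
noncomputable def weightedComp (w : α →ₘ[μ] ℂ) {φ : α → α}
    (hφ : Measure.QuasiMeasurePreserving φ μ μ) : Module.End ℂ (α →ₘ[μ] ℂ) where
  toFun h := w * h.compQuasiMeasurePreserving φ hφ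
  map_add' h k := AEEqFun.induction_on₃ w h k fun _ _ _ _ _ _ =>
    AEEqFun.mk_eq_mk.2 <| .of_forall fun _ => mul_add _ _ _
  map_smul' c h := AEEqFun.induction_on₂ w h fun _ _ _ _ =>
    AEEqFun.mk_eq_mk.2 <| .of_forall fun _ => mul_smul_comm c _ _

theorem coeFn_weightedComp (w : α →ₘ[μ] ℂ) {φ : α → α}
    (hφ : Measure.QuasiMeasurePreserving φ μ μ) (h : α →ₘ[μ] ℂ) :
    weightedComp w hφ h =ᵐ[μ] fun x => w x * h (φ x) := by
  filter_upwards [AEEqFun.coeFn_mul w (h.compQuasiMeasurePreserving φ hφ),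
    AEEqFun.coeFn_compQuasiMeasurePreserving h hφ] with x h_mul h_comp
  exact h_mul.trans (congrArg (w x * ·) h_comp)

theorem tendstoInMeasure_weightedComp [IsFiniteMeasure μ] (w : α →ₘ[μ] ℂ) {φ : α → α}
    (hφ : Measure.QuasiMeasurePreserving φ μ μ) {h : ℕ → α →ₘ[μ] ℂ} {k : α →ₘ[μ] ℂ}
    (hk : TendstoInMeasure μ (fun n x => h n x) atTop k) :
    TendstoInMeasure μ (fun n x => weightedComp w hφ (h n) x) atTop (weightedComp w hφ k) := by
  rw [exists_seq_tendstoInMeasure_atTop_iff fun n => AEEqFun.aestronglyMeasurable _] at hk ⊢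
  intro ns hns
  obtain ⟨ms, hms, hlim⟩ := hk ns hns
  refine ⟨ms, hms, ?_⟩
  filter_upwards [hφ.ae hlim, coeFn_weightedComp w hφ k,
    ae_all_iff.2 fun n => coeFn_weightedComp w hφ (h n)] with x hlim hk hh
  simpa only [hk, hh] using hlim.const_mul (w x)

theorem exists_seq_Lp_tendstoInMeasure [IsFiniteMeasure μ] (p : ℝ≥0∞) (k : α →ₘ[μ] ℂ) :
    ∃ f : ℕ → Lp ℂ p μ, TendstoInMeasure μ (fun n x => f n x) atTop k := by
  have hk := k.stronglyMeasurable
  have hmem (n : ℕ) : MemLp (hk.approx n) p μ := SimpleFunc.memLp_of_isFiniteMeasure _ p μ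
  refine ⟨fun n => (hmem n).toLp _,
    tendstoInMeasure_of_tendsto_ae (fun n => Lp.aestronglyMeasurable _) ?_⟩
  filter_upwards [ae_all_iff.2 fun n => (hmem n).coeFn_toLp] with x hx
  simpa only [hx] using hk.tendsto_approx x

end WeightedComposition

section Extension

variable {p : ℝ≥0∞} [Fact (1 ≤ p)] {S T : IsomLp p} {V V' : Module.End ℂ L0}

theorem IsContinuousExtension.unique (h : IsContinuousExtension T V)
    (h' : IsContinuousExtension T V') : V = V' := by
  ext1 k
  obtain ⟨f, hf⟩ := exists_seq_Lp_tendstoInMeasure p k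
  have hV := h.2 (fun n => toL0 p (f n)) k hf
  have hV' := h'.2 (fun n => toL0 p (f n)) k hf
  simp only [h.1, h'.1] at hV hV'
  exact AEEqFun.ext (tendstoInMeasure_ae_unique hV hV')

theorem IsContinuousExtension.one : IsContinuousExtension (1 : IsomLp p) 1 :=
  ⟨fun _ => rfl, fun _ _ h => h⟩

theorem IsContinuousExtension.mul (h : IsContinuousExtension S V)
    (h' : IsContinuousExtension T V') : IsContinuousExtension (S * T) (V * V') :=
  ⟨fun f => (congrArg V (h'.1 f)).trans (h.1 (T f)), fun _ _ hk => h.2 _ _ (h'.2 _ _ hk)⟩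

/-- The isometry `T` is the weighted composition operator `f ↦ W · (f ∘ φ)`. -/
structure IsWeightedComp (T : IsomLp p) (W : ℝ → ℂ) (φ : ℝ → ℝ) : Prop where
  measurable_weight : Measurable W
  quasiMeasurePreserving : Measure.QuasiMeasurePreserving φ leb01 leb01
  coeFn_eq : ∀ f : LpI p, T f =ᵐ[leb01] fun x => W x * f (φ x)

variable {W : ℝ → ℂ} {φ : ℝ → ℝ}

theorem IsWeightedComp.exists_isContinuousExtension (hT : IsWeightedComp T W φ) :
    ∃ V : Module.End ℂ L0, IsContinuousExtension T V ∧
      ∀ h : L0, V h =ᵐ[leb01] fun x => W x * h (φ x) := by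
  set w : L0 := AEEqFun.mk W hT.measurable_weight.aestronglyMeasurable
  have hV (h : L0) : weightedComp w hT.quasiMeasurePreserving h =ᵐ[leb01]
      fun x => W x * h (φ x) := by
    filter_upwards [coeFn_weightedComp w hT.quasiMeasurePreserving h,
      AEEqFun.coeFn_mk W hT.measurable_weight.aestronglyMeasurable] with x h_comp hw
    rw [h_comp, hw]
  exact ⟨_, ⟨fun f => AEEqFun.ext ((hV (toL0 p f)).trans (hT.coeFn_eq f).symm),
    fun _ _ => tendstoInMeasure_weightedComp w _⟩, hV⟩

theorem IsContinuousExtension.coeFn_eq (hV : IsContinuousExtension T V)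
    (hT : IsWeightedComp T W φ) (h : L0) : V h =ᵐ[leb01] fun x => W x * h (φ x) := by
  obtain ⟨V', hV', h_eq⟩ := hT.exists_isContinuousExtension
  exact hV.unique hV' ▸ h_eq h

end Extension

/-! ## Isometries of `L_p` preserve disjointness if `p ≠ 2` -/

theorem rpow_add_rpow_lt_add_rpow {r a b : ℝ} (hr : 1 < r) (ha : 0 < a) (hb : 0 < b) :
    a ^ r + b ^ r < (a + b) ^ r := by
  have split {c : ℝ} (hc : 0 < c) : c ^ r = c ^ (r - 1) * c := by
    rw [← Real.rpow_add_one hc.ne', sub_add_cancel]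
  have h₁ : a ^ (r - 1) < (a + b) ^ (r - 1) := by gcongr; linarith
  have h₂ : b ^ (r - 1) < (a + b) ^ (r - 1) := by gcongr; linarith
  rw [split ha, split hb, split (add_pos ha hb), mul_add]
  gcongr

theorem add_rpow_lt_rpow_add_rpow {r a b : ℝ} (hr : r < 1) (ha : 0 < a) (hb : 0 < b) :
    (a + b) ^ r < a ^ r + b ^ r := by
  have split {c : ℝ} (hc : 0 < c) : c ^ r = c ^ (r - 1) * c := by
    rw [← Real.rpow_add_one hc.ne', sub_add_cancel]
  have h₁ : (a + b) ^ (r - 1) < a ^ (r - 1) :=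
    Real.rpow_lt_rpow_of_neg ha (by linarith) (by linarith)
  have h₂ : (a + b) ^ (r - 1) < b ^ (r - 1) :=
    Real.rpow_lt_rpow_of_neg hb (by linarith) (by linarith)
  rw [split ha, split hb, split (add_pos ha hb), mul_add]
  gcongr

section Clarkson

variable {E : Type*} [NormedAddCommGroup E] {q : ℝ} {α : Type*} [MeasurableSpace α] {μ : Measure α}
  {p : ℝ≥0∞}

/-- The defect of the parallelogram identity for the exponent `q`. -/
noncomputable def parallelogramDefect (q : ℝ) (a b : E) : ℝ :=
  ‖a + b‖ ^ q + ‖a - b‖ ^ q - 2 * (‖a‖ ^ q + ‖b‖ ^ q)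

theorem parallelogramDefect_eq_zero (hq : 0 < q) {a b : E} (h : a = 0 ∨ b = 0) :
    parallelogramDefect q a b = 0 := by
  rcases h with rfl | rfl <;> (simp [parallelogramDefect, Real.zero_rpow hq.ne']; ring)

theorem parallelogramDefect_eq (q : ℝ) (a b : E) :
    parallelogramDefect q a b = (‖a + b‖ ^ 2) ^ (q / 2) + (‖a - b‖ ^ 2) ^ (q / 2) -
      2 * ((‖a‖ ^ 2) ^ (q / 2) + (‖b‖ ^ 2) ^ (q / 2)) := by
  have sq_rpow (c : E) : (‖c‖ ^ 2) ^ (q / 2) = ‖c‖ ^ q := by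
    rw [← Real.rpow_natCast, ← Real.rpow_mul (norm_nonneg _), Nat.cast_two,
      mul_div_cancel₀ _ two_ne_zero]
  simp only [parallelogramDefect, sq_rpow]

theorem norm_rpow_eq_integral (hp₀ : p ≠ 0) (hp : p ≠ ∞)
    (f : Lp E p μ) : ‖f‖ ^ p.toReal = ∫ x, ‖f x‖ ^ p.toReal ∂μ := by
  have h0 : 0 ≤ ∫ x, ‖f x‖ ^ p.toReal ∂μ := integral_nonneg fun x => by positivity
  rw [Lp.norm_def, (Lp.memLp f).eLpNorm_eq_integral_rpow_norm hp₀ hp,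
    ENNReal.toReal_ofReal (by positivity),
    Real.rpow_inv_rpow h0 (ENNReal.toReal_pos hp₀ hp).ne']

theorem integrable_parallelogramDefect (hp₀ : p ≠ 0) (hp : p ≠ ∞) (f g : Lp E p μ) :
    Integrable (fun x => parallelogramDefect p.toReal (f x) (g x)) μ := by
  have hf := (Lp.memLp f).integrable_norm_rpow hp₀ hp
  have hg := (Lp.memLp g).integrable_norm_rpow hp₀ hp
  have h_add := ((Lp.memLp f).add (Lp.memLp g)).integrable_norm_rpow hp₀ hp
  have h_sub := ((Lp.memLp f).sub (Lp.memLp g)).integrable_norm_rpow hp₀ hp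
  exact (h_add.add h_sub).sub ((hf.add hg).const_mul 2)

theorem integral_parallelogramDefect (hp₀ : p ≠ 0) (hp : p ≠ ∞) (f g : Lp E p μ) :
    ∫ x, parallelogramDefect p.toReal (f x) (g x) ∂μ =
      ‖f + g‖ ^ p.toReal + ‖f - g‖ ^ p.toReal - 2 * (‖f‖ ^ p.toReal + ‖g‖ ^ p.toReal) := by
  have int (h : Lp E p μ) : Integrable (fun x => ‖h x‖ ^ p.toReal) μ :=
    (Lp.memLp h).integrable_norm_rpow hp₀ hp
  have h_congr : (fun x => parallelogramDefect p.toReal (f x) (g x)) =ᵐ[μ] fun x =>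
      ‖(f + g) x‖ ^ p.toReal + ‖(f - g) x‖ ^ p.toReal -
        2 * (‖f x‖ ^ p.toReal + ‖g x‖ ^ p.toReal) := by
    filter_upwards [Lp.coeFn_add f g, Lp.coeFn_sub f g] with x h_add h_sub
    simp only [parallelogramDefect, h_add, h_sub, Pi.add_apply, Pi.sub_apply]
  rw [integral_congr_ae h_congr,
    integral_sub (by exact (int _).add (int _)) (by exact ((int f).add (int g)).const_mul 2),
    integral_const_mul,
    integral_add (int _) (int _), integral_add (int f) (int g)]
  simp only [norm_rpow_eq_integral hp₀ hp]

variable [InnerProductSpace ℝ E]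

theorem average_sq_norm (a b : E) :
    (1 / 2 : ℝ) * ‖a + b‖ ^ 2 + 1 / 2 * ‖a - b‖ ^ 2 = ‖a‖ ^ 2 + ‖b‖ ^ 2 := by
  linarith [parallelogram_law_with_norm ℝ a b]

theorem parallelogramDefect_pos (hq : 2 < q) {a b : E} (ha : a ≠ 0) (hb : b ≠ 0) :
    0 < parallelogramDefect q a b := by
  have hr : 1 < q / 2 := by linarith
  have h_conv := (convexOn_rpow hr.le).2 (Set.mem_Ici.2 (sq_nonneg ‖a + b‖))
    (Set.mem_Ici.2 (sq_nonneg ‖a - b‖)) one_half_pos.le one_half_pos.le (add_halves 1)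
  simp only [smul_eq_mul, average_sq_norm] at h_conv
  have h_add := rpow_add_rpow_lt_add_rpow hr (a := ‖a‖ ^ 2) (b := ‖b‖ ^ 2)
    (by positivity) (by positivity)
  rw [parallelogramDefect_eq]
  linarith

theorem parallelogramDefect_neg (hq₀ : 0 < q) (hq : q < 2) {a b : E} (ha : a ≠ 0) (hb : b ≠ 0) :
    parallelogramDefect q a b < 0 := by
  have hr : q / 2 < 1 := by linarith
  have h_conc := (Real.concaveOn_rpow (by linarith) hr.le).2 (Set.mem_Ici.2 (sq_nonneg ‖a + b‖))
    (Set.mem_Ici.2 (sq_nonneg ‖a - b‖)) one_half_pos.le one_half_pos.le (add_halves 1)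
  simp only [smul_eq_mul, average_sq_norm] at h_conc
  have h_add := add_rpow_lt_rpow_add_rpow hr (a := ‖a‖ ^ 2) (b := ‖b‖ ^ 2)
    (by positivity) (by positivity)
  rw [parallelogramDefect_eq]
  linarith

theorem sub_two_mul_parallelogramDefect_pos (hq₀ : 0 < q) (hq : q ≠ 2) {a b : E} (ha : a ≠ 0)
    (hb : b ≠ 0) : 0 < (q - 2) * parallelogramDefect q a b := by
  rcases hq.lt_or_gt with hq | hq
  · exact mul_pos_of_neg_of_neg (by linarith) (parallelogramDefect_neg hq₀ hq ha hb)
  · exact mul_pos (by linarith) (parallelogramDefect_pos hq ha hb)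

theorem ae_eq_zero_or_eq_zero_iff (hp₀ : p ≠ 0) (hp : p ≠ ∞) (hp₂ : p ≠ 2) (f g : Lp E p μ) :
    (∀ᵐ x ∂μ, f x = 0 ∨ g x = 0) ↔
      ‖f + g‖ ^ p.toReal + ‖f - g‖ ^ p.toReal - 2 * (‖f‖ ^ p.toReal + ‖g‖ ^ p.toReal) = 0 := by
  have hq₀ : 0 < p.toReal := ENNReal.toReal_pos hp₀ hp
  have hq : p.toReal ≠ 2 := fun h => hp₂ (by rw [← ENNReal.ofReal_toReal hp, h]; simp)
  rw [← integral_parallelogramDefect hp₀ hp]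
  refine ⟨fun h => integral_eq_zero_of_ae (h.mono fun x => parallelogramDefect_eq_zero hq₀),
    fun h => ?_⟩
  have h_nonneg : 0 ≤ fun x => (p.toReal - 2) * parallelogramDefect p.toReal (f x) (g x) :=
    fun x => by
      by_cases hx : f x = 0 ∨ g x = 0
      · simp [parallelogramDefect_eq_zero hq₀ hx]
      · rw [not_or] at hx
        exact (sub_two_mul_parallelogramDefect_pos hq₀ hq hx.1 hx.2).le
  have h_zero : ∫ x, (p.toReal - 2) * parallelogramDefect p.toReal (f x) (g x) ∂μ = 0 := by
    rw [integral_const_mul, h, mul_zero]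
  rw [integral_eq_zero_iff_of_nonneg h_nonneg
    ((integrable_parallelogramDefect hp₀ hp f g).const_mul _)] at h_zero
  filter_upwards [h_zero] with x hx
  by_contra! hne
  exact (sub_two_mul_parallelogramDefect_pos hq₀ hq hne.1 hne.2).ne' hx

end Clarkson

theorem disjointnessPreserving_eq_top {p : ℝ≥0∞} [Fact (1 ≤ p)] (hp : p ≠ ∞) (hp₂ : p ≠ 2) :
    disjointnessPreserving p = ⊤ := by
  have disjointLp_iff (f g : LpI p) : DisjointLp f g ↔ ∀ᵐ x ∂leb01, f x = 0 ∨ g x = 0 := by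
    simp only [DisjointLp, mul_eq_zero]
  have hp₀ : p ≠ 0 := (zero_lt_one.trans_le Fact.out).ne'
  refine eq_top_iff.2 fun T _ f g => ?_
  simp only [disjointLp_iff, ae_eq_zero_or_eq_zero_iff hp₀ hp hp₂, ← map_add, ← map_sub, T.norm_map]

/-! ## Disjointness preserving isometries are weighted composition operators -/

section Indicator

variable {p : ℝ≥0∞} {A B : Set ℝ}

/-- The indicator function of a measurable set, as an element of `L_p(0, 1)`. -/
noncomputable abbrev indLp (p : ℝ≥0∞) (hA : MeasurableSet A) : LpI p :=
  indicatorConstLp p hA (measure_ne_top leb01 A) (1 : ℂ)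

theorem coeFn_indLp (p : ℝ≥0∞) (hA : MeasurableSet A) :
    indLp p hA =ᵐ[leb01] A.indicator fun _ => 1 :=
  indicatorConstLp_coeFn

theorem indLp_ne_zero_iff (p : ℝ≥0∞) (hA : MeasurableSet A) :
    ∀ᵐ x ∂leb01, indLp p hA x ≠ 0 ↔ x ∈ A := by
  filter_upwards [coeFn_indLp p hA] with x hx
  simp [hx]

theorem indicatorConstLp_eq_smul_indLp (hA : MeasurableSet A) (c : ℂ) :
    indicatorConstLp p hA (measure_ne_top leb01 A) c = c • indLp p hA := by
  simp only [indLp, indicatorConstLp, ← MemLp.toLp_const_smul]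
  exact (MemLp.toLp_eq_toLp_iff ..).2 (.of_eq (by ext x; by_cases hx : x ∈ A <;> simp [hx]))

end Indicator

section Representation

variable {p : ℝ≥0∞} [Fact (1 ≤ p)] {T : IsomLp p}

theorem exists_map_ne_zero (hT : T ∈ disjointnessPreserving p) {ι : Type*} [Countable ι]
    {f : LpI p} {g : ι → LpI p} (h : ∀ᵐ x ∂leb01, f x ≠ 0 → ∃ i, g i x ≠ 0) :
    ∀ᵐ x ∂leb01, T f x ≠ 0 → ∃ i, T (g i) x ≠ 0 := by
  -- A function carried by the set where all `T (g i)` vanish has a preimage disjoint from all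
  -- `g i`, hence from `f`.
  set D : Set ℝ := {x | ∀ i, T (g i) x = 0}
  have hD : MeasurableSet D := by
    simp only [D, Set.ofPred_forall]
    exact .iInter fun i => (Lp.stronglyMeasurable _).measurable (measurableSet_singleton 0)
  obtain ⟨v, hv⟩ := T.surjective (indLp p hD)
  have hvg (i : ι) : DisjointLp v (g i) := (hT _ _).1 <| by
    filter_upwards [indLp_ne_zero_iff p hD] with x hx
    rw [hv, mul_eq_zero, or_iff_not_imp_left]
    exact fun hne => hx.1 hne i
  have hvf : DisjointLp v f := by
    filter_upwards [h, ae_all_iff.2 hvg] with x h hvg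
    by_contra hne
    obtain ⟨i, hi⟩ := h (right_ne_zero_of_mul hne)
    exact mul_ne_zero (left_ne_zero_of_mul hne) hi (hvg i)
  filter_upwards [(hT _ _).2 hvf, indLp_ne_zero_iff p hD] with x hx hu hf
  by_contra! hxD
  rw [hv] at hx
  exact mul_ne_zero (hu.2 hxD) hf hx

theorem map_ne_zero_iff_exists (hT : T ∈ disjointnessPreserving p) {ι : Type*} [Countable ι]
    {f : LpI p} {g : ι → LpI p} (h : ∀ᵐ x ∂leb01, f x ≠ 0 ↔ ∃ i, g i x ≠ 0) :
    ∀ᵐ x ∂leb01, T f x ≠ 0 ↔ ∃ i, T (g i) x ≠ 0 := by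
  have h_ge (i : ι) : ∀ᵐ x ∂leb01, T (g i) x ≠ 0 → ∃ _ : Unit, T f x ≠ 0 :=
    exists_map_ne_zero hT (h.mono fun x hx hg => ⟨(), hx.2 ⟨i, hg⟩⟩)
  filter_upwards [exists_map_ne_zero hT (h.mono fun x => Iff.mp), ae_all_iff.2 h_ge] with x h₁ h₂
  exact ⟨h₁, fun ⟨i, hi⟩ => (h₂ i hi).elim fun _ => id⟩

theorem map_ne_zero_ae (hT : T ∈ disjointnessPreserving p) {f : LpI p}
    (hf : ∀ᵐ x ∂leb01, f x ≠ 0) : ∀ᵐ x ∂leb01, T f x ≠ 0 := by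
  obtain ⟨v, hv⟩ := T.surjective f
  have h : ∀ᵐ x ∂leb01, T v x ≠ 0 → ∃ _ : Unit, T f x ≠ 0 :=
    exists_map_ne_zero hT (hf.mono fun x hx _ => ⟨(), hx⟩)
  filter_upwards [h, hf] with x hx hfx
  exact (hx (hv ▸ hfx)).elim fun _ => id

theorem map_indLp_compl (hT : T ∈ disjointnessPreserving p) {A : Set ℝ} (hA : MeasurableSet A) :
    ∀ᵐ x ∂leb01, T (indLp p hA) x * T (indLp p hA.compl) x = 0 ∧
      T (indLp p hA) x + T (indLp p hA.compl) x = T (indLp p .univ) x := by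
  have h_disj : DisjointLp (indLp p hA) (indLp p hA.compl) := by
    filter_upwards [coeFn_indLp p hA, coeFn_indLp p hA.compl] with x h h'
    rw [h, h']
    by_cases hx : x ∈ A <;> simp [hx]
  have h_add : indLp p hA + indLp p hA.compl = indLp p .univ := by
    refine Lp.ext ((Lp.coeFn_add _ _).trans ?_)
    filter_upwards [coeFn_indLp p hA, coeFn_indLp p hA.compl, coeFn_indLp p .univ] with x h h' h₁
    rw [Pi.add_apply, h, h', h₁]
    by_cases hx : x ∈ A <;> simp [hx]
  rw [← h_add, map_add]
  filter_upwards [(hT _ _).2 h_disj, Lp.coeFn_add (T (indLp p hA)) (T (indLp p hA.compl))]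
    with x h_mul h_add
  exact ⟨h_mul, h_add.symm⟩

theorem map_indLp_eq_map_indLp_univ (hT : T ∈ disjointnessPreserving p) {A : Set ℝ}
    (hA : MeasurableSet A) :
    ∀ᵐ x ∂leb01, T (indLp p hA) x ≠ 0 → T (indLp p hA) x = T (indLp p .univ) x := by
  filter_upwards [map_indLp_compl hT hA] with x ⟨h_mul, h_add⟩ hx
  rw [← h_add, (mul_eq_zero.1 h_mul).resolve_left hx, add_zero]

open Classical in
/-- The point map inducing a disjointness preserving isometry `T`: it is read off the supports of
the functions `T 1_(-∞, q)`. -/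
noncomputable def pointMap (T : IsomLp p) (x : ℝ) : ℝ :=
  ⨅ q : ℚ≥0, if T (indLp p (measurableSet_Iio (a := (q : ℝ)))) x ≠ 0 then (q : ℝ) else 1

theorem pointMap_lt_iff (T : IsomLp p) (x : ℝ) {c : ℝ} (hc : c ≤ 1) :
    pointMap T x < c ↔
      ∃ q : {q : ℚ≥0 // (q : ℝ) < c}, T (indLp p (measurableSet_Iio (a := (q : ℝ)))) x ≠ 0 := by
  rw [pointMap, ciInf_lt_iff ⟨0, by rintro _ ⟨q, rfl⟩; positivity⟩, Subtype.exists]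
  refine exists_congr fun q => ?_
  split_ifs with h
  · exact ⟨fun hq => ⟨hq, h⟩, fun ⟨hq, _⟩ => hq⟩
  · exact ⟨fun hq => absurd hq hc.not_gt, fun ⟨_, h'⟩ => absurd h' h⟩

theorem pointMap_le_one (T : IsomLp p) (x : ℝ) : pointMap T x ≤ 1 := by
  refine (ciInf_le ⟨0, by rintro _ ⟨q, rfl⟩; positivity⟩ 0).trans ?_
  split_ifs <;> simp

theorem measurable_pointMap (T : IsomLp p) : Measurable (pointMap T) :=
  .iInf fun _ => .ite ((Lp.stronglyMeasurable _).measurable (measurableSet_singleton 0)).compl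
    measurable_const measurable_const

theorem map_indLp_Iio_ne_zero_iff (hT : T ∈ disjointnessPreserving p) (c : ℝ) :
    ∀ᵐ x ∂leb01, T (indLp p (measurableSet_Iio (a := c))) x ≠ 0 ↔ pointMap T x < c := by
  have h_mem : ∀ᵐ x ∂leb01, x ∈ Set.Ioo (0 : ℝ) 1 := ae_restrict_mem measurableSet_Ioo
  have h_ne (b : ℝ) := indLp_ne_zero_iff p (measurableSet_Iio (a := b))
  rcases le_or_gt c 1 with hc | hc
  · simp_rw [pointMap_lt_iff T _ hc]
    refine map_ne_zero_iff_exists hT ?_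
    filter_upwards [h_mem, h_ne c, ae_all_iff.2 fun q : {q : ℚ≥0 // (q : ℝ) < c} => h_ne q]
      with x hx hxc hxq
    simp only [hxc, hxq, Set.mem_Iio]
    refine ⟨fun h => ?_, fun ⟨q, hq⟩ => hq.trans q.2⟩
    obtain ⟨q, hxq, hqc⟩ := exists_rat_btwn h
    exact ⟨⟨⟨q, by exact_mod_cast (hx.1.trans hxq).le⟩, hqc⟩, hxq⟩
  · filter_upwards [map_ne_zero_ae hT (by
      filter_upwards [h_mem, h_ne c] with x hx hxc using hxc.2 (hx.2.trans hc))] with x hx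
    exact iff_of_true hx ((pointMap_le_one T x).trans_lt hc)

theorem map_indLp_ne_zero_iff (hT : T ∈ disjointnessPreserving p) {A : Set ℝ}
    (hA : MeasurableSet A) : ∀ᵐ x ∂leb01, T (indLp p hA) x ≠ 0 ↔ pointMap T x ∈ A := by
  induction A, hA using MeasurableSpace.induction_on_inter (borel_eq_generateFrom_Iio ℝ)
    isPiSystem_Iio with
  | empty =>
    filter_upwards [map_ne_zero_iff_exists (f := indLp p .empty) (g := Empty.elim) hT
      ((indLp_ne_zero_iff p .empty).mono fun x hx => by simpa using hx)] with x hx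
    simpa using hx
  | basic t ht =>
    obtain ⟨c, rfl⟩ := ht
    exact map_indLp_Iio_ne_zero_iff hT c
  | compl A hA ih =>
    have h_univ : ∀ᵐ x ∂leb01, T (indLp p .univ) x ≠ 0 :=
      map_ne_zero_ae hT ((indLp_ne_zero_iff p .univ).mono fun x hx => hx.2 trivial)
    filter_upwards [ih, map_indLp_compl hT hA, h_univ] with x ih ⟨h_mul, h_add⟩ h_univ
    rw [Set.mem_compl_iff, ← ih, not_not]
    refine ⟨(mul_eq_zero.1 h_mul).resolve_right, fun h => ?_⟩
    rwa [← h_add, h, zero_add] at h_univ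
  | iUnion A _ hA ih =>
    have h_supp : ∀ᵐ x ∂leb01, indLp p (.iUnion hA) x ≠ 0 ↔ ∃ i, indLp p (hA i) x ≠ 0 := by
      filter_upwards [indLp_ne_zero_iff p (.iUnion hA),
        ae_all_iff.2 fun i => indLp_ne_zero_iff p (hA i)] with x h_iUnion h
      simp only [h_iUnion, h, Set.mem_iUnion]
    filter_upwards [ae_all_iff.2 ih, map_ne_zero_iff_exists hT h_supp] with x ih hx
    simp only [hx, ih, Set.mem_iUnion]

theorem quasiMeasurePreserving_pointMap (hT : T ∈ disjointnessPreserving p) :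
    Measure.QuasiMeasurePreserving (pointMap T) leb01 leb01 := by
  refine ⟨measurable_pointMap T, Measure.AbsolutelyContinuous.mk fun A hA h₀ => ?_⟩
  rw [Measure.map_apply (measurable_pointMap T) hA, measure_eq_zero_iff_ae_notMem]
  have h_supp : ∀ᵐ x ∂leb01, indLp p hA x ≠ 0 → ∃ i, (Empty.elim i : LpI p) x ≠ 0 := by
    filter_upwards [indLp_ne_zero_iff p hA, measure_eq_zero_iff_ae_notMem.1 h₀] with x hx hxA h
    exact absurd (hx.1 h) hxA
  filter_upwards [map_indLp_ne_zero_iff hT hA, exists_map_ne_zero hT h_supp] with x hx h_empty hxA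
  exact (h_empty (hx.2 hxA)).elim fun i => i.elim

theorem isWeightedComp_of_disjointnessPreserving (hp : p ≠ ∞) (hT : T ∈ disjointnessPreserving p) :
    IsWeightedComp T (T (indLp p .univ)) (pointMap T) := by
  have hφ := quasiMeasurePreserving_pointMap hT
  refine ⟨(Lp.stronglyMeasurable _).measurable, hφ, fun f => ?_⟩
  refine Lp.induction hp (fun f => T f =ᵐ[leb01] fun x => T (indLp p .univ) x * f (pointMap T x))
    (fun c A hA _ => ?_) (fun f g hf hg _ hTf hTg => ?_)
    (isSeqClosed_iff_isClosed.1 fun f g hTf hfg => ?_) f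
  · rw [Lp.simpleFunc.coe_indicatorConst, indicatorConstLp_eq_smul_indLp, map_smul]
    filter_upwards [map_indLp_ne_zero_iff hT hA, map_indLp_eq_map_indLp_univ hT hA,
      hφ.ae (coeFn_indLp p hA), hφ.ae (Lp.coeFn_smul c (indLp p hA)),
      Lp.coeFn_smul c (T (indLp p hA))] with x h_iff h_eq h_ind h_smul h_smul'
    rw [h_smul', h_smul, Pi.smul_apply, Pi.smul_apply, h_ind, smul_eq_mul, smul_eq_mul]
    by_cases hx : pointMap T x ∈ A
    · rw [h_eq (h_iff.2 hx), Set.indicator_of_mem hx, mul_one, mul_comm]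
    · rw [not_not.1 (mt h_iff.1 hx), Set.indicator_of_notMem hx, mul_zero, mul_zero]
  · rw [map_add]
    filter_upwards [hTf, hTg, Lp.coeFn_add (T (hf.toLp f)) (T (hg.toLp g)),
      hφ.ae (Lp.coeFn_add (hf.toLp f) (hg.toLp g))] with x hTf hTg h_add' h_add
    rw [h_add', h_add, Pi.add_apply, Pi.add_apply, hTf, hTg, mul_add]
  · obtain ⟨ns, hns, hf⟩ := (tendstoInMeasure_of_tendsto_Lp hfg).exists_seq_tendsto_ae
    obtain ⟨ms, hms, hT'⟩ := (tendstoInMeasure_of_tendsto_Lp (((T.continuous.tendsto g).comp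
      hfg).comp hns.tendsto_atTop)).exists_seq_tendsto_ae
    filter_upwards [hφ.ae hf, hT', ae_all_iff.2 hTf] with x hf hT' hTf
    exact tendsto_nhds_unique hT' (((hf.comp hms.tendsto_atTop).const_mul _).congr fun i =>
      (hTf _).symm)

end Representation

/-! ## Compatible actions and twisted sums -/

section Compatibility

variable {G X Y E : Type*} [Monoid G] [NormedAddCommGroup X] [NormedSpace ℂ X]
  [NormedAddCommGroup Y] [NormedSpace ℂ Y] [AddCommGroup E] [Module ℂ E]
  {ι : X →ₗ[ℂ] E} {e e' : E} {r r' : ℝ}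

theorem NormLE.add (h : NormLE ι e r) (h' : NormLE ι e' r') : NormLE ι (e + e') (r + r') := by
  obtain ⟨x, rfl, hx⟩ := h
  obtain ⟨x', rfl, hx'⟩ := h'
  exact ⟨x + x', map_add _ _ _, (norm_add_le _ _).trans (add_le_add hx hx')⟩

theorem NormLE.smul (c : ℂ) (h : NormLE ι e r) : NormLE ι (c • e) (‖c‖ * r) := by
  obtain ⟨x, rfl, hx⟩ := h
  exact ⟨c • x, map_smul _ _ _, by rw [norm_smul]; gcongr⟩

theorem NormLE.sub (h : NormLE ι e r) (h' : NormLE ι e' r') : NormLE ι (e - e') (r + r') := by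
  obtain ⟨x, rfl, hx⟩ := h
  obtain ⟨x', rfl, hx'⟩ := h'
  exact ⟨x - x', map_sub _ _ _, (norm_sub_le _ _).trans (add_le_add hx hx')⟩

theorem NormLE.mono (h : NormLE ι e r) (hr : r ≤ r') : NormLE ι e r' :=
  h.imp fun _ hx => ⟨hx.1, hx.2.trans hr⟩

omit [NormedSpace ℂ Y] in
theorem NormLE.twistedNorm_le {Ω : Y → E} {y : Y} (h : NormLE ι (e - Ω y) r) :
    twistedNorm ι Ω (e, y) ≤ r + ‖y‖ := by
  obtain ⟨x, hx, hxr⟩ := h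
  have h_bdd : BddBelow {r : ℝ | ∃ x : X, ι x = e - Ω y ∧ r = ‖x‖} := by
    refine ⟨0, ?_⟩
    rintro _ ⟨x', -, rfl⟩
    positivity
  exact add_le_add ((csInf_le h_bdd ⟨x, hx, rfl⟩).trans hxr) le_rfl

omit [NormedSpace ℂ Y] in
theorem twistedNorm_eq (hι : Function.Injective ι) {Ω : Y → E} {y : Y} {x : X}
    (hx : ι x = e - Ω y) : twistedNorm ι Ω (e, y) = ‖x‖ + ‖y‖ := by
  have h_eq : {r : ℝ | ∃ x : X, ι x = e - Ω y ∧ r = ‖x‖} = {‖x‖} :=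
    Set.ext fun r => ⟨fun ⟨x', hx', hr⟩ => by rw [hr, hι (hx'.trans hx.symm)]; rfl,
      fun hr => ⟨x, hx, hr⟩⟩
  rw [twistedNorm, h_eq, csInf_singleton]

variable {U : G →* Module.End ℂ E} {v : G →* Module.End ℂ Y} {Ω : Y → E} {d : G → (Y →ₗ[ℂ] E)}

theorem isActionDerivation_of_eq_neg_commutator (h : ∀ g y, d g y = -actionCommutator U v Ω g y) :
    IsActionDerivation U v d := by
  intro g g'
  ext1 y
  simp only [LinearMap.add_apply, LinearMap.comp_apply, h, actionCommutator, map_mul, map_neg,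
    map_sub, Module.End.mul_apply]
  abel

theorem isCompatibleVia_of_eq_neg_commutator (hΩ : IsQuasiLinear ι Ω)
    (h : ∀ g y, d g y = -actionCommutator U v Ω g y) : IsCompatibleVia ι U v Ω d :=
  ⟨hΩ, isActionDerivation_of_eq_neg_commutator h, 0, fun g y => ⟨0, by simp [h], by simp⟩⟩

theorem IsActionDerivation.smul (h : IsActionDerivation U v d) (c : ℂ) :
    IsActionDerivation U v (fun g => c • d g) := by
  intro g g'
  ext1 y
  simp [h g g']

theorem IsActionDerivation.map_one (h : IsActionDerivation U v d) : d 1 = 0 := by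
  have h₁ := h 1 1
  rwa [mul_one, U.map_one, v.map_one, Module.End.one_eq_id, Module.End.one_eq_id,
    LinearMap.id_comp, LinearMap.comp_id, left_eq_add] at h₁

theorem IsQuasiLinear.of_bounded_sub_smul (hΩ : IsQuasiLinear ι Ω) {Ω' : Y → E}
    (hΩ' : ∀ (c : ℂ) (y : Y), Ω' (c • y) = c • Ω' y) (c : ℂ) {K : ℝ}
    (h : ∀ y, NormLE ι (Ω' y - c • Ω y) (K * ‖y‖)) : IsQuasiLinear ι Ω' := by
  obtain ⟨C, hC⟩ := hΩ.2
  refine ⟨hΩ', ‖c‖ * C + 2 * |K|, fun y y' => ?_⟩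
  have h_sum := ((((hC y y').smul c).add (h (y + y'))).sub (h y)).sub (h y')
  have h_bound (z : Y) : K * ‖z‖ ≤ |K| * ‖z‖ := by gcongr; exact le_abs_self K
  have h_add : |K| * ‖y + y'‖ ≤ |K| * (‖y‖ + ‖y'‖) := by gcongr; exact norm_add_le y y'
  convert h_sum.mono (r' := (‖c‖ * C + 2 * |K|) * (‖y‖ + ‖y'‖)) ?_ using 1
  · simp only [smul_sub]; abel
  · linarith [h_bound (y + y'), h_bound y, h_bound y']

variable {M : ℝ} (hU : ∀ g e r, NormLE ι e r → NormLE ι (U g e) (M * r))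
  (hv : ∀ g y, ‖v g y‖ ≤ M * ‖y‖)

include hU hv

theorem IsCompatibleVia.of_bounded_sub_smul (h : IsCompatibleVia ι U v Ω d) {Ω' : Y → E}
    (hΩ' : ∀ (c : ℂ) (y : Y), Ω' (c • y) = c • Ω' y) (c : ℂ) {K : ℝ} (hK₀ : 0 ≤ K)
    (hK : ∀ y, NormLE ι (Ω' y - c • Ω y) (K * ‖y‖)) :
    IsCompatibleVia ι U v Ω' (fun g => c • d g) := by
  obtain ⟨hΩ, hd, C, hC⟩ := h
  refine ⟨hΩ.of_bounded_sub_smul hΩ' c hK, hd.smul c, ‖c‖ * C + 2 * K * M, fun g y => ?_⟩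
  have h_sum := (((hC g y).smul c).add (hU g _ _ (hK y))).sub (hK (v g y))
  have h_norm : K * ‖v g y‖ ≤ K * (M * ‖y‖) := by gcongr; exact hv g y
  convert h_sum.mono (r' := (‖c‖ * C + 2 * K * M) * ‖y‖) ?_ using 1
  · simp only [actionCommutator, LinearMap.smul_apply, smul_add, smul_sub, map_sub, map_smul]
    abel
  · linarith

omit hU hv in
/-- The triangular action `g ↦ (g, d g; 0, g)` on the product, defined by a derivation `d`. -/
def triangularAction (hd : IsActionDerivation U v d) : G →* Module.End ℂ (E × Y) where
  toFun g := ((U g).coprod (d g)).prod ((v g).comp (LinearMap.snd ℂ E Y))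
  map_one' := by
    ext z <;> simp [hd.map_one]
  map_mul' g g' := by
    ext z <;> simp [hd g g']

theorem IsCompatibleVia.exists_action_twistedSum (hι : Function.Injective ι)
    (h : IsCompatibleVia ι U v Ω d) :
    ∃ Λ : G →* Module.End ℂ (twistedSum ι Ω h.1),
      (∀ g (z : twistedSum ι Ω h.1),
        (Λ g z : E × Y) = (U g (z : E × Y).1 + d g (z : E × Y).2, v g (z : E × Y).2)) ∧
      ∃ C : ℝ, ∀ g (z : twistedSum ι Ω h.1),
        twistedNorm ι Ω (Λ g z : E × Y) ≤ C * twistedNorm ι Ω (z : E × Y) := by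
  obtain ⟨hΩ, hd, C, hC⟩ := h
  have h_norm (g : G) {e : E} {y : Y} {x : X} (hx : ι x = e - Ω y) :
      NormLE ι (U g e + d g y - Ω (v g y)) (M * ‖x‖ + C * ‖y‖) := by
    convert (hU g _ _ ⟨x, hx, le_rfl⟩).add (hC g y) using 1
    rw [actionCommutator, map_sub]
    abel
  have h_mem (g : G) : ∀ z ∈ twistedSum ι Ω hΩ, triangularAction hd g z ∈ twistedSum ι Ω hΩ :=
    fun z ⟨x, hx⟩ => (h_norm g hx).imp fun _ => And.left
  refine ⟨⟨⟨fun g => (triangularAction hd g).restrict (h_mem g), ?_⟩, fun g g' => ?_⟩,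
    fun g z => rfl, |M| + |C|, fun g ⟨⟨e, y⟩, x, hx⟩ => ?_⟩
  · ext1 z
    exact Subtype.ext (by simp)
  · ext1 z
    exact Subtype.ext (by simp)
  · refine (h_norm g hx).twistedNorm_le.trans ?_
    rw [twistedNorm_eq hι hx]
    have h_abs {a t : ℝ} (ht : 0 ≤ t) : a * t ≤ |a| * t := by gcongr; exact le_abs_self a
    linarith [hv g y, h_abs (a := M) (norm_nonneg x), h_abs (a := C) (norm_nonneg y),
      h_abs (a := M) (norm_nonneg y), mul_nonneg (abs_nonneg C) (norm_nonneg x)]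

end Compatibility

section KaltonPeck

variable {p : ℝ≥0∞} [Fact (1 ≤ p)] {T : IsomLp p} {V : Module.End ℂ L0} {W : ℝ → ℂ} {φ : ℝ → ℝ}

theorem IsContinuousExtension.kaltonPeck_sub (hV : IsContinuousExtension T V)
    (hT : IsWeightedComp T W φ) (f : LpI p) :
    (V (kaltonPeck p f) - kaltonPeck p (T f) : L0) =ᵐ[leb01]
      fun x => -((Real.log ‖W x‖ : ℂ) * T f x) := by
  filter_upwards [AEEqFun.coeFn_sub (V (kaltonPeck p f)) (kaltonPeck p (T f)),
    hV.coeFn_eq hT (kaltonPeck p f), hT.quasiMeasurePreserving.ae (kaltonPeck_ae one_pos f),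
    kaltonPeck_ae one_pos (T f), hT.coeFn_eq f] with x h_sub hVf hf hTf hT
  rw [h_sub, Pi.sub_apply, hVf, hf, hTf, hT, T.norm_map]
  rcases eq_or_ne (W x) 0 with hW | hW
  · simp [hW]
  rcases eq_or_ne (f (φ x)) 0 with hfx | hfx
  · simp [hfx]
  simp only [div_one, norm_mul]
  rw [Real.log_mul (norm_ne_zero_iff.2 hW) (norm_ne_zero_iff.2 hfx)]
  push_cast
  ring

theorem IsContinuousExtension.normLE (hV : IsContinuousExtension T V) {e : L0} {r : ℝ}
    (h : NormLE (toL0 p) e r) : NormLE (toL0 p) (V e) r := by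
  obtain ⟨f, rfl, hf⟩ := h
  exact ⟨T f, (hV.1 f).symm, (T.norm_map f).trans_le hf⟩

theorem exists_extendedAction (hp : p ≠ ∞) {G : Subgroup (IsomLp p)}
    (hG : G ≤ disjointnessPreserving p) :
    ∃ U : G →* Module.End ℂ L0, ∀ g : G, IsContinuousExtension (g : IsomLp p) (U g) := by
  choose V hV _ using fun g : G =>
    (isWeightedComp_of_disjointnessPreserving hp (hG g.2)).exists_isContinuousExtension
  exact ⟨⟨⟨V, (hV 1).unique .one⟩, fun g g' => (hV (g * g')).unique ((hV g).mul (hV g'))⟩, hV⟩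

theorem exists_derivation (hp : p ≠ ∞) {G : Subgroup (IsomLp p)}
    (hG : G ≤ disjointnessPreserving p) {U : G →* Module.End ℂ L0}
    (hU : ∀ g : G, IsContinuousExtension (g : IsomLp p) (U g)) :
    ∃ d : G → (LpI p →ₗ[ℂ] L0), ∀ (g : G) (f : LpI p),
      d g f = -actionCommutator U (naturalAction G) (kaltonPeck p) g f := by
  suffices h : ∀ g : G, ∃ D : LpI p →ₗ[ℂ] L0, ∀ f,
      D f = -actionCommutator U (naturalAction G) (kaltonPeck p) g f from Classical.skolem.1 h
  intro g
  have hg := isWeightedComp_of_disjointnessPreserving hp (hG g.2)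
  set a : ℝ → ℂ := fun x => Real.log ‖(g : IsomLp p) (indLp p .univ) x‖
  have ha : AEStronglyMeasurable a leb01 := (Complex.measurable_ofReal.comp
    (Real.measurable_log.comp hg.measurable_weight.norm)).aestronglyMeasurable
  refine ⟨(weightedComp (.mk a ha) (.id leb01)).comp ((toL0 p).comp (naturalAction G g)),
    fun f => AEEqFun.ext ?_⟩
  filter_upwards [coeFn_weightedComp (.mk a ha) (.id leb01) (toL0 p ((g : IsomLp p) f)),
    AEEqFun.coeFn_mk a ha, (hU g).kaltonPeck_sub hg f,
    AEEqFun.coeFn_neg (U g (kaltonPeck p f) - kaltonPeck p ((g : IsomLp p) f))]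
    with x h_comp h_mk h_sub h_neg
  refine h_comp.trans (Eq.trans ?_ h_neg.symm)
  rw [Pi.neg_apply, h_sub, neg_neg, h_mk]
  rfl

end KaltonPeck

/-! ## Calderón functions of the couple `(L_∞, L_1)` -/

section Calderon

open Complex.HadamardThreeLines

theorem openStrip_eq_verticalStrip : openStrip = verticalStrip 0 1 := rfl

theorem closedStrip_eq_verticalClosedStrip : closedStrip = verticalClosedStrip 0 1 := rfl

theorem closure_openStrip : closure openStrip = closedStrip := by
  rw [openStrip_eq_verticalStrip, closedStrip_eq_verticalClosedStrip, verticalStrip,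
    verticalClosedStrip, Complex.closure_preimage_re, closure_Ioo zero_ne_one]

theorem isOpen_openStrip : IsOpen openStrip :=
  isOpen_Ioo.preimage Complex.continuous_re

theorem openStrip_subset_closedStrip : openStrip ⊆ closedStrip :=
  fun _ hz => ⟨hz.1.le, hz.2.le⟩

theorem ofReal_mem_openStrip {θ : ℝ} (hθ : θ ∈ Set.Ioo 0 1) : (θ : ℂ) ∈ openStrip := hθ

theorem mul_I_mem_closedStrip (t : ℝ) : t * Complex.I ∈ closedStrip := by simp [closedStrip]

theorem one_add_mul_I_mem_closedStrip (t : ℝ) : 1 + t * Complex.I ∈ closedStrip := by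
  simp [closedStrip]

theorem im_mul_I_eq {z : ℂ} (hz : z.re = 0) : z.im * Complex.I = z := by
  apply Complex.ext <;> simp [hz]

theorem one_add_im_mul_I_eq {z : ℂ} (hz : z.re = 1) : 1 + z.im * Complex.I = z := by
  apply Complex.ext <;> simp [hz]

variable {F H : ℂ → LpI 1} {r s θ : ℝ}

theorem CalderonNormLE.nonneg (h : CalderonNormLE F r) : 0 ≤ r :=
  (norm_nonneg _).trans (h.2.2.2.2 0)

theorem CalderonNormLE.sub (hF : CalderonNormLE F r) (hH : CalderonNormLE H s) :
    CalderonNormLE (F - H) (r + s) := by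
  obtain ⟨F_cont, F_diff, ⟨M, hM⟩, F_zero, F_one⟩ := hF
  obtain ⟨H_cont, H_diff, ⟨M', hM'⟩, H_zero, H_one⟩ := hH
  refine ⟨F_cont.sub H_cont, F_diff.sub H_diff, ⟨M + M', fun z hz => ?_⟩, fun t => ?_,
    fun t => ?_⟩
  · exact (norm_sub_le _ _).trans (add_le_add (hM z hz) (hM' z hz))
  · filter_upwards [F_zero t, H_zero t, Lp.coeFn_sub (F (t * Complex.I)) (H (t * Complex.I))]
      with x hFx hHx hx
    rw [Pi.sub_apply, hx]
    exact (norm_sub_le _ _).trans (add_le_add hFx hHx)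
  · exact (norm_sub_le _ _).trans (add_le_add (F_one t) (H_one t))

-- `|z - θ| ≥ min θ (1 - θ)` on the boundary of the strip.
theorem CalderonNormLE.dslope (hF : CalderonNormLE F r) (hθ : θ ∈ Set.Ioo 0 1)
    (hFθ : F θ = 0) : CalderonNormLE (dslope F θ) (r / min θ (1 - θ)) := by
  obtain ⟨F_cont, F_diff, ⟨M, hM⟩, F_zero, F_one⟩ := hF
  set δ := min θ (1 - θ)
  have hδ : 0 < δ := lt_min hθ.1 (sub_pos.2 hθ.2)
  have hmem := ofReal_mem_openStrip hθ
  have hnhds : openStrip ∈ 𝓝 (θ : ℂ) := isOpen_openStrip.mem_nhds hmem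
  have hd : DifferentiableOn ℂ (_root_.dslope F θ) openStrip :=
    (Complex.differentiableOn_dslope hnhds).2 F_diff
  have hc : ContinuousOn (_root_.dslope F θ) closedStrip :=
    (continuousOn_dslope (mem_of_superset hnhds openStrip_subset_closedStrip)).2
      ⟨F_cont, F_diff.differentiableAt hnhds⟩
  have eq_smul {z : ℂ} (hz : δ ≤ ‖z - θ‖) : _root_.dslope F θ z = (z - θ)⁻¹ • F z := by
    have hne : z ≠ θ := fun h => by simp [h] at hz; linarith
    rw [dslope_of_ne _ hne, slope_def_module, hFθ, sub_zero]
  have norm_inv_le {z : ℂ} (hz : δ ≤ ‖z - θ‖) : ‖(z - θ)⁻¹‖ ≤ δ⁻¹ := by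
    rw [norm_inv]; gcongr
  have norm_le {z : ℂ} {K : ℝ} (hz : δ ≤ ‖z - θ‖) (hK : ‖F z‖ ≤ K) :
      ‖_root_.dslope F θ z‖ ≤ K / δ := by
    rw [eq_smul hz, norm_smul, div_eq_inv_mul]
    exact mul_le_mul (norm_inv_le hz) hK (norm_nonneg _) (by positivity)
  have le_zero (t : ℝ) : δ ≤ ‖t * Complex.I - θ‖ := by
    refine (min_le_left _ _).trans ((le_abs_self _).trans ?_)
    simpa using Complex.abs_re_le_norm (t * Complex.I - θ)
  have le_one (t : ℝ) : δ ≤ ‖1 + t * Complex.I - θ‖ := by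
    refine (min_le_right _ _).trans ((le_abs_self _).trans ?_)
    simpa using Complex.abs_re_le_norm (1 + t * Complex.I - θ)
  refine ⟨hc, hd, ?_, fun t => ?_, fun t => norm_le (le_one t) (F_one t)⟩
  · obtain ⟨K, hK⟩ := ((isCompact_closedBall (θ : ℂ) δ).inter_left isClosed_closure
      ).exists_bound_of_continuousOn (closure_openStrip ▸ hc.mono Set.inter_subset_left)
    refine ⟨max K (M / δ), fun z hz => ?_⟩
    rcases le_total ‖z - θ‖ δ with h | h
    · refine (hK z ⟨closure_openStrip ▸ hz, ?_⟩).trans (le_max_left _ _)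
      rwa [Metric.mem_closedBall, dist_eq_norm]
    · exact (norm_le h (hM z hz)).trans (le_max_right _ _)
  · rw [eq_smul (le_zero t)]
    filter_upwards [F_zero t, Lp.coeFn_smul (t * Complex.I - θ)⁻¹ (F (t * Complex.I))] with x hx h
    rw [h, Pi.smul_apply, norm_smul, div_eq_inv_mul]
    exact mul_le_mul (norm_inv_le (le_zero t)) hx (norm_nonneg _) (by positivity)

end Calderon

/-! ## The interpolation space of `(L_∞, L_1)` at `1 / p` is contained in `L_p` -/

section Interpolation

variable {α : Type*} [MeasurableSpace α] {μ : Measure α}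

theorem exists_clm_eq_integral_mul {σ : α → ℂ} (hσ : MemLp σ ∞ μ) :
    ∃ L : Lp ℂ 1 μ →L[ℂ] ℂ, ∀ F : Lp ℂ 1 μ, L F = ∫ x, σ x * F x ∂μ := by
  have : ENNReal.HolderConjugate ∞ 1 := .top_one
  refine ⟨(ContinuousLinearMap.mul ℂ ℂ).lpPairing μ ∞ 1 (hσ.toLp σ), fun F => ?_⟩
  rw [ContinuousLinearMap.lpPairing_eq_integral]
  refine integral_congr_ae ?_
  filter_upwards [hσ.coeFn_toLp] with x hx
  rw [ContinuousLinearMap.mul_apply', hx]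

/-- The simple function `φ ^ (1 - z)`, with value `0` wherever `φ` vanishes, so that it is analytic
in `z`. -/
noncomputable def cpowOneSub (φ : SimpleFunc α NNReal) (z : ℂ) (x : α) : ℂ :=
  if φ x = 0 then 0 else ((φ x : ℝ) : ℂ) ^ (1 - z)

theorem cpowOneSub_eq_sum (φ : SimpleFunc α NNReal) (z : ℂ) (x : α) :
    cpowOneSub φ z x =
      ∑ c ∈ φ.range.erase 0, (φ ⁻¹' {c}).indicator (fun _ => ((c : ℝ) : ℂ) ^ (1 - z)) x := by
  have hind (c : NNReal) : (φ ⁻¹' {c}).indicator (fun _ => ((c : ℝ) : ℂ) ^ (1 - z)) x =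
      if φ x = c then ((c : ℝ) : ℂ) ^ (1 - z) else 0 := by
    by_cases hx : φ x = c <;> simp [hx]
  simp only [hind, Finset.sum_ite_eq, Finset.mem_erase, SimpleFunc.mem_range_self, and_true,
    cpowOneSub, ite_not]

theorem norm_cpowOneSub_le (φ : SimpleFunc α NNReal) (z : ℂ) (x : α) :
    ‖cpowOneSub φ z x‖ ≤ (φ x : ℝ) ^ (1 - z.re) := by
  rw [cpowOneSub]
  split_ifs with h
  · rw [norm_zero]
    positivity
  · rw [Complex.norm_cpow_eq_rpow_re_of_pos (NNReal.coe_pos.2 (pos_iff_ne_zero.2 h))]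
    simp

theorem cpowOneSub_ofReal (φ : SimpleFunc α NNReal) {θ : ℝ} (hθ : θ < 1) (x : α) :
    cpowOneSub φ θ x = ((φ x : ℝ) ^ (1 - θ) : ℝ) := by
  rw [cpowOneSub]
  split_ifs with h
  · simp [h, Real.zero_rpow (sub_pos.2 hθ).ne']
  · rw [Complex.ofReal_cpow (NNReal.coe_nonneg _)]
    simp

theorem integrable_simpleFunc_rpow_mul_norm (φ : SimpleFunc α NNReal) (t : ℝ) (F : Lp ℂ 1 μ) :
    Integrable (fun x => (φ x : ℝ) ^ t * ‖F x‖) μ := by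
  obtain ⟨C, hC⟩ := (φ.map fun c : NNReal => (c : ℝ) ^ t).exists_forall_norm_le
  exact (L1.integrable_coeFn F).norm.bdd_mul
    (φ.map fun c : NNReal => (c : ℝ) ^ t).aestronglyMeasurable (.of_forall hC)

theorem norm_integral_cpowOneSub_mul_le (φ : SimpleFunc α NNReal) {σ : α → ℂ}
    (hσ : ∀ x, ‖σ x‖ ≤ 1) (z : ℂ) (F : Lp ℂ 1 μ) :
    ‖∫ x, cpowOneSub φ z x * (σ x * F x) ∂μ‖ ≤ ∫ x, (φ x : ℝ) ^ (1 - z.re) * ‖F x‖ ∂μ := by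
  refine norm_integral_le_of_norm_le (integrable_simpleFunc_rpow_mul_norm φ _ F)
    (.of_forall fun x => ?_)
  rw [norm_mul, norm_mul]
  exact mul_le_mul (norm_cpowOneSub_le φ z x) (mul_le_of_le_one_left (norm_nonneg _) (hσ x))
    (by positivity) (by positivity)

theorem exists_integral_cpowOneSub_mul_eq_sum (φ : SimpleFunc α NNReal) {σ : α → ℂ}
    (hσ : MemLp σ ∞ μ) :
    ∃ L : NNReal → Lp ℂ 1 μ →L[ℂ] ℂ, ∀ (z : ℂ) (F : Lp ℂ 1 μ),
      ∫ x, cpowOneSub φ z x * (σ x * F x) ∂μ =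
        ∑ c ∈ φ.range.erase 0, ((c : ℝ) : ℂ) ^ (1 - z) * L c F := by
  have hfib (c : NNReal) : MemLp ((φ ⁻¹' {c}).indicator σ) ∞ μ :=
    hσ.indicator (φ.measurableSet_preimage _)
  choose L hL using fun c => exists_clm_eq_integral_mul (hfib c)
  refine ⟨L, fun z F => ?_⟩
  have : ENNReal.HolderConjugate ∞ 1 := .top_one
  have hint (c : NNReal) : Integrable (fun x => (φ ⁻¹' {c}).indicator σ x * F x) μ :=
    (hfib c).integrable_mul (memLp_one_iff_integrable.2 (L1.integrable_coeFn F))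
  simp only [hL, ← integral_const_mul]
  rw [← integral_finsetSum _ fun c _ => (hint c).const_mul _]
  refine integral_congr_ae (.of_forall fun x => ?_)
  simp only [cpowOneSub_eq_sum, Finset.sum_mul]
  refine Finset.sum_congr rfl fun c _ => ?_
  by_cases hx : φ x = c <;> simp [hx]

/-- The signum of the conjugate. -/
noncomputable def conjSign (w : ℂ) : ℂ := (starRingEnd ℂ) w / ‖w‖

theorem conjSign_mul (w : ℂ) : conjSign w * w = ‖w‖ := by
  by_cases hw : w = 0
  · simp [hw]
  have : (‖w‖ : ℂ) ≠ 0 := by exact_mod_cast norm_ne_zero_iff.2 hw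
  rw [conjSign, div_mul_eq_mul_div, Complex.conj_mul', div_eq_iff this, sq]

theorem norm_conjSign_le (w : ℂ) : ‖conjSign w‖ ≤ 1 := by
  rw [conjSign, norm_div, Complex.norm_conj, Complex.norm_real, norm_norm]
  exact div_self_le_one _

theorem measurable_conjSign : Measurable conjSign :=
  Complex.continuous_conj.measurable.div (Complex.measurable_ofReal.comp measurable_norm)

theorem le_rpow_of_le_mul_rpow {a r θ : ℝ} (ha : 0 ≤ a) (hr : 0 ≤ r) (hθ : 0 < θ)
    (h : a ≤ r * a ^ (1 - θ)) : a ≤ r ^ (1 / θ) := by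
  rcases ha.eq_or_lt with rfl | ha
  · positivity
  have hle : a ^ θ ≤ r := by
    rwa [← mul_le_mul_iff_left₀ (Real.rpow_pos_of_pos ha (1 - θ)), ← Real.rpow_add ha,
      add_sub_cancel, Real.rpow_one]
  calc a = (a ^ θ) ^ (1 / θ) := by
        rw [← Real.rpow_mul ha.le, mul_one_div_cancel hθ.ne', Real.rpow_one]
    _ ≤ r ^ (1 / θ) := by gcongr

theorem integrable_coe_simpleFunc [IsFiniteMeasure μ] (φ : SimpleFunc α NNReal) :
    Integrable (fun x => (φ x : ℝ)) μ :=
  (φ.map ((↑) : NNReal → ℝ)).integrable_of_isFiniteMeasure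

theorem exists_memLp_of_simpleFunc_le [IsFiniteMeasure μ] {p : ℝ≥0∞} (hp₀ : p ≠ 0) (hp : p ≠ ∞)
    {h : α → ℂ} (hh : AEStronglyMeasurable h μ) {M : ℝ} (hM : 0 ≤ M)
    (hle : ∀ φ : SimpleFunc α NNReal, (∀ x, (φ x : ℝ) ≤ ‖h x‖ ^ p.toReal) →
      ∫ x, (φ x : ℝ) ∂μ ≤ M ^ p.toReal) :
    ∃ hL : MemLp h p μ, ‖hL.toLp h‖ ≤ M := by
  have hq := ENNReal.toReal_pos hp₀ hp
  have hlint : ∫⁻ x, ‖h x‖ₑ ^ p.toReal ∂μ ≤ ENNReal.ofReal M ^ p.toReal := by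
    rw [lintegral_eq_nnreal]
    refine iSup₂_le fun φ hφ => ?_
    have hφ' (x : α) : (φ x : ℝ) ≤ ‖h x‖ ^ p.toReal := by
      have := hφ x
      rwa [← ofReal_norm, ENNReal.ofReal_rpow_of_nonneg (norm_nonneg _) hq.le,
        ← ENNReal.ofReal_coe_nnreal, ENNReal.ofReal_le_ofReal_iff (by positivity)] at this
    have hint := ofReal_integral_eq_lintegral_ofReal (integrable_coe_simpleFunc (μ := μ) φ)
      (.of_forall fun x => NNReal.coe_nonneg _)
    simp only [ENNReal.ofReal_coe_nnreal] at hint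
    rw [← SimpleFunc.lintegral_eq_lintegral, ENNReal.ofReal_rpow_of_nonneg hM hq.le]
    exact hint.ge.trans (ENNReal.ofReal_le_ofReal (hle φ hφ'))
  have hnorm : eLpNorm h p μ ≤ ENNReal.ofReal M := by
    rw [eLpNorm_eq_lintegral_rpow_enorm_toReal hp₀ hp, one_div, ENNReal.rpow_inv_le_iff hq]
    exact hlint
  have hL : MemLp h p μ := ⟨hh, hnorm.trans_lt ENNReal.ofReal_lt_top⟩
  refine ⟨hL, ?_⟩
  rw [Lp.norm_toLp]
  exact ENNReal.toReal_le_of_le_ofReal hM hnorm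

variable {F : ℂ → LpI 1} {r θ : ℝ}

theorem CalderonNormLE.diffContOnCl_integral_cpowOneSub_mul (hF : CalderonNormLE F r)
    (φ : SimpleFunc ℝ NNReal) {σ : ℝ → ℂ} (hσ : MemLp σ ∞ leb01) :
    DiffContOnCl ℂ (fun z => ∫ x, cpowOneSub φ z x * (σ x * F z x) ∂leb01) openStrip := by
  obtain ⟨L, hL⟩ := exists_integral_cpowOneSub_mul_eq_sum φ hσ
  have hpow (c) (hc : c ∈ φ.range.erase 0) :
      Differentiable ℂ fun z : ℂ => ((c : ℝ) : ℂ) ^ (1 - z) := fun z =>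
    (differentiableAt_id.const_sub 1).const_cpow
      (.inl (by exact_mod_cast Finset.ne_of_mem_erase hc))
  simp only [hL]
  refine ⟨.fun_sum fun c hc => (hpow c hc).differentiableOn.mul ?_,
    continuousOn_finsetSum _ fun c hc => (hpow c hc).continuous.continuousOn.mul ?_⟩
  · exact (L c).differentiable.comp_differentiableOn hF.2.1
  · rw [closure_openStrip]
    exact (L c).continuous.comp_continuousOn hF.1

theorem CalderonNormLE.bddAbove_integral_cpowOneSub_mul (hF : CalderonNormLE F r)
    (φ : SimpleFunc ℝ NNReal) {σ : ℝ → ℂ} (hσ : ∀ x, ‖σ x‖ ≤ 1) :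
    BddAbove ((norm ∘ fun z => ∫ x, cpowOneSub φ z x * (σ x * F z x) ∂leb01) '' closedStrip) := by
  obtain ⟨M, hM⟩ := hF.2.2.1
  obtain ⟨C, hC⟩ := (φ.map ((↑) : NNReal → ℝ)).exists_forall_norm_le
  have hC₀ : 0 ≤ C := (norm_nonneg _).trans (hC 0)
  refine ⟨(1 + C) * M, ?_⟩
  rintro _ ⟨z, hz, rfl⟩
  refine (norm_integral_cpowOneSub_mul_le φ hσ z (F z)).trans ?_
  calc ∫ x, (φ x : ℝ) ^ (1 - z.re) * ‖F z x‖ ∂leb01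
      ≤ ∫ x, (1 + C) * ‖F z x‖ ∂leb01 := by
        refine integral_mono (integrable_simpleFunc_rpow_mul_norm φ _ _)
          ((L1.integrable_coeFn _).norm.const_mul _) fun x => ?_
        have hφ : (φ x : ℝ) ≤ C := (le_abs_self _).trans (hC x)
        dsimp only
        gcongr
        calc (φ x : ℝ) ^ (1 - z.re) ≤ (1 + C) ^ (1 - z.re) := by
              gcongr
              · linarith [hz.2]
              · linarith
          _ ≤ 1 + C := Real.rpow_le_self_of_one_le (by linarith) (by linarith [hz.1])
    _ = (1 + C) * ‖F z‖ := by rw [integral_const_mul, ← L1.norm_eq_integral_norm]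
    _ ≤ (1 + C) * M := by gcongr; exact hM z hz

theorem CalderonNormLE.norm_integral_cpowOneSub_mul_le_rpow (hF : CalderonNormLE F r)
    (φ : SimpleFunc ℝ NNReal) {σ : ℝ → ℂ} (hσm : Measurable σ) (hσ : ∀ x, ‖σ x‖ ≤ 1)
    (hθ : θ ∈ Set.Ioo 0 1) :
    ‖∫ x, cpowOneSub φ θ x * (σ x * F θ x) ∂leb01‖ ≤ r * (∫ x, (φ x : ℝ) ∂leb01) ^ (1 - θ) := by
  have hr := hF.nonneg
  have ha : 0 ≤ ∫ x, (φ x : ℝ) ∂leb01 := integral_nonneg fun x => NNReal.coe_nonneg _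
  have hσL : MemLp σ ∞ leb01 := memLp_top_of_bound hσm.aestronglyMeasurable 1 (.of_forall hσ)
  have hthree := Complex.HadamardThreeLines.norm_le_interp_of_mem_verticalClosedStrip₀₁'
    (a := r * ∫ x, (φ x : ℝ) ∂leb01) (b := r)
    _ (openStrip_subset_closedStrip (ofReal_mem_openStrip hθ))
    (hF.diffContOnCl_integral_cpowOneSub_mul φ hσL) (hF.bddAbove_integral_cpowOneSub_mul φ hσ)
    ?_ ?_
  · refine hthree.trans_eq ?_
    rw [Complex.ofReal_re, Real.mul_rpow hr ha, mul_right_comm,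
      ← Real.rpow_add_of_nonneg hr (sub_nonneg.2 hθ.2.le) hθ.1.le, sub_add_cancel, Real.rpow_one]
  · intro z hz
    refine (norm_integral_cpowOneSub_mul_le φ hσ z (F z)).trans ?_
    rw [← integral_const_mul, show z.re = 0 from hz, sub_zero]
    refine integral_mono_ae (integrable_simpleFunc_rpow_mul_norm φ _ _)
      ((integrable_coe_simpleFunc φ).const_mul r) ?_
    filter_upwards [hF.2.2.2.1 z.im] with x hx
    rw [im_mul_I_eq hz] at hx
    rw [Real.rpow_one, mul_comm]
    gcongr
  · intro z hz
    refine (norm_integral_cpowOneSub_mul_le φ hσ z (F z)).trans ?_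
    simp only [show z.re = 1 from hz, sub_self, Real.rpow_zero, one_mul]
    rw [← L1.norm_eq_integral_norm, ← one_add_im_mul_I_eq hz]
    exact hF.2.2.2.2 z.im

theorem CalderonNormLE.integral_simpleFunc_le (hF : CalderonNormLE F r)
    (hθ : θ ∈ Set.Ioo 0 1) (φ : SimpleFunc ℝ NNReal) (hφ : ∀ x, (φ x : ℝ) ^ θ ≤ ‖F θ x‖) :
    ∫ x, (φ x : ℝ) ∂leb01 ≤ r ^ (1 / θ) := by
  refine le_rpow_of_le_mul_rpow (integral_nonneg fun x => NNReal.coe_nonneg _) hF.nonneg hθ.1 ?_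
  have heq : ∫ x, cpowOneSub φ θ x * (conjSign (F θ x) * F θ x) ∂leb01 =
      ((∫ x, (φ x : ℝ) ^ (1 - θ) * ‖F θ x‖ ∂leb01 : ℝ) : ℂ) := by
    simp only [cpowOneSub_ofReal φ hθ.2, conjSign_mul, ← Complex.ofReal_mul,
      integral_complex_ofReal]
  calc ∫ x, (φ x : ℝ) ∂leb01 ≤ ∫ x, (φ x : ℝ) ^ (1 - θ) * ‖F θ x‖ ∂leb01 := by
        refine integral_mono (integrable_coe_simpleFunc φ)
          (integrable_simpleFunc_rpow_mul_norm φ _ _) fun x => ?_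
        calc (φ x : ℝ) = (φ x : ℝ) ^ (1 - θ) * (φ x : ℝ) ^ θ := by
              rw [← Real.rpow_add_of_nonneg (NNReal.coe_nonneg _) (sub_nonneg.2 hθ.2.le) hθ.1.le,
                sub_add_cancel, Real.rpow_one]
          _ ≤ _ := by gcongr; exact hφ x
    _ ≤ ‖∫ x, cpowOneSub φ θ x * (conjSign (F θ x) * F θ x) ∂leb01‖ := by
        rw [heq, Complex.norm_real]
        exact le_abs_self _
    _ ≤ r * (∫ x, (φ x : ℝ) ∂leb01) ^ (1 - θ) :=
        hF.norm_integral_cpowOneSub_mul_le_rpow φ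
          (measurable_conjSign.comp (Lp.stronglyMeasurable (F θ)).measurable)
          (fun x => norm_conjSign_le _) hθ

theorem one_div_toReal_mem_Ioo {p : ℝ≥0∞} (hp₁ : 1 < p) (hp : p ≠ ∞) :
    1 / p.toReal ∈ Set.Ioo (0 : ℝ) 1 := by
  have h : 1 < p.toReal := by simpa using (ENNReal.toReal_lt_toReal ENNReal.one_ne_top hp).2 hp₁
  exact ⟨by positivity, (div_lt_one (by positivity)).2 h⟩

theorem CalderonNormLE.normLE {p : ℝ≥0∞} [Fact (1 ≤ p)] (hp₁ : 1 < p) (hp : p ≠ ∞)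
    (hF : CalderonNormLE F r) : NormLE (toL0 p) (toL0 1 (F (1 / p.toReal : ℝ))) r := by
  have hθ := one_div_toReal_mem_Ioo hp₁ hp
  have hq : p.toReal ≠ 0 := (ENNReal.toReal_pos (zero_lt_one.trans hp₁).ne' hp).ne'
  obtain ⟨hL, hnorm⟩ := exists_memLp_of_simpleFunc_le (zero_lt_one.trans hp₁).ne' hp
    (Lp.aestronglyMeasurable (F (1 / p.toReal : ℝ))) hF.nonneg fun φ hφ => by
      refine (hF.integral_simpleFunc_le hθ φ fun x => ?_).trans_eq (by rw [one_div_one_div])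
      calc (φ x : ℝ) ^ (1 / p.toReal) ≤ (‖_‖ ^ p.toReal) ^ (1 / p.toReal) := by
            gcongr
            exact hφ x
        _ = ‖_‖ := by
            rw [← Real.rpow_mul (norm_nonneg _), mul_one_div_cancel hq, Real.rpow_one]
  exact ⟨hL.toLp _, AEEqFun.ext hL.coeFn_toLp, hnorm⟩

end Interpolation

/-! ## Analytic functions with values in `L_1` -/

section ToL1

variable {α E : Type*} [MeasurableSpace α] [NormedAddCommGroup E]

open Classical in
/-- The class of `f` in `L_1`, and `0` if `f` is not integrable. -/
noncomputable def toL1 (μ : Measure α) (f : α → E) : Lp E 1 μ :=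
  if h : Integrable f μ then h.toL1 f else 0

variable {μ : Measure α} {f g : α → E}

theorem toL1_eq (hf : Integrable f μ) : toL1 μ f = hf.toL1 f := dif_pos hf

theorem coeFn_toL1 (hf : Integrable f μ) : toL1 μ f =ᵐ[μ] f := by
  rw [toL1_eq hf]
  exact hf.coeFn_toL1

theorem norm_toL1_sub (hf : Integrable f μ) (hg : Integrable g μ) :
    ‖toL1 μ f - toL1 μ g‖ = ∫ x, ‖f x - g x‖ ∂μ := by
  rw [toL1_eq hf, toL1_eq hg, ← Integrable.toL1_sub, L1.norm_of_fun_eq_integral_norm]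
  rfl

theorem tendsto_toL1_of_dominated {ι : Type*} {l : Filter ι} [l.IsCountablyGenerated]
    {F : ι → α → E} {bound : α → ℝ}
    (hF_meas : ∀ᶠ i in l, AEStronglyMeasurable (F i) μ) (hf : Integrable f μ)
    (h_bound : ∀ᶠ i in l, ∀ᵐ x ∂μ, ‖F i x‖ ≤ bound x) (hbound : Integrable bound μ)
    (h_lim : ∀ᵐ x ∂μ, Tendsto (fun i => F i x) l (𝓝 (f x))) :
    Tendsto (fun i => toL1 μ (F i)) l (𝓝 (toL1 μ f)) := by
  rw [tendsto_iff_norm_sub_tendsto_zero]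
  have hint : Tendsto (fun i => ∫ x, ‖F i x - f x‖ ∂μ) l (𝓝 (∫ _, (0 : ℝ) ∂μ)) := by
    refine tendsto_integral_filter_of_dominated_convergence (fun x => bound x + ‖f x‖) ?_ ?_
      (hbound.add hf.norm) ?_
    · filter_upwards [hF_meas] with i hi using (hi.sub hf.aestronglyMeasurable).norm
    · filter_upwards [h_bound] with i hi
      filter_upwards [hi] with x hx
      rw [norm_norm]
      exact (norm_sub_le _ _).trans (by gcongr)
    · filter_upwards [h_lim] with x hx using tendsto_iff_norm_sub_tendsto_zero.1 hx
  rw [integral_zero] at hint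
  refine hint.congr' ?_
  filter_upwards [hF_meas, h_bound] with i hi hi'
  exact (norm_toL1_sub (hbound.mono' hi hi') hf).symm

theorem hasDerivAt_toL1_of_dominated {𝕜 : Type*} [RCLike 𝕜] [NormedSpace 𝕜 E] {F F' : 𝕜 → α → E}
    {bound : α → ℝ} {z : 𝕜} {s : Set 𝕜} (hs : s ∈ 𝓝 z) (hs_conv : Convex ℝ s)
    (hF_int : ∀ w ∈ s, Integrable (F w) μ) (hF'_meas : AEStronglyMeasurable (F' z) μ)
    (h_bound : ∀ᵐ x ∂μ, ∀ w ∈ s, ‖F' w x‖ ≤ bound x) (hbound : Integrable bound μ)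
    (h_diff : ∀ᵐ x ∂μ, ∀ w ∈ s, HasDerivAt (F · x) (F' w x) w) :
    HasDerivAt (fun w => toL1 μ (F w)) (toL1 μ (F' z)) z := by
  have hzs := mem_of_mem_nhds hs
  have hs' : ∀ᶠ w in 𝓝[≠] z, w ∈ s := nhdsWithin_le_nhds hs
  have hF'_int : Integrable (F' z) μ := by
    refine hbound.mono' hF'_meas ?_
    filter_upwards [h_bound] with x hx using hx z hzs
  have hslope_int {w : 𝕜} (hw : w ∈ s) : Integrable (fun x => slope (F · x) z w) μ := by
    simp only [slope_def_module]
    exact ((hF_int w hw).sub (hF_int z hzs)).smul (w - z)⁻¹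
  rw [hasDerivAt_iff_tendsto_slope]
  have hlim : Tendsto (fun w => toL1 μ fun x => slope (F · x) z w) (𝓝[≠] z)
      (𝓝 (toL1 μ (F' z))) := by
    refine tendsto_toL1_of_dominated ?_ hF'_int ?_ hbound ?_
    · filter_upwards [hs'] with w hw using (hslope_int hw).aestronglyMeasurable
    · filter_upwards [hs', self_mem_nhdsWithin] with w hw hwz
      filter_upwards [h_bound, h_diff] with x hx hx'
      have hwz' : 0 < ‖w - z‖ := norm_pos_iff.2 (sub_ne_zero.2 hwz)
      rw [slope_def_module, norm_smul, norm_inv, inv_mul_le_iff₀ hwz', mul_comm]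
      exact hs_conv.norm_image_sub_le_of_norm_hasDerivWithin_le
        (fun v hv => (hx' v hv).hasDerivWithinAt) hx hzs hw
    · filter_upwards [h_diff] with x hx using hasDerivAt_iff_tendsto_slope.1 (hx z hzs)
  refine hlim.congr' ?_
  filter_upwards [hs'] with w hw
  rw [slope_def_module, toL1_eq (hF_int w hw), toL1_eq (hF_int z hzs), toL1_eq (hslope_int hw),
    ← Integrable.toL1_sub, ← Integrable.toL1_smul]
  simp only [slope_def_module]
  rfl

end ToL1

/-! ## The differential of the scale of Lebesgue spaces -/

section Extremal

/-- The extremal function `z ↦ a (|a| / N) ^ (q z - 1)`. -/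
noncomputable def extremal (q N : ℝ) (a z : ℂ) : ℂ :=
  a * Complex.exp ((q * z - 1) * (Real.log (‖a‖ / N) : ℂ))

variable {q N ε : ℝ}

theorem norm_extremal (hN : 0 < N) {a : ℂ} (ha : a ≠ 0) (z : ℂ) :
    ‖extremal q N a z‖ = N * (‖a‖ / N) ^ (q * z.re) := by
  have hu : 0 < ‖a‖ / N := div_pos (norm_pos_iff.2 ha) hN
  have hre : ((q * z - 1) * (Real.log (‖a‖ / N) : ℂ)).re =
      Real.log (‖a‖ / N) * (q * z.re - 1) := by
    simp [mul_comm]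
  rw [extremal, norm_mul, Complex.norm_exp, hre, ← Real.rpow_def_of_pos hu,
    Real.rpow_sub_one hu.ne']
  field_simp

theorem extremal_one_div (hq : q ≠ 0) (N : ℝ) (a : ℂ) :
    extremal q N a ((1 / q : ℝ) : ℂ) = a := by
  have : (q : ℂ) ≠ 0 := by exact_mod_cast hq
  simp [extremal, this]

theorem rpow_le_one_add_rpow {u s t : ℝ} (hu : 0 < u) (hs : 0 ≤ s) (hst : s ≤ t) :
    u ^ s ≤ 1 + u ^ t := by
  rcases le_total u 1 with h | h
  · linarith [Real.rpow_le_one hu.le h hs, Real.rpow_nonneg hu.le t]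
  · linarith [Real.rpow_le_rpow_of_exponent_le h hst]

theorem norm_extremal_le (hq : 0 < q) (hN : 0 < N) (a : ℂ) {z : ℂ}
    (hz : z ∈ closedStrip) : ‖extremal q N a z‖ ≤ N * (1 + (‖a‖ / N) ^ q) := by
  by_cases ha : a = 0
  · simp only [extremal, ha, zero_mul, norm_zero]
    positivity
  have hu : 0 < ‖a‖ / N := div_pos (norm_pos_iff.2 ha) hN
  rw [norm_extremal hN ha]
  gcongr
  exact rpow_le_one_add_rpow hu (mul_nonneg hq.le hz.1) (mul_le_of_le_one_right hq.le hz.2)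

theorem norm_extremal_mul_I_le (hN : 0 < N) (a : ℂ) (t : ℝ) :
    ‖extremal q N a (t * Complex.I)‖ ≤ N := by
  by_cases ha : a = 0
  · simp [extremal, ha, hN.le]
  · simp [norm_extremal hN ha]

theorem norm_extremal_one_add_mul_I (hq : 0 < q) (hN : 0 < N) (a : ℂ) (t : ℝ) :
    ‖extremal q N a (1 + t * Complex.I)‖ = N * (‖a‖ / N) ^ q := by
  by_cases ha : a = 0
  · simp [extremal, ha, Real.zero_rpow hq.ne']
  · simp [norm_extremal hN ha]

theorem hasDerivAt_extremal (q N : ℝ) (a z : ℂ) :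
    HasDerivAt (extremal q N a) (q * (Real.log (‖a‖ / N) : ℂ) * extremal q N a z) z := by
  have hlin : HasDerivAt (fun z : ℂ => (q * z - 1) * (Real.log (‖a‖ / N) : ℂ))
      (q * (Real.log (‖a‖ / N) : ℂ)) z := by
    simpa using (((hasDerivAt_id z).const_mul (q : ℂ)).sub_const 1).mul_const
      (Real.log (‖a‖ / N) : ℂ)
  refine (hlin.cexp.const_mul a).congr_deriv ?_
  rw [extremal]
  ring

theorem abs_log_le_rpow_add_rpow_neg {u δ : ℝ} (hu : 0 < u) (hδ : 0 < δ) :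
    |Real.log u| ≤ (u ^ δ + u ^ (-δ)) / δ := by
  have hlog := Real.log_le_rpow_div hu.le hδ
  have hlog_inv := Real.log_le_rpow_div (inv_pos.2 hu).le hδ
  rw [Real.log_inv, Real.inv_rpow hu.le, ← Real.rpow_neg hu.le] at hlog_inv
  have hδu : 0 ≤ u ^ δ / δ := by positivity
  have hδu' : 0 ≤ u ^ (-δ) / δ := by positivity
  rw [add_div, abs_le]
  constructor <;> linarith

theorem norm_log_mul_extremal_le (hq : 0 < q) (hN : 0 < N) (hε : 0 < ε) (a : ℂ) {z : ℂ}
    (hz : ε ≤ z.re) (hz' : z.re ≤ 1 - ε) :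
    ‖q * (Real.log (‖a‖ / N) : ℂ) * extremal q N a z‖ ≤
      2 / ε * (N * (1 + (‖a‖ / N) ^ q)) := by
  by_cases ha : a = 0
  · simp only [extremal, ha, zero_mul, mul_zero, norm_zero]
    positivity
  have hu : 0 < ‖a‖ / N := div_pos (norm_pos_iff.2 ha) hN
  rw [norm_mul, norm_extremal hN ha, norm_mul, Complex.norm_real, Complex.norm_real,
    Real.norm_of_nonneg hq.le, Real.norm_eq_abs]
  set u := ‖a‖ / N
  have hpos : u ^ (q * ε) * u ^ (q * z.re) ≤ 1 + u ^ q := by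
    rw [← Real.rpow_add hu]
    exact rpow_le_one_add_rpow hu (by nlinarith) (by nlinarith)
  have hneg : u ^ (-(q * ε)) * u ^ (q * z.re) ≤ 1 + u ^ q := by
    rw [← Real.rpow_add hu]
    exact rpow_le_one_add_rpow hu (by nlinarith) (by nlinarith)
  calc q * |Real.log u| * (N * u ^ (q * z.re))
      ≤ q * ((u ^ (q * ε) + u ^ (-(q * ε))) / (q * ε)) * (N * u ^ (q * z.re)) := by
        gcongr
        exact abs_log_le_rpow_add_rpow_neg hu (by positivity)
    _ = 1 / ε * N * (u ^ (q * ε) * u ^ (q * z.re) + u ^ (-(q * ε)) * u ^ (q * z.re)) := by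
        field_simp
    _ ≤ 1 / ε * N * ((1 + u ^ q) + (1 + u ^ q)) := by gcongr
    _ = _ := by ring

variable {α : Type*} [MeasurableSpace α] {μ : Measure α} {p : ℝ≥0∞} {z : ℂ}

theorem aestronglyMeasurable_extremal (f : Lp ℂ p μ) (q N : ℝ) (z : ℂ) :
    AEStronglyMeasurable (fun x => extremal q N (f x) z) μ := by
  have hf : Measurable f := (Lp.stronglyMeasurable f).measurable
  unfold extremal
  exact Measurable.aestronglyMeasurable (by fun_prop)

variable [IsFiniteMeasure μ]

theorem integrable_one_add_norm_rpow (hp₀ : p ≠ 0) (hp : p ≠ ∞) (N : ℝ) (f : Lp ℂ p μ) :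
    Integrable (fun x => N * (1 + (‖f x‖ / ‖f‖) ^ p.toReal)) μ := by
  have h : Integrable (fun x => (‖f x‖ / ‖f‖) ^ p.toReal) μ := by
    refine (((Lp.memLp f).integrable_norm_rpow hp₀ hp).div_const (‖f‖ ^ p.toReal)).congr
      (.of_forall fun x => ?_)
    exact (Real.div_rpow (norm_nonneg _) ENNReal.toReal_nonneg _).symm
  exact ((integrable_const 1).add h).const_mul N

theorem integrable_extremal (hp₀ : p ≠ 0) (hp : p ≠ ∞) {f : Lp ℂ p μ} (hf : 0 < ‖f‖)
    (hz : z ∈ closedStrip) : Integrable (fun x => extremal p.toReal ‖f‖ (f x) z) μ :=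
  (integrable_one_add_norm_rpow hp₀ hp ‖f‖ f).mono' (aestronglyMeasurable_extremal f _ _ z)
    (.of_forall fun _ => norm_extremal_le (ENNReal.toReal_pos hp₀ hp) hf _ hz)

omit [IsFiniteMeasure μ] in
theorem aestronglyMeasurable_log_mul_extremal (f : Lp ℂ p μ) (q N : ℝ) (z : ℂ) :
    AEStronglyMeasurable
      (fun x => q * (Real.log (‖f x‖ / N) : ℂ) * extremal q N (f x) z) μ := by
  have hf : Measurable f := (Lp.stronglyMeasurable f).measurable
  exact (Measurable.aestronglyMeasurable (by fun_prop)).mul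
    (aestronglyMeasurable_extremal f q N z)

theorem integrable_log_mul_extremal (hp₀ : p ≠ 0) (hp : p ≠ ∞) {f : Lp ℂ p μ} (hf : 0 < ‖f‖)
    (hz : z ∈ openStrip) : Integrable (fun x =>
      p.toReal * (Real.log (‖f x‖ / ‖f‖) : ℂ) * extremal p.toReal ‖f‖ (f x) z) μ :=
  ((integrable_one_add_norm_rpow hp₀ hp ‖f‖ f).const_mul _).mono'
    (aestronglyMeasurable_log_mul_extremal f _ _ z) (.of_forall fun _ =>
      norm_log_mul_extremal_le (ENNReal.toReal_pos hp₀ hp) hf (lt_min hz.1 (sub_pos.2 hz.2)) _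
        (min_le_left _ _) (by linarith [min_le_right z.re (1 - z.re)]))

theorem hasDerivAt_toL1_extremal (hp₀ : p ≠ 0) (hp : p ≠ ∞) {f : Lp ℂ p μ} (hf : 0 < ‖f‖)
    (hz : z ∈ openStrip) :
    HasDerivAt (fun z => toL1 μ fun x => extremal p.toReal ‖f‖ (f x) z)
      (toL1 μ fun x =>
        p.toReal * (Real.log (‖f x‖ / ‖f‖) : ℂ) * extremal p.toReal ‖f‖ (f x) z) z := by
  have hq := ENNReal.toReal_pos hp₀ hp
  obtain ⟨ε, hε, hεz⟩ := exists_between (lt_min hz.1 (sub_pos.2 hz.2))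
  have hεz₀ := hεz.trans_le (min_le_left _ _)
  have hεz₁ := hεz.trans_le (min_le_right _ _)
  refine hasDerivAt_toL1_of_dominated (s := {w : ℂ | ε < w.re} ∩ {w : ℂ | w.re < 1 - ε})
    (F' := fun w x =>
      p.toReal * (Real.log (‖f x‖ / ‖f‖) : ℂ) * extremal p.toReal ‖f‖ (f x) w)
    ((isOpen_Ioo.preimage Complex.continuous_re).mem_nhds ⟨hεz₀, by linarith⟩)
    ((convex_halfSpace_re_gt ε).inter (convex_halfSpace_re_lt (1 - ε)))
    (fun w hw => integrable_extremal hp₀ hp hf ⟨hε.le.trans hw.1.le, ?_⟩)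
    (aestronglyMeasurable_log_mul_extremal f _ _ z)
    (.of_forall fun x w hw => norm_log_mul_extremal_le hq hf hε _ hw.1.le hw.2.le)
    ((integrable_one_add_norm_rpow hp₀ hp ‖f‖ f).const_mul _)
    (.of_forall fun x w _ => hasDerivAt_extremal _ _ _ w)
  exact (hw.2.trans (sub_lt_self 1 hε)).le

theorem continuousOn_toL1_extremal (hp₀ : p ≠ 0) (hp : p ≠ ∞) {f : Lp ℂ p μ} (hf : 0 < ‖f‖) :
    ContinuousOn (fun z => toL1 μ fun x => extremal p.toReal ‖f‖ (f x) z) closedStrip :=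
  fun z hz => tendsto_toL1_of_dominated
    (.of_forall fun w => aestronglyMeasurable_extremal f _ _ w) (integrable_extremal hp₀ hp hf hz)
    (eventually_mem_nhdsWithin.mono fun _ hw => .of_forall fun _ =>
      norm_extremal_le (ENNReal.toReal_pos hp₀ hp) hf _ hw)
    (integrable_one_add_norm_rpow hp₀ hp ‖f‖ f)
    (.of_forall fun _ => (hasDerivAt_extremal _ _ _ z).continuousAt.continuousWithinAt)

theorem norm_toL1_extremal (hp₀ : p ≠ 0) (hp : p ≠ ∞) {f : Lp ℂ p μ} (hf : 0 < ‖f‖)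
    (hz : z ∈ closedStrip) : ‖toL1 μ fun x => extremal p.toReal ‖f‖ (f x) z‖ =
      ∫ x, ‖extremal p.toReal ‖f‖ (f x) z‖ ∂μ := by
  rw [toL1_eq (integrable_extremal hp₀ hp hf hz), L1.norm_of_fun_eq_integral_norm]

theorem norm_toL1_extremal_one (hp₀ : p ≠ 0) (hp : p ≠ ∞) {f : Lp ℂ p μ} (hf : 0 < ‖f‖) (t : ℝ) :
    ‖toL1 μ fun x => extremal p.toReal ‖f‖ (f x) (1 + t * Complex.I)‖ = ‖f‖ := by
  rw [norm_toL1_extremal hp₀ hp hf (one_add_mul_I_mem_closedStrip t)]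
  simp only [norm_extremal_one_add_mul_I (ENNReal.toReal_pos hp₀ hp) hf,
    Real.div_rpow (norm_nonneg _) hf.le]
  rw [integral_const_mul, integral_div, ← norm_rpow_eq_integral hp₀ hp, div_self (by positivity),
    mul_one]

theorem calderonNormLE_toL1_extremal (hp₀ : p ≠ 0) (hp : p ≠ ∞) {f : LpI p} (hf : 0 < ‖f‖) :
    CalderonNormLE (fun z => toL1 leb01 fun x => extremal p.toReal ‖f‖ (f x) z) ‖f‖ := by
  refine ⟨continuousOn_toL1_extremal hp₀ hp hf,
    fun z hz => (hasDerivAt_toL1_extremal hp₀ hp hf hz).differentiableAt.differentiableWithinAt,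
    ⟨∫ x, ‖f‖ * (1 + (‖f x‖ / ‖f‖) ^ p.toReal) ∂leb01, fun z hz => ?_⟩, fun t => ?_,
    fun t => (norm_toL1_extremal_one hp₀ hp hf t).le⟩
  · rw [norm_toL1_extremal hp₀ hp hf hz]
    exact integral_mono (integrable_extremal hp₀ hp hf hz).norm
      (integrable_one_add_norm_rpow hp₀ hp ‖f‖ f)
      fun x => norm_extremal_le (ENNReal.toReal_pos hp₀ hp) hf _ hz
  · filter_upwards [coeFn_toL1 (integrable_extremal hp₀ hp hf (mul_I_mem_closedStrip t))] with x hx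
    rw [hx]
    exact norm_extremal_mul_I_le hf _ t

end Extremal

section ScaleDifferential

variable {p : ℝ≥0∞} [Fact (1 ≤ p)]

theorem toL0_deriv_toL1_extremal (hp₁ : 1 < p) (hp : p ≠ ∞) {f : LpI p} (hf : 0 < ‖f‖) :
    toL0 1 (deriv (fun z => toL1 leb01 fun x => extremal p.toReal ‖f‖ (f x) z)
      (1 / p.toReal : ℝ)) = (p.toReal : ℂ) • kaltonPeck p f := by
  have hp₀ : p ≠ 0 := (zero_lt_one.trans hp₁).ne'
  have hq := ENNReal.toReal_pos hp₀ hp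
  have hθ := ofReal_mem_openStrip (one_div_toReal_mem_Ioo hp₁ hp)
  rw [(hasDerivAt_toL1_extremal hp₀ hp hf hθ).deriv]
  refine AEEqFun.ext ?_
  filter_upwards [coeFn_toL1 (integrable_log_mul_extremal hp₀ hp hf hθ), kaltonPeck_ae hf f,
    AEEqFun.coeFn_smul (p.toReal : ℂ) (kaltonPeck p f)] with x hx hK h_smul
  refine hx.trans ?_
  rw [h_smul, Pi.smul_apply, hK, extremal_one_div hq.ne', div_self hf.ne', Real.log_one,
    smul_eq_mul]
  push_cast
  ring

theorem normLE_toL0_deriv_sub_kaltonPeck (hp₁ : 1 < p) (hp : p ≠ ∞) {F : ℂ → LpI 1} {r : ℝ}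
    (hF : CalderonNormLE F r) {f : LpI p} (hf : 0 < ‖f‖)
    (hFf : toL0 1 (F (1 / p.toReal : ℝ)) = toL0 p f) :
    NormLE (toL0 p) (toL0 1 (deriv F (1 / p.toReal : ℝ)) - (p.toReal : ℂ) • kaltonPeck p f)
      ((r + ‖f‖) / min (1 / p.toReal) (1 - 1 / p.toReal)) := by
  have hp₀ : p ≠ 0 := (zero_lt_one.trans hp₁).ne'
  have hθ := one_div_toReal_mem_Ioo hp₁ hp
  have hθs := ofReal_mem_openStrip hθ
  have hE := calderonNormLE_toL1_extremal hp₀ hp hf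
  set E : ℂ → LpI 1 := fun z => toL1 leb01 fun x => extremal p.toReal ‖f‖ (f x) z
  have hEf : F (1 / p.toReal : ℝ) = E (1 / p.toReal : ℝ) := by
    refine Lp.ext ?_
    filter_upwards [coeFn_toL1 (integrable_extremal hp₀ hp hf (openStrip_subset_closedStrip hθs))]
      with x hx
    rw [hx, extremal_one_div (ENNReal.toReal_pos hp₀ hp).ne']
    exact congrArg (fun h : L0 => h x) hFf
  have hzero : (F - E) (1 / p.toReal : ℝ) = 0 := sub_eq_zero.2 hEf
  have hdiff {H : ℂ → LpI 1} {s : ℝ} (hH : CalderonNormLE H s) :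
      DifferentiableAt ℂ H (1 / p.toReal : ℝ) :=
    hH.2.1.differentiableAt (isOpen_openStrip.mem_nhds hθs)
  have h := ((hF.sub hE).dslope hθ hzero).normLE hp₁ hp
  rwa [dslope_same, deriv_sub (hdiff hF) (hdiff hE), map_sub, toL0_deriv_toL1_extremal hp₁ hp hf]
    at h

omit [Fact (1 ≤ p)] in
theorem scaleDifferential_smul (hp₁ : 1 < p) (hp : p ≠ ∞) {B : LpI p → ℂ → LpI 1}
    (hB : IsCalderonSelection p B) (c : ℂ) (f : LpI p) :
    scaleDifferential p B (c • f) = c • scaleDifferential p B f := by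
  have heq : B (c • f) =ᶠ[𝓝 ((1 / p.toReal : ℝ) : ℂ)] c • B f := by
    have hθ := ofReal_mem_openStrip (one_div_toReal_mem_Ioo hp₁ hp)
    filter_upwards [isOpen_openStrip.mem_nhds hθ] with z hz
    exact hB.2.1 c f z (openStrip_subset_closedStrip hz)
  rw [scaleDifferential, scaleDifferential, heq.deriv_eq, deriv_const_smul_field, map_smul]

theorem exists_normLE_scaleDifferential_sub_kaltonPeck (hp₁ : 1 < p) (hp : p ≠ ∞)
    {B : LpI p → ℂ → LpI 1} (hB : IsCalderonSelection p B) :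
    ∃ K : ℝ, 0 ≤ K ∧ ∀ f : LpI p, NormLE (toL0 p)
      (scaleDifferential p B f - (p.toReal : ℂ) • kaltonPeck p f) (K * ‖f‖) := by
  obtain ⟨C, hC⟩ := hB.2.2
  have hθ := one_div_toReal_mem_Ioo hp₁ hp
  have hδ : 0 < min (1 / p.toReal) (1 - 1 / p.toReal) := lt_min hθ.1 (sub_pos.2 hθ.2)
  refine ⟨(|C| + 1) / min (1 / p.toReal) (1 - 1 / p.toReal), by positivity, fun f => ?_⟩
  rcases (norm_nonneg f).eq_or_lt with hf | hf
  · obtain rfl : f = 0 := norm_eq_zero.1 hf.symm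
    have h_zero {Ω : LpI p → L0} (hΩ : ∀ (c : ℂ) f, Ω (c • f) = c • Ω f) : Ω 0 = 0 := by
      have h := hΩ 0 0
      rw [zero_smul] at h
      exact h.trans (zero_smul ℂ (Ω 0))
    rw [h_zero (scaleDifferential_smul hp₁ hp hB), h_zero (kaltonPeck_isQuasiLinear p).1]
    refine ⟨0, ?_, by simp⟩
    rw [map_zero]
    exact ((sub_eq_zero (G := L0)).2 (smul_zero (A := L0) (p.toReal : ℂ)).symm).symm
  · refine (normLE_toL0_deriv_sub_kaltonPeck hp₁ hp (hC f) hf (hB.1 f)).mono ?_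
    rw [div_mul_eq_mul_div, add_mul, one_mul]
    gcongr
    exact le_abs_self C

end ScaleDifferential

/-! ## Isometries given by a weight and a point map -/

section ChangeOfVariables

variable {α β : Type*} [MeasurableSpace α] [MeasurableSpace β] {μ : Measure α} {ν : Measure β}
  {W : α → ℂ} {φ : α → β} {p : ℝ≥0∞}

theorem quasiMeasurePreserving_of_withDensity_enorm_rpow {q : ℝ} (hW : Measurable W)
    (hW₀ : ∀ᵐ x ∂μ, W x ≠ 0) (hφ : MeasurePreserving φ (μ.withDensity fun x => ‖W x‖ₑ ^ q) ν) :
    Measure.QuasiMeasurePreserving φ μ ν := by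
  have h_ac : μ ≪ μ.withDensity fun x => ‖W x‖ₑ ^ q :=
    withDensity_absolutelyContinuous' (hW.enorm.pow_const q).aemeasurable
      (hW₀.mono fun x hx => by simp [ENNReal.rpow_eq_zero_iff, hx])
  exact ⟨hφ.measurable, (h_ac.map hφ.measurable).trans hφ.map_eq.absolutelyContinuous⟩

theorem eLpNorm_mul_comp (hp₀ : p ≠ 0) (hp : p ≠ ∞) (hW : Measurable W)
    (hφ : MeasurePreserving φ (μ.withDensity fun x => ‖W x‖ₑ ^ p.toReal) ν) {f : β → ℂ}
    (hf : Measurable f) : eLpNorm (fun x => W x * f (φ x)) p μ = eLpNorm f p ν := by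
  rw [eLpNorm_eq_lintegral_rpow_enorm_toReal hp₀ hp, eLpNorm_eq_lintegral_rpow_enorm_toReal hp₀ hp,
    ← hφ.lintegral_comp (hf.enorm.pow_const _),
    lintegral_withDensity_eq_lintegral_mul _ (hW.enorm.pow_const _)
      (g := fun x => ‖f (φ x)‖ₑ ^ p.toReal) ((hf.comp hφ.measurable).enorm.pow_const _)]
  simp only [Pi.mul_apply, enorm_mul,
    ENNReal.mul_rpow_of_nonneg _ _ ENNReal.toReal_nonneg]

end ChangeOfVariables

section Isometries

variable {p : ℝ≥0∞} [Fact (1 ≤ p)] {W : ℝ → ℂ} {φ ψ : ℝ → ℝ}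

theorem exists_linearIsometry_mul_comp (hp : p ≠ ∞) (hW : Measurable W)
    (hW₀ : ∀ᵐ x ∂leb01, W x ≠ 0)
    (hφ : MeasurePreserving φ (leb01.withDensity fun x => ‖W x‖ₑ ^ p.toReal) leb01) :
    ∃ T : LpI p →ₗᵢ[ℂ] LpI p, ∀ f : LpI p, T f =ᵐ[leb01] fun x => W x * f (φ x) := by
  have hp₀ : p ≠ 0 := (one_pos.trans_le Fact.out).ne'
  have hqmp := quasiMeasurePreserving_of_withDensity_enorm_rpow hW hW₀ hφ
  set V := weightedComp (AEEqFun.mk W hW.aestronglyMeasurable) hqmp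
  have hV (f : LpI p) : V (toL0 p f) =ᵐ[leb01] fun x => W x * f (φ x) := by
    filter_upwards [coeFn_weightedComp (AEEqFun.mk W hW.aestronglyMeasurable) hqmp (toL0 p f),
      AEEqFun.coeFn_mk W hW.aestronglyMeasurable] with x h_comp h_mk
    exact h_comp.trans (congrArg (· * f (φ x)) h_mk)
  have hnorm (f : LpI p) : eLpNorm (V (toL0 p f)) p leb01 = eLpNorm f p leb01 :=
    (eLpNorm_congr_ae (hV f)).trans
      (eLpNorm_mul_comp hp₀ hp hW hφ (Lp.stronglyMeasurable f).measurable)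
  let T : LpI p →ₗ[ℂ] LpI p :=
    { toFun := fun f => ⟨V (toL0 p f), Lp.mem_Lp_iff_eLpNorm_lt_top.2
        ((hnorm f).trans_lt (Lp.eLpNorm_lt_top f))⟩
      map_add' := fun f g => Subtype.ext (by simp only [map_add]; rfl)
      map_smul' := fun c f => Subtype.ext (by simp only [map_smul]; rfl) }
  exact ⟨⟨T, fun f => congrArg ENNReal.toReal (hnorm f)⟩, hV⟩

theorem mul_comp_surjective (hp : p ≠ ∞) (hW : Measurable W) (hW₀ : ∀ᵐ x ∂leb01, W x ≠ 0)
    (hφ : MeasurePreserving φ (leb01.withDensity fun x => ‖W x‖ₑ ^ p.toReal) leb01)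
    (hψ : Measurable ψ) (hψφ : ∀ᵐ x ∂leb01, ψ (φ x) = x) {T : LpI p → LpI p}
    (hT : ∀ f : LpI p, T f =ᵐ[leb01] fun x => W x * f (φ x)) : Function.Surjective T := by
  intro k
  have hk := (Lp.stronglyMeasurable k).measurable
  have hf : Measurable fun y => k (ψ y) / W (ψ y) := (hk.comp hψ).div (hW.comp hψ)
  have hfk : (fun x => W x * (k (ψ (φ x)) / W (ψ (φ x)))) =ᵐ[leb01] k := by
    filter_upwards [hψφ, hW₀] with x hx hWx
    rw [hx, mul_div_cancel₀ _ hWx]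
  have hL : MemLp (fun y => k (ψ y) / W (ψ y)) p leb01 := ⟨hf.aestronglyMeasurable, by
    rw [← eLpNorm_mul_comp (one_pos.trans_le Fact.out).ne' hp hW hφ hf, eLpNorm_congr_ae hfk]
    exact Lp.eLpNorm_lt_top k⟩
  have hqmp := quasiMeasurePreserving_of_withDensity_enorm_rpow hW hW₀ hφ
  refine ⟨hL.toLp _, Lp.ext ((hT _).trans (EventuallyEq.trans ?_ hfk))⟩
  filter_upwards [hqmp.ae hL.coeFn_toLp] with x hx
  rw [hx]

omit [Fact (1 ≤ p)] in
theorem disjointLp_mul_comp_iff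
    (hφ : MeasurePreserving φ (leb01.withDensity fun x => ‖W x‖ₑ ^ p.toReal) leb01)
    (hqmp : Measure.QuasiMeasurePreserving φ leb01 leb01) (hW₀ : ∀ᵐ x ∂leb01, W x ≠ 0)
    {T : LpI p → LpI p} (hT : ∀ f : LpI p, T f =ᵐ[leb01] fun x => W x * f (φ x)) (f g : LpI p) :
    DisjointLp (T f) (T g) ↔ DisjointLp f g := by
  have h_iff : DisjointLp (T f) (T g) ↔ ∀ᵐ x ∂leb01, f (φ x) * g (φ x) = 0 := by
    refine eventually_congr ?_
    filter_upwards [hT f, hT g, hW₀] with x hf hg hWx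
    simp [hf, hg, hWx]
  refine h_iff.trans ⟨fun h => ?_, fun h => hqmp.ae h⟩
  have hmeas : MeasurableSet {y | f y * g y = 0} :=
    ((Lp.stronglyMeasurable f).measurable.mul (Lp.stronglyMeasurable g).measurable)
      (measurableSet_singleton 0)
  have h_map := (ae_map_iff (μ := leb01.withDensity fun x => ‖W x‖ₑ ^ p.toReal)
    hφ.measurable.aemeasurable hmeas).2 ((withDensity_absolutelyContinuous _ _).ae_le h)
  rwa [hφ.map_eq] at h_map

theorem exists_isWeightedComp (hp : p ≠ ∞) (hW : Measurable W) (hW₀ : ∀ᵐ x ∂leb01, W x ≠ 0)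
    (hφ : MeasurePreserving φ (leb01.withDensity fun x => ‖W x‖ₑ ^ p.toReal) leb01)
    (hψ : Measurable ψ) (hψφ : ∀ᵐ x ∂leb01, ψ (φ x) = x) :
    ∃ T ∈ disjointnessPreserving p, IsWeightedComp T W φ := by
  have hqmp := quasiMeasurePreserving_of_withDensity_enorm_rpow hW hW₀ hφ
  obtain ⟨T, hT⟩ := exists_linearIsometry_mul_comp hp hW hW₀ hφ
  exact ⟨LinearIsometryEquiv.ofSurjective T (mul_comp_surjective hp hW hW₀ hφ hψ hψφ hT),
    disjointLp_mul_comp_iff hφ hqmp hW₀ hT, hW, hqmp, hT⟩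

theorem exists_isWeightedComp_unimodular (hp : p ≠ ∞) (hW : Measurable W)
    (hW₁ : ∀ x, ‖W x‖ = 1) : ∃ T ∈ disjointnessPreserving p, IsWeightedComp T W id := by
  have hW₀ (x : ℝ) : W x ≠ 0 := norm_ne_zero_iff.1 ((hW₁ x).trans_ne one_ne_zero)
  have h_one : (fun x => ‖W x‖ₑ ^ p.toReal) = 1 := by
    ext x
    rw [← ofReal_norm, hW₁, ENNReal.ofReal_one, ENNReal.one_rpow, Pi.one_apply]
  refine exists_isWeightedComp hp hW (.of_forall hW₀) ?_ measurable_id (.of_forall fun _ => rfl)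
  rw [h_one, withDensity_one]
  exact .id _

end Isometries

/-! ## Rearrangement of a measurable set -/

theorem leb01_Iic (c : ℝ) : leb01 (Set.Iic c) = ENNReal.ofReal (min 1 c) := by
  rw [leb01, Measure.restrict_congr_set Ioo_ae_eq_Ioc, Measure.restrict_apply measurableSet_Iic,
    Set.inter_comm, Set.Ioc_inter_Iic, Real.volume_Ioc, sub_zero]

instance isProbabilityMeasure_leb01 : IsProbabilityMeasure leb01 := ⟨by simp⟩

theorem exists_measurable_leftInvOn {f : ℝ → ℝ} (hf : Measurable f) {s : Set ℝ}
    (hs : MeasurableSet s) (hinj : s.InjOn f) :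
    ∃ ψ : ℝ → ℝ, Measurable ψ ∧ s.LeftInvOn ψ f := by
  have := hs.standardBorel
  obtain ⟨ψ, hψ, hψf⟩ := ((hf.comp measurable_subtype_coe).measurableEmbedding
    (Set.injOn_iff_injective.1 hinj)).exists_measurable_extend measurable_subtype_coe
    fun _ => ⟨0⟩
  exact ⟨ψ, hψ, fun x hx => congrFun hψf ⟨x, hx⟩⟩

section ProbabilityIntegralTransform

open ProbabilityTheory

variable (ν : Measure ℝ) [IsProbabilityMeasure ν] [NullSingletonClass ν]

theorem continuous_cdf : Continuous (cdf ν) := by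
  refine continuous_iff_continuousAt.2 fun a =>
    (monotone_cdf ν).continuousAt_iff_leftLim_eq_rightLim.2 ?_
  have h_atom : ENNReal.ofReal (cdf ν a - Function.leftLim (cdf ν) a) = 0 := by
    rw [← StieltjesFunction.measure_singleton, measure_cdf, measure_singleton]
  rw [(cdf ν).rightLim_eq]
  exact ((monotone_cdf ν).leftLim_le le_rfl).antisymm
    (sub_nonpos.1 (ENNReal.ofReal_eq_zero.1 h_atom))

theorem exists_cdf_eq {c : ℝ} (hc : c ∈ Set.Ioo (0 : ℝ) 1) : ∃ x, cdf ν x = c :=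
  mem_range_of_exists_le_of_exists_ge (continuous_cdf ν)
    ((tendsto_cdf_atBot ν).eventually_le_const hc.1).exists
    ((tendsto_cdf_atTop ν).eventually_const_le hc.2).exists

theorem measure_cdf_le {c : ℝ} (hc₀ : 0 ≤ c) (hc₁ : c < 1) :
    ν {x | cdf ν x ≤ c} = ENNReal.ofReal c := by
  refine le_antisymm (le_of_forall_gt fun r hr => ?_) ?_
  · obtain ⟨c', hcc', hc'r⟩ := ENNReal.lt_iff_exists_nnreal_btwn.1
      (lt_min hr (ENNReal.ofReal_lt_one.2 hc₁))
    have hcc' : c < c' := by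
      rwa [← ENNReal.ofReal_coe_nnreal, ENNReal.ofReal_lt_ofReal_iff_of_nonneg hc₀] at hcc'
    obtain ⟨x, hx⟩ := exists_cdf_eq ν
      ⟨hc₀.trans_lt hcc', by exact_mod_cast hc'r.trans_le (min_le_right _ _)⟩
    calc ν {y | cdf ν y ≤ c} ≤ ν (Set.Iic x) := measure_mono fun y hy =>
          ((monotone_cdf ν).reflect_lt ((hx ▸ hcc').trans_le' hy)).le
      _ = c' := by rw [← ofReal_cdf, hx, ENNReal.ofReal_coe_nnreal]
      _ < r := hc'r.trans_le (min_le_left _ _)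
  · rcases hc₀.eq_or_lt with rfl | hc₀
    · simp
    obtain ⟨x, rfl⟩ := exists_cdf_eq ν ⟨hc₀, hc₁⟩
    rw [ofReal_cdf]
    exact measure_mono fun y hy => monotone_cdf ν hy

theorem measurePreserving_cdf : MeasurePreserving (cdf ν) ν leb01 := by
  have hm : Measurable (cdf ν) := (continuous_cdf ν).measurable
  have := Measure.isProbabilityMeasure_map (μ := ν) hm.aemeasurable
  refine ⟨hm, Measure.ext_of_Iic _ _ fun c => ?_⟩
  rw [Measure.map_apply hm measurableSet_Iic, leb01_Iic]
  rcases lt_or_ge c 0 with hc | hc₀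
  · have h_empty : cdf ν ⁻¹' Set.Iic c = ∅ :=
      Set.eq_empty_of_forall_notMem fun x hx => hc.not_ge ((cdf_nonneg ν x).trans hx)
    rw [min_eq_right (hc.le.trans zero_le_one), ENNReal.ofReal_of_nonpos hc.le, h_empty,
      measure_empty]
  rcases lt_or_ge c 1 with hc₁ | hc₁
  · rw [min_eq_right hc₁.le]
    exact measure_cdf_le ν hc₀ hc₁
  · have h_univ : cdf ν ⁻¹' Set.Iic c = Set.univ :=
      Set.eq_univ_of_forall fun x => (cdf_le_one ν x).trans hc₁
    rw [min_eq_left hc₁, ENNReal.ofReal_one, h_univ, measure_univ]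

theorem exists_measurable_leftInverse_cdf :
    ∃ ψ : ℝ → ℝ, Measurable ψ ∧ ∀ᵐ x ∂ν, ψ (cdf ν x) = x := by
  -- Off the countably many fibres through rational points, which are null, `cdf ν` is injective.
  have hm : Measurable (cdf ν) := (continuous_cdf ν).measurable
  have hs : MeasurableSet {x | ∀ q : ℚ, cdf ν x ≠ cdf ν q} := by
    simp only [Set.ofPred_forall]
    exact .iInter fun q => (hm (measurableSet_singleton (cdf ν q))).compl
  obtain ⟨ψ, hψ, hψs⟩ := exists_measurable_leftInvOn hm hs fun x hx y hy hxy => by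
    by_contra hne
    wlog hlt : x < y generalizing x y
    · exact this y hy x hx hxy.symm (Ne.symm hne) ((Ne.lt_or_gt hne).resolve_left hlt)
    obtain ⟨q, hxq, hqy⟩ := exists_rat_btwn hlt
    exact hx q ((monotone_cdf ν hxq.le).antisymm ((monotone_cdf ν hqy.le).trans hxy.ge))
  refine ⟨ψ, hψ, (ae_all_iff.2 fun q : ℚ => ?_).mono fun x hx => hψs hx⟩
  exact (measurePreserving_cdf ν).quasiMeasurePreserving.ae
    (compl_mem_ae_iff.2 (measure_singleton (cdf ν q)))

end ProbabilityIntegralTransform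

section Rearrangement

open ProbabilityTheory

/-- The half `x < 1 / 2` of the unit interval, which serves as the model set of measure `1 / 2`. -/
abbrev lowerHalf : Set ℝ := Set.Iio 2⁻¹

open Classical in
/-- The map sending a set `A`, normalized to be a probability space, onto `lowerHalf`, and its
complement onto the other half, in each case by an increasing function. -/
noncomputable def rearrange (A : Set ℝ) : ℝ → ℝ :=
  A.piecewise (fun x => 2⁻¹ * cdf leb01[|A] x) fun x => 2⁻¹ + 2⁻¹ * cdf leb01[|Aᶜ] x

open Classical in
/-- The weight that makes composition with `rearrange A` isometric on `L_p`. -/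
noncomputable def rearrangeWeight (p : ℝ≥0∞) (A : Set ℝ) : ℝ → ℂ :=
  A.piecewise (fun _ => (((2 * leb01.real A)⁻¹ ^ (1 / p.toReal) : ℝ) : ℂ))
    fun _ => (((2 * leb01.real Aᶜ)⁻¹ ^ (1 / p.toReal) : ℝ) : ℂ)

theorem leb01_real_pos {A : Set ℝ} (hA : leb01 A ≠ 0) : 0 < leb01.real A :=
  ENNReal.toReal_pos hA (measure_ne_top _ _)

instance nullSingletonClass_cond (A : Set ℝ) : NullSingletonClass leb01[|A] :=
  ⟨fun x => cond_absolutelyContinuous (measure_singleton x)⟩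

theorem ae_of_ae_cond {α : Type*} [MeasurableSpace α] {μ : Measure α} [IsFiniteMeasure μ]
    (A : Set α) {P : α → Prop} (h : ∀ᵐ x ∂μ[|A], P x)
    (h' : ∀ᵐ x ∂μ[|Aᶜ], P x) : ∀ᵐ x ∂μ, P x := by
  have h_restrict {B : Set α} (hB : ∀ᵐ x ∂μ[|B], P x) : ∀ᵐ x ∂μ.restrict B, P x :=
    (Measure.ae_ennreal_smul_measure_iff (ENNReal.inv_ne_zero.2 (measure_ne_top μ B))).1 hB
  exact ae_of_ae_restrict_of_ae_restrict_compl A (h_restrict h) (h_restrict h')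

theorem map_affine_leb01 (b : ℝ) {k : ℝ} (hk : 0 < k) :
    leb01.map (fun y => b + k * y) =
      ENNReal.ofReal k⁻¹ • volume.restrict (Set.Ioo b (b + k)) := by
  have h_volume : volume.map (fun y => b + k * y) = ENNReal.ofReal k⁻¹ • volume := by
    rw [← Function.comp_def (b + ·) (k * ·), ← Measure.map_map (by fun_prop) (by fun_prop),
      Real.map_volume_mul_left hk.ne', Measure.map_smul, map_add_left_eq_self,
      abs_of_pos (inv_pos.2 hk)]
  have h_preimage : (fun y => b + k * y) ⁻¹' Set.Ioo b (b + k) = Set.Ioo 0 1 := by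
    ext y
    simp [hk]
  rw [← Measure.restrict_smul, ← h_volume,
    Measure.restrict_map (by fun_prop) measurableSet_Ioo, h_preimage]

theorem leb01_lowerHalf : leb01 lowerHalf = 2⁻¹ := by
  rw [measure_congr Iio_ae_eq_Iic, leb01_Iic, min_eq_right (by norm_num),
    ENNReal.ofReal_inv_of_pos two_pos, ENNReal.ofReal_ofNat]

theorem leb01_compl_lowerHalf : leb01 lowerHalfᶜ = 2⁻¹ := by
  rw [prob_compl_eq_one_sub measurableSet_Iio, leb01_lowerHalf, ENNReal.one_sub_inv_two]

theorem leb01_lowerHalf_ne_zero : leb01 lowerHalf ≠ 0 :=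
  leb01_lowerHalf.trans_ne (ENNReal.inv_ne_zero.2 ENNReal.ofNat_ne_top)

theorem leb01_compl_lowerHalf_ne_zero : leb01 lowerHalfᶜ ≠ 0 :=
  leb01_compl_lowerHalf.trans_ne (ENNReal.inv_ne_zero.2 ENNReal.ofNat_ne_top)

theorem cond_lowerHalf :
    leb01[|lowerHalf] = (2 : ℝ≥0∞) • volume.restrict (Set.Ioo (0 : ℝ) 2⁻¹) := by
  rw [ProbabilityTheory.cond, leb01_lowerHalf, inv_inv, Measure.restrict_restrict measurableSet_Iio,
    Set.Iio_inter_Ioo, min_eq_left (by norm_num)]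

theorem cond_compl_lowerHalf :
    leb01[|lowerHalfᶜ] = (2 : ℝ≥0∞) • volume.restrict (Set.Ioo (2⁻¹ : ℝ) 1) := by
  have h_inter : Set.Ici (2⁻¹ : ℝ) ∩ Set.Ioo 0 1 = Set.Ico 2⁻¹ 1 := by
    ext x
    simp only [Set.mem_inter_iff, Set.mem_Ici, Set.mem_Ioo, Set.mem_Ico]
    exact ⟨fun h => ⟨h.1, h.2.2⟩, fun h => ⟨h.1, by linarith [h.1], h.2⟩⟩
  rw [ProbabilityTheory.cond, leb01_compl_lowerHalf, inv_inv, Set.compl_Iio,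
    Measure.restrict_restrict measurableSet_Ici, h_inter,
    ← Measure.restrict_congr_set Ioo_ae_eq_Ico]

variable {A : Set ℝ}

theorem leb01_eq_add_cond (hA : MeasurableSet A) :
    leb01 = leb01 A • leb01[|A] + leb01 Aᶜ • leb01[|Aᶜ] := by
  ext s
  simp only [Measure.add_apply, Measure.smul_apply, smul_eq_mul]
  rw [mul_comm, mul_comm (leb01 Aᶜ), cond_add_cond_compl_eq hA]

theorem rearrange_of_mem {x : ℝ} (hx : x ∈ A) : rearrange A x = 2⁻¹ * cdf leb01[|A] x :=
  if_pos hx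

theorem rearrange_of_notMem {x : ℝ} (hx : x ∉ A) :
    rearrange A x = 2⁻¹ + 2⁻¹ * cdf leb01[|Aᶜ] x :=
  if_neg hx

theorem rearrangeWeight_of_mem (p : ℝ≥0∞) {x : ℝ} (hx : x ∈ A) :
    rearrangeWeight p A x = (((2 * leb01.real A)⁻¹ ^ (1 / p.toReal) : ℝ) : ℂ) :=
  if_pos hx

theorem rearrangeWeight_of_notMem (p : ℝ≥0∞) {x : ℝ} (hx : x ∉ A) :
    rearrangeWeight p A x = (((2 * leb01.real Aᶜ)⁻¹ ^ (1 / p.toReal) : ℝ) : ℂ) :=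
  if_neg hx

theorem measurable_rearrange (hA : MeasurableSet A) : Measurable (rearrange A) :=
  .piecewise hA ((monotone_cdf _).measurable.const_mul _)
    (((monotone_cdf _).measurable.const_mul _).const_add _)

theorem measurable_rearrangeWeight (p : ℝ≥0∞) (hA : MeasurableSet A) :
    Measurable (rearrangeWeight p A) :=
  .piecewise hA measurable_const measurable_const

theorem measurePreserving_rearrange (hA : MeasurableSet A) (hA₀ : leb01 A ≠ 0) :
    MeasurePreserving (rearrange A) leb01[|A] leb01[|lowerHalf] := by
  have := cond_isProbabilityMeasure hA₀
  have h_affine : MeasurePreserving (fun y : ℝ => 2⁻¹ * y) leb01 leb01[|lowerHalf] :=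
    ⟨by fun_prop, by simpa [cond_lowerHalf] using map_affine_leb01 0 (k := 2⁻¹) (by norm_num)⟩
  refine (h_affine.comp (measurePreserving_cdf leb01[|A])).congr (measurable_rearrange hA) ?_
  filter_upwards [ae_cond_mem hA] with x hx
  rw [rearrange_of_mem hx, Function.comp_apply]

theorem measurePreserving_rearrange_compl (hA : MeasurableSet A) (hA₀ : leb01 Aᶜ ≠ 0) :
    MeasurePreserving (rearrange A) leb01[|Aᶜ] leb01[|lowerHalfᶜ] := by
  have := cond_isProbabilityMeasure hA₀
  have h_affine : MeasurePreserving (fun y : ℝ => 2⁻¹ + 2⁻¹ * y) leb01 leb01[|lowerHalfᶜ] := by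
    refine ⟨by fun_prop, ?_⟩
    rw [map_affine_leb01 2⁻¹ (by norm_num), cond_compl_lowerHalf]
    norm_num
  refine (h_affine.comp (measurePreserving_cdf leb01[|Aᶜ])).congr (measurable_rearrange hA) ?_
  filter_upwards [ae_cond_mem hA.compl] with x hx
  rw [rearrange_of_notMem hx, Function.comp_apply]

theorem enorm_ofReal_rpow_one_div_rpow {q : ℝ} (hq : 0 < q) {u : ℝ} (hu : 0 ≤ u) :
    ‖((u ^ (1 / q) : ℝ) : ℂ)‖ₑ ^ q = ENNReal.ofReal u := by
  rw [← ofReal_norm, Complex.norm_real, Real.norm_of_nonneg (by positivity),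
    ENNReal.ofReal_rpow_of_nonneg (by positivity) hq.le, ← Real.rpow_mul hu,
    one_div_mul_cancel hq.ne', Real.rpow_one]

theorem withDensity_rearrangeWeight {p : ℝ≥0∞} (hp₀ : p ≠ 0) (hp : p ≠ ∞)
    (hA : MeasurableSet A) (hA₀ : leb01 A ≠ 0) (hA₁ : leb01 Aᶜ ≠ 0) :
    leb01.withDensity (fun x => ‖rearrangeWeight p A x‖ₑ ^ p.toReal) =
      (2⁻¹ : ℝ≥0∞) • leb01[|A] + (2⁻¹ : ℝ≥0∞) • leb01[|Aᶜ] := by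
  have h_piece {B : Set ℝ} (hB : MeasurableSet B) (hB₀ : leb01 B ≠ 0)
      (hW : ∀ x ∈ B, rearrangeWeight p A x = ((2 * leb01.real B)⁻¹ ^ (1 / p.toReal) : ℝ)) :
      (leb01.restrict B).withDensity (fun x => ‖rearrangeWeight p A x‖ₑ ^ p.toReal) =
        (2⁻¹ : ℝ≥0∞) • leb01[|B] := by
    have h_const : (fun x => ‖rearrangeWeight p A x‖ₑ ^ p.toReal) =ᵐ[leb01.restrict B]
        fun _ => 2⁻¹ * (leb01 B)⁻¹ := by
      filter_upwards [ae_restrict_mem hB] with x hx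
      rw [hW x hx, enorm_ofReal_rpow_one_div_rpow (ENNReal.toReal_pos hp₀ hp) (by positivity),
        ENNReal.ofReal_inv_of_pos (mul_pos two_pos (leb01_real_pos hB₀)),
        ENNReal.ofReal_mul two_pos.le, ofReal_measureReal, ENNReal.ofReal_ofNat,
        ENNReal.mul_inv (by simp) (by simp)]
    rw [withDensity_congr_ae h_const, withDensity_const, ProbabilityTheory.cond, smul_smul]
  calc leb01.withDensity (fun x => ‖rearrangeWeight p A x‖ₑ ^ p.toReal)
      = (leb01.restrict A + leb01.restrict Aᶜ).withDensity
          fun x => ‖rearrangeWeight p A x‖ₑ ^ p.toReal := by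
        rw [Measure.restrict_add_restrict_compl hA]
    _ = (2⁻¹ : ℝ≥0∞) • leb01[|A] + (2⁻¹ : ℝ≥0∞) • leb01[|Aᶜ] := by
        rw [withDensity_add_measure, h_piece hA hA₀ fun x hx => rearrangeWeight_of_mem p hx,
          h_piece hA.compl hA₁ fun x hx => rearrangeWeight_of_notMem p hx]

theorem measurePreserving_rearrange_withDensity {p : ℝ≥0∞} (hp₀ : p ≠ 0) (hp : p ≠ ∞)
    (hA : MeasurableSet A) (hA₀ : leb01 A ≠ 0) (hA₁ : leb01 Aᶜ ≠ 0) :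
    MeasurePreserving (rearrange A)
      (leb01.withDensity fun x => ‖rearrangeWeight p A x‖ₑ ^ p.toReal) leb01 := by
  refine ⟨measurable_rearrange hA, ?_⟩
  rw [withDensity_rearrangeWeight hp₀ hp hA hA₀ hA₁, Measure.map_add _ _ (measurable_rearrange hA),
    Measure.map_smul, Measure.map_smul, (measurePreserving_rearrange hA hA₀).map_eq,
    (measurePreserving_rearrange_compl hA hA₁).map_eq]
  have h_split := leb01_eq_add_cond (measurableSet_Iio (a := (2⁻¹ : ℝ)))
  rw [leb01_lowerHalf, leb01_compl_lowerHalf] at h_split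
  exact h_split.symm

theorem rearrange_mem_lowerHalf_iff (hA : MeasurableSet A) (hA₀ : leb01 A ≠ 0)
    (hA₁ : leb01 Aᶜ ≠ 0) : ∀ᵐ x ∂leb01, rearrange A x ∈ lowerHalf ↔ x ∈ A := by
  refine ae_of_ae_cond A ?_ ?_
  · filter_upwards [ae_cond_mem hA, (measurePreserving_rearrange hA hA₀).quasiMeasurePreserving.ae
      (ae_cond_mem measurableSet_Iio)] with x hx hx'
    exact iff_of_true hx' hx
  · filter_upwards [ae_cond_mem hA.compl, (measurePreserving_rearrange_compl hA
      hA₁).quasiMeasurePreserving.ae (ae_cond_mem measurableSet_Iio.compl)] with x hx hx'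
    exact iff_of_false hx' hx

theorem exists_measurable_leftInverse_rearrange (hA : MeasurableSet A) (hA₀ : leb01 A ≠ 0)
    (hA₁ : leb01 Aᶜ ≠ 0) :
    ∃ ψ : ℝ → ℝ, Measurable ψ ∧ ∀ᵐ x ∂leb01, ψ (rearrange A x) = x := by
  classical
  have := cond_isProbabilityMeasure hA₀
  have := cond_isProbabilityMeasure hA₁
  obtain ⟨ψ, hψ, hψA⟩ := exists_measurable_leftInverse_cdf leb01[|A]
  obtain ⟨ψ', hψ', hψA'⟩ := exists_measurable_leftInverse_cdf leb01[|Aᶜ]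
  refine ⟨lowerHalf.piecewise (fun y => ψ (2 * y)) fun y => ψ' (2 * y - 1),
    .piecewise measurableSet_Iio (by fun_prop) (by fun_prop), ae_of_ae_cond A ?_ ?_⟩
  · filter_upwards [ae_cond_mem hA, hψA,
      cond_absolutelyContinuous.ae_le (rearrange_mem_lowerHalf_iff hA hA₀ hA₁)] with x hxA hx hx'
    rw [Set.piecewise_eq_of_mem _ _ _ (hx'.2 hxA), rearrange_of_mem hxA,
      mul_inv_cancel_left₀ two_ne_zero, hx]
  · filter_upwards [ae_cond_mem hA.compl, hψA',
      cond_absolutelyContinuous.ae_le (rearrange_mem_lowerHalf_iff hA hA₀ hA₁)] with x hxA hx hx'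
    rw [Set.piecewise_eq_of_notMem _ _ _ (mt hx'.1 hxA), rearrange_of_notMem hxA, mul_add,
      mul_inv_cancel_left₀ two_ne_zero, mul_inv_cancel₀ two_ne_zero, add_sub_cancel_left, hx]

variable {p : ℝ≥0∞} [Fact (1 ≤ p)]

theorem exists_isWeightedComp_rearrange (hp : p ≠ ∞) (hA : MeasurableSet A) (hA₀ : leb01 A ≠ 0)
    (hA₁ : leb01 Aᶜ ≠ 0) :
    ∃ T ∈ disjointnessPreserving p, IsWeightedComp T (rearrangeWeight p A) (rearrange A) := by
  obtain ⟨ψ, hψ, hψA⟩ := exists_measurable_leftInverse_rearrange hA hA₀ hA₁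
  refine exists_isWeightedComp hp (measurable_rearrangeWeight p hA) (.of_forall fun x => ?_)
    (measurePreserving_rearrange_withDensity (one_pos.trans_le Fact.out).ne' hp hA hA₀ hA₁) hψ hψA
  have h_pos {B : Set ℝ} (hB : leb01 B ≠ 0) : 0 < (2 * leb01.real B)⁻¹ ^ (1 / p.toReal) :=
    Real.rpow_pos_of_pos (inv_pos.2 (mul_pos two_pos (leb01_real_pos hB))) _
  by_cases hx : x ∈ A
  · rw [rearrangeWeight_of_mem p hx]
    exact_mod_cast (h_pos hA₀).ne'
  · rw [rearrangeWeight_of_notMem p hx]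
    exact_mod_cast (h_pos hA₁).ne'

theorem IsWeightedComp.apply_indLp_lowerHalf (hA : MeasurableSet A) (hA₀ : leb01 A ≠ 0)
    (hA₁ : leb01 Aᶜ ≠ 0) {T : IsomLp p}
    (hT : IsWeightedComp T (rearrangeWeight p A) (rearrange A)) :
    T (indLp p (measurableSet_Iio : MeasurableSet lowerHalf)) =
      (((2 * leb01.real A)⁻¹ ^ (1 / p.toReal) : ℝ) : ℂ) • indLp p hA := by
  refine Lp.ext ?_
  filter_upwards [hT.coeFn_eq (indLp p measurableSet_Iio),
    hT.quasiMeasurePreserving.ae (coeFn_indLp p (measurableSet_Iio : MeasurableSet lowerHalf)),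
    Lp.coeFn_smul (((2 * leb01.real A)⁻¹ ^ (1 / p.toReal) : ℝ) : ℂ) (indLp p hA),
    coeFn_indLp p hA, rearrange_mem_lowerHalf_iff hA hA₀ hA₁] with x h_T h_comp h_smul h_ind h_mem
  rw [h_T, h_comp, h_smul, Pi.smul_apply, h_ind, smul_eq_mul]
  by_cases hx : x ∈ A
  · rw [Set.indicator_of_mem (h_mem.2 hx), Set.indicator_of_mem hx, rearrangeWeight_of_mem p hx]
  · rw [Set.indicator_of_notMem (mt h_mem.1 hx), Set.indicator_of_notMem hx, mul_zero, mul_zero]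

end Rearrangement

/-! ## Dense invariant subspaces are modules over the bounded functions -/

theorem exp_arg_add_arccos_add_exp_arg_sub_arccos {a : ℂ} (ha : ‖a‖ ≤ 1) :
    Complex.exp ((a.arg + Real.arccos ‖a‖ : ℝ) * Complex.I) +
      Complex.exp ((a.arg - Real.arccos ‖a‖ : ℝ) * Complex.I) = 2 * a := by
  have h_cos : Complex.exp (Real.arccos ‖a‖ * Complex.I) +
      Complex.exp (-Real.arccos ‖a‖ * Complex.I) = 2 * (‖a‖ : ℂ) := by
    rw [← Complex.two_cos, ← Complex.ofReal_cos,
      Real.cos_arccos (neg_one_lt_zero.le.trans (norm_nonneg a)) ha]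
  push_cast
  rw [sub_eq_add_neg, add_mul, add_mul, Complex.exp_add, Complex.exp_add, ← mul_add, h_cos]
  linear_combination 2 * Complex.norm_mul_exp_arg_mul_I a

section Module

variable {p : ℝ≥0∞} [Fact (1 ≤ p)] {Y₀ : Submodule ℂ (LpI p)}

-- A function bounded by `1` is the average of two unimodular functions.
theorem mem_of_bounded_mul (hp : p ≠ ∞)
    (hY : ∀ T ∈ disjointnessPreserving p, ∀ y ∈ Y₀, T y ∈ Y₀) {y : LpI p} (hy : y ∈ Y₀)
    {a : ℝ → ℂ} (ha : Measurable a) (ha₁ : ∀ x, ‖a x‖ ≤ 1) {k : LpI p}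
    (hk : ∀ᵐ x ∂leb01, k x = a x * y x) : k ∈ Y₀ := by
  obtain ⟨T, hT, hTW⟩ := exists_isWeightedComp_unimodular hp
    (W := fun x => Complex.exp (((a x).arg + Real.arccos ‖a x‖ : ℝ) * Complex.I))
    (by fun_prop) fun x => Complex.norm_exp_ofReal_mul_I _
  obtain ⟨S, hS, hSW⟩ := exists_isWeightedComp_unimodular hp
    (W := fun x => Complex.exp (((a x).arg - Real.arccos ‖a x‖ : ℝ) * Complex.I))
    (by fun_prop) fun x => Complex.norm_exp_ofReal_mul_I _
  have h_avg : k = (2⁻¹ : ℂ) • (T y + S y) := by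
    refine Lp.ext ?_
    filter_upwards [hk, hTW.coeFn_eq y, hSW.coeFn_eq y, Lp.coeFn_smul (2⁻¹ : ℂ) (T y + S y),
      Lp.coeFn_add (T y) (S y)] with x h_k h_T h_S h_smul h_add
    rw [h_k, h_smul, Pi.smul_apply, h_add, Pi.add_apply, h_T, h_S, id, ← add_mul,
      exp_arg_add_arccos_add_exp_arg_sub_arccos (ha₁ x), smul_eq_mul, mul_assoc,
      inv_mul_cancel_left₀ two_ne_zero]
  rw [h_avg]
  exact Y₀.smul_mem _ (Y₀.add_mem (hY T hT y hy) (hY S hS y hy))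

theorem indLp_mem_of_le_norm (hp : p ≠ ∞)
    (hY : ∀ T ∈ disjointnessPreserving p, ∀ y ∈ Y₀, T y ∈ Y₀) {y : LpI p} (hy : y ∈ Y₀)
    {A : Set ℝ} (hA : MeasurableSet A) {ε : ℝ} (hε : 0 < ε)
    (hle : ∀ᵐ x ∂leb01, x ∈ A → ε ≤ ‖y x‖) : indLp p hA ∈ Y₀ := by
  have hy_meas := (Lp.stronglyMeasurable y).measurable
  let B : Set ℝ := A ∩ {x | ε ≤ ‖y x‖}
  have hB_meas : MeasurableSet B := hA.inter (measurableSet_le measurable_const hy_meas.norm)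
  have h_smul_mem : (ε : ℂ) • indLp p hA ∈ Y₀ := by
    refine mem_of_bounded_mul hp hY hy (a := B.indicator fun x => ε / y x)
      ((measurable_const.div hy_meas).indicator hB_meas) (fun x => ?_) ?_
    · by_cases hx : x ∈ B
      · rw [Set.indicator_of_mem hx, norm_div, Complex.norm_real, Real.norm_of_nonneg hε.le]
        exact div_le_one_of_le₀ hx.2 (norm_nonneg _)
      · rw [Set.indicator_of_notMem hx, norm_zero]
        exact zero_le_one
    · filter_upwards [coeFn_indLp p hA, Lp.coeFn_smul (ε : ℂ) (indLp p hA), hle]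
        with x h_ind h_smul hx_le
      rw [h_smul, Pi.smul_apply, h_ind]
      by_cases hx : x ∈ A
      · have hyx : y x ≠ 0 := norm_pos_iff.1 (hε.trans_le (hx_le hx))
        have hxB : x ∈ B := ⟨hx, hx_le hx⟩
        rw [Set.indicator_of_mem hx, Set.indicator_of_mem hxB, div_mul_cancel₀ _ hyx,
          smul_eq_mul, mul_one]
      · have hxB : x ∉ B := fun h => hx h.1
        rw [Set.indicator_of_notMem hx, Set.indicator_of_notMem hxB, smul_zero, zero_mul]
  rwa [Y₀.smul_mem_iff (Complex.ofReal_ne_zero.2 hε.ne')] at h_smul_mem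

theorem indLp_mem_of_subset (hp : p ≠ ∞)
    (hY : ∀ T ∈ disjointnessPreserving p, ∀ y ∈ Y₀, T y ∈ Y₀) {A B : Set ℝ}
    (hA : MeasurableSet A) (hB : MeasurableSet B) (hBY : indLp p hB ∈ Y₀) (hAB : A ⊆ B) :
    indLp p hA ∈ Y₀ := by
  refine indLp_mem_of_le_norm hp hY hBY hA one_pos ?_
  filter_upwards [coeFn_indLp p hB] with x h_ind hx
  rw [h_ind, Set.indicator_of_mem (hAB hx), norm_one]

theorem norm_indLp (hp : p ≠ ∞) {A : Set ℝ} (hA : MeasurableSet A) :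
    ‖indLp p hA‖ = leb01.real A ^ (1 / p.toReal) := by
  rw [norm_indicatorConstLp (one_pos.trans_le Fact.out).ne' hp, norm_one, one_mul]

omit [Fact (1 ≤ p)] in
theorem exists_leb01_le_norm_ne_zero {y : LpI p} (hy : y ≠ 0) :
    ∃ ε : ℝ, 0 < ε ∧ leb01 {x | ε ≤ ‖y x‖} ≠ 0 := by
  contrapose! hy
  refine Lp.ext ?_
  have h_null (n : ℕ) : ∀ᵐ x ∂leb01, ‖y x‖ < 1 / (n + 1) := by
    simpa only [ae_iff, not_lt] using hy _ Nat.one_div_pos_of_nat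
  filter_upwards [ae_all_iff.2 h_null, Lp.coeFn_zero ℂ p leb01] with x hx h_zero
  rw [h_zero, Pi.zero_apply, ← norm_le_zero_iff]
  exact ge_of_tendsto' tendsto_one_div_add_atTop_nhds_zero_nat fun n => (hx n).le

theorem exists_subset_leb01_ne_zero {A : Set ℝ} (hA : MeasurableSet A) (hA₀ : leb01 A ≠ 0) :
    ∃ B ⊆ A, MeasurableSet B ∧ leb01 B ≠ 0 ∧ leb01 Bᶜ ≠ 0 := by
  rw [← measure_inter_add_sdiff A (measurableSet_Iio : MeasurableSet lowerHalf), ne_eq,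
    add_eq_zero, not_and_or] at hA₀
  rcases hA₀ with h | h
  · refine ⟨A ∩ lowerHalf, Set.inter_subset_left, hA.inter measurableSet_Iio, h, fun h_null => ?_⟩
    have := measure_mono_null (Set.compl_subset_compl.2 Set.inter_subset_right) h_null
    exact leb01_compl_lowerHalf_ne_zero this
  · refine ⟨A \ lowerHalf, Set.sdiff_subset, hA.diff measurableSet_Iio, h, fun h_null => ?_⟩
    have := measure_mono_null (fun x hx (hx' : x ∈ A \ lowerHalf) => hx'.2 hx) h_null
    exact leb01_lowerHalf_ne_zero this

theorem indLp_lowerHalf_mem (hp : p ≠ ∞)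
    (hY : ∀ T ∈ disjointnessPreserving p, ∀ y ∈ Y₀, T y ∈ Y₀) (hd : Dense (Y₀ : Set (LpI p))) :
    indLp p (measurableSet_Iio : MeasurableSet lowerHalf) ∈ Y₀ := by
  have h_ne : indLp p (measurableSet_Iio : MeasurableSet lowerHalf) ≠ 0 := by
    rw [← norm_ne_zero_iff, norm_indLp hp]
    exact (Real.rpow_pos_of_pos (leb01_real_pos leb01_lowerHalf_ne_zero) _).ne'
  obtain ⟨y, hy, hy₀⟩ := hd.exists_mem_open isOpen_compl_singleton ⟨_, h_ne⟩
  obtain ⟨ε, hε, hy_ne⟩ := exists_leb01_le_norm_ne_zero hy₀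
  obtain ⟨A, hA_sub, hA, hA₀, hA₁⟩ := exists_subset_leb01_ne_zero
    (measurableSet_le measurable_const (Lp.stronglyMeasurable y).measurable.norm) hy_ne
  have hAY : indLp p hA ∈ Y₀ := indLp_mem_of_le_norm hp hY hy hA hε (.of_forall hA_sub)
  obtain ⟨T, hT, hTW⟩ := exists_isWeightedComp_rearrange (p := p) hp hA hA₀ hA₁
  have h_mem := hY T⁻¹ (inv_mem hT) _ (Y₀.smul_mem
    ((((2 * leb01.real A)⁻¹ ^ (1 / p.toReal) : ℝ) : ℂ)) hAY)
  rw [← hTW.apply_indLp_lowerHalf hA hA₀ hA₁] at h_mem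
  exact (T.symm_apply_apply (indLp p (measurableSet_Iio : MeasurableSet lowerHalf))) ▸ h_mem

end Module

/-! ## Means of equidistributed functions -/

theorem setIntegral_norm_le_norm_mul_rpow {α E : Type*} [MeasurableSpace α] {μ : Measure α}
    [IsFiniteMeasure μ] [NormedAddCommGroup E] {p : ℝ≥0∞} (hp : 1 ≤ p) (f : Lp E p μ)
    (A : Set α) : ∫ x in A, ‖f x‖ ∂μ ≤ ‖f‖ * μ.real A ^ (1 - 1 / p.toReal) := by
  have hf := (Lp.aestronglyMeasurable f).restrict (s := A)
  have h_holder := eLpNorm_le_eLpNorm_mul_rpow_measure_univ hp hf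
  rw [eLpNorm_one_eq_lintegral_enorm, Measure.restrict_apply_univ, ENNReal.toReal_one,
    div_one] at h_holder
  have h_exp : 0 ≤ 1 - 1 / p.toReal := by
    rcases eq_or_ne p ∞ with rfl | hp'
    · simp
    · exact sub_nonneg.2 (div_le_one_of_le₀ (ENNReal.toReal_mono hp' hp) ENNReal.toReal_nonneg)
  have h_le : eLpNorm f p (μ.restrict A) * μ A ^ (1 - 1 / p.toReal) ≤
      eLpNorm f p μ * μ A ^ (1 - 1 / p.toReal) := by
    gcongr
    exact Measure.restrict_le_self
  rw [integral_norm_eq_lintegral_enorm hf, Lp.norm_def, measureReal_def, ENNReal.toReal_rpow,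
    ← ENNReal.toReal_mul]
  exact ENNReal.toReal_mono (ENNReal.mul_ne_top (Lp.eLpNorm_ne_top f)
    (ENNReal.rpow_ne_top_of_nonneg h_exp (measure_ne_top μ A))) (h_holder.trans h_le)

theorem setIntegral_norm_le_mul_measureReal {p : ℝ≥0∞} [Fact (1 ≤ p)] (hp : p ≠ ∞) {A : Set ℝ}
    (hA : MeasurableSet A) (hA₀ : leb01 A ≠ 0) {f : LpI p} {C : ℝ} (hf : ‖f‖ ≤ C * ‖indLp p hA‖) :
    ∫ x in A, ‖f x‖ ∂leb01 ≤ C * leb01.real A := by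
  calc ∫ x in A, ‖f x‖ ∂leb01
      ≤ ‖f‖ * leb01.real A ^ (1 - 1 / p.toReal) := setIntegral_norm_le_norm_mul_rpow Fact.out f A
    _ ≤ C * leb01.real A ^ (1 / p.toReal) * leb01.real A ^ (1 - 1 / p.toReal) := by
        rw [← norm_indLp hp hA]
        gcongr
    _ = C * leb01.real A := by
        rw [mul_assoc, ← Real.rpow_add (leb01_real_pos hA₀), add_sub_cancel, Real.rpow_one]

/-- Truncation of real numbers to the interval `[-n, n]`. -/
noncomputable def truncate (n : ℕ) (t : ℝ) : ℝ :=
  max (-n : ℝ) (min n t)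

theorem measurable_truncate (n : ℕ) : Measurable (truncate n) :=
  measurable_const.max (measurable_const.min measurable_id)

theorem abs_truncate_le (n : ℕ) (t : ℝ) : |truncate n t| ≤ n :=
  abs_le.2 ⟨le_max_left _ _,
    max_le (neg_le_self n.cast_nonneg) (min_le_left _ _)⟩

theorem abs_truncate_sub_le (n : ℕ) (s t : ℝ) : |truncate n s - truncate n t| ≤ |s - t| :=
  calc |truncate n s - truncate n t|
      ≤ |min (n : ℝ) s - min (n : ℝ) t| := by
        rw [truncate, truncate, max_comm, max_comm (-n : ℝ)]
        exact abs_max_sub_max_le_abs _ _ _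
    _ ≤ |s - t| := by simpa using abs_min_sub_min_le_max (n : ℝ) s n t

theorem tendsto_truncate (t : ℝ) : Tendsto (fun n => truncate n t) atTop (𝓝 t) := by
  refine tendsto_const_nhds.congr' ?_
  filter_upwards [eventually_ge_atTop ⌈|t|⌉₊] with n hn
  have ht := abs_le.1 (Nat.ceil_le.1 hn)
  rw [truncate, min_eq_right ht.2, max_eq_right ht.1]

theorem integral_sub_eq_zero_of_identDistrib {α : Type*} [MeasurableSpace α]
    {μ : Measure α} [IsFiniteMeasure μ] {X Y : α → ℝ} (h : ProbabilityTheory.IdentDistrib X Y μ μ)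
    (h_int : Integrable (fun x => X x - Y x) μ) : ∫ x, (X x - Y x) ∂μ = 0 := by
  have h_trunc {Z : α → ℝ} (hZ : AEMeasurable Z μ) (n : ℕ) :
      Integrable (fun x => truncate n (Z x)) μ :=
    .of_bound ((measurable_truncate n).comp_aemeasurable hZ).aestronglyMeasurable n
      (.of_forall fun x => abs_truncate_le n _)
  have h_zero (n : ℕ) : ∫ x, (truncate n (X x) - truncate n (Y x)) ∂μ = 0 := by
    rw [integral_sub (h_trunc h.aemeasurable_fst n) (h_trunc h.aemeasurable_snd n), sub_eq_zero]
    exact (h.comp (measurable_truncate n)).integral_eq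
  have h_lim := tendsto_integral_of_dominated_convergence
    (F := fun n x => truncate n (X x) - truncate n (Y x)) (fun x => |X x - Y x|)
    (fun n => ((h_trunc h.aemeasurable_fst n).sub
      (h_trunc h.aemeasurable_snd n)).aestronglyMeasurable) h_int.abs
    (fun n => .of_forall fun x => abs_truncate_sub_le n _ _)
    (.of_forall fun x => (tendsto_truncate (X x)).sub (tendsto_truncate (Y x)))
  simp only [h_zero] at h_lim
  exact tendsto_nhds_unique h_lim tendsto_const_nhds

section Fibers

variable {α ι : Type*} [MeasurableSpace α] {μ : Measure α} [MeasurableSpace ι]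
  [MeasurableSingletonClass ι] {φ : α → ι} {H : Set α}

theorem eventuallyEq_fiber {E : Type*} (f : ι → α → E) (hφ : Measurable φ)
    (hH : MeasurableSet H) (i : ι) :
    (fun x => f (φ x) x) =ᵐ[μ.restrict (H ∩ φ ⁻¹' {i})] f i := by
  filter_upwards [ae_restrict_mem (hH.inter (hφ (measurableSet_singleton i)))] with x hx
  rw [show φ x = i from hx.2]

theorem restrict_eq_sum_inter_fiber [Fintype ι] (hφ : Measurable φ) (hH : MeasurableSet H) :
    μ.restrict H = ∑ i, μ.restrict (H ∩ φ ⁻¹' {i}) := by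
  rw [← Measure.sum_fintype, ← Measure.restrict_iUnion
    (fun i j hij => (Set.disjoint_singleton.2 hij).preimage φ |>.mono Set.inter_subset_right
      Set.inter_subset_right) fun i => hH.inter (hφ (measurableSet_singleton i)),
    ← Set.inter_iUnion, ← Set.preimage_iUnion, Set.iUnion_of_singleton, Set.preimage_univ,
    Set.inter_univ]

variable {E : Type*} [NormedAddCommGroup E] {f : ι → α → E}

theorem integrableOn_fiberwise [Finite ι] (hφ : Measurable φ) (hH : MeasurableSet H)
    (hf : ∀ i, IntegrableOn (f i) (H ∩ φ ⁻¹' {i}) μ) :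
    IntegrableOn (fun x => f (φ x) x) H μ := by
  cases nonempty_fintype ι
  rw [IntegrableOn, restrict_eq_sum_inter_fiber hφ hH, integrable_finsetSum_measure]
  exact fun i _ => (integrable_congr (eventuallyEq_fiber f hφ hH i)).2 (hf i)

theorem setIntegral_fiberwise [Fintype ι] [NormedSpace ℝ E] (hφ : Measurable φ)
    (hH : MeasurableSet H) (hf : ∀ i, IntegrableOn (f i) (H ∩ φ ⁻¹' {i}) μ) :
    ∫ x in H, f (φ x) x ∂μ = ∑ i, ∫ x in H ∩ φ ⁻¹' {i}, f i x ∂μ := by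
  rw [restrict_eq_sum_inter_fiber hφ hH, integral_finsetSum_measure
    fun i _ => (integrable_congr (eventuallyEq_fiber f hφ hH i)).2 (hf i)]
  exact Finset.sum_congr rfl fun i _ => integral_congr_ae (eventuallyEq_fiber f hφ hH i)

end Fibers

section PiecewiseRearrange

variable {ι : Type*} {φ : ℝ → ι}

/-- The map equal on each piece `lowerHalf ∩ φ ⁻¹' {i}` of `lowerHalf` to the increasing
rearrangement of that piece onto the whole of `lowerHalf`. -/
noncomputable def piecewiseRearrange (φ : ℝ → ι) (x : ℝ) : ℝ :=
  rearrange (lowerHalf ∩ φ ⁻¹' {φ x}) x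

variable [Finite ι] [MeasurableSpace ι] [MeasurableSingletonClass ι]

theorem measurable_piecewiseRearrange (hφ : Measurable φ) : Measurable (piecewiseRearrange φ) :=
  (measurable_from_prod_countable_right (f := fun z : ι × ℝ =>
    rearrange (lowerHalf ∩ φ ⁻¹' {z.1}) z.2) fun i =>
      measurable_rearrange (measurableSet_Iio.inter (hφ (measurableSet_singleton i)))).comp
    (hφ.prodMk measurable_id)

theorem restrict_eq_smul_cond {A : Set ℝ} (hA₀ : leb01 A ≠ 0) :
    leb01.restrict A = leb01 A • ProbabilityTheory.cond leb01 A := by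
  rw [ProbabilityTheory.cond, smul_smul, ENNReal.mul_inv_cancel hA₀ (measure_ne_top _ _), one_smul]

theorem measurePreserving_piecewiseRearrange (hφ : Measurable φ)
    (h₀ : ∀ i, leb01 (lowerHalf ∩ φ ⁻¹' {i}) ≠ 0) :
    MeasurePreserving (piecewiseRearrange φ) (leb01.restrict lowerHalf)
      (leb01.restrict lowerHalf) := by
  cases nonempty_fintype ι
  have h_sum := restrict_eq_sum_inter_fiber (μ := leb01) hφ (measurableSet_Iio (a := (2⁻¹ : ℝ)))
  have h_piece (i : ι) : (leb01.restrict (lowerHalf ∩ φ ⁻¹' {i})).map (piecewiseRearrange φ) =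
      leb01 (lowerHalf ∩ φ ⁻¹' {i}) • ProbabilityTheory.cond leb01 lowerHalf := by
    have h_eq : piecewiseRearrange φ =ᵐ[leb01.restrict (lowerHalf ∩ φ ⁻¹' {i})]
        rearrange (lowerHalf ∩ φ ⁻¹' {i}) :=
      eventuallyEq_fiber (fun i => rearrange (lowerHalf ∩ φ ⁻¹' {i})) hφ measurableSet_Iio i
    rw [Measure.map_congr h_eq,
      restrict_eq_smul_cond (h₀ i), Measure.map_smul, (measurePreserving_rearrange
        (measurableSet_Iio.inter (hφ (measurableSet_singleton i))) (h₀ i)).map_eq]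
  refine ⟨measurable_piecewiseRearrange hφ, ?_⟩
  calc (leb01.restrict lowerHalf).map (piecewiseRearrange φ)
      = ∑ i, (leb01.restrict (lowerHalf ∩ φ ⁻¹' {i})).map (piecewiseRearrange φ) := by
        rw [h_sum, Measure.map_finset_sum (measurable_piecewiseRearrange hφ).aemeasurable]
    _ = (∑ i, leb01 (lowerHalf ∩ φ ⁻¹' {i})) • ProbabilityTheory.cond leb01 lowerHalf := by
        simp only [h_piece, Finset.sum_smul]
    _ = leb01.restrict lowerHalf := by
        rw [restrict_eq_smul_cond leb01_lowerHalf_ne_zero, ← Measure.restrict_apply_univ lowerHalf,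
          h_sum]
        simp

end PiecewiseRearrange

/-! ## Kalton–Peck maps are not linear perturbations of centralizers -/

section BoundedCommutators

variable {p : ℝ≥0∞} [Fact (1 ≤ p)] {Y₀ : Submodule ℂ (LpI p)} {L : Y₀ →ₗ[ℂ] L0} {C : ℝ}

/-- The commutators of `𝒦 + L` with the disjointness preserving isometries `f ↦ W · (f ∘ φ)` are
bounded by `C`; here `[T, 𝒦] y = -log ‖W‖ · T y` is written out. -/
def HasBoundedCommutators (L : Y₀ →ₗ[ℂ] L0) (C : ℝ) : Prop :=
  ∀ T ∈ disjointnessPreserving p, ∀ W φ, IsWeightedComp T W φ → ∀ (y : Y₀) (hy : T y ∈ Y₀),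
    ∃ e : LpI p, ‖e‖ ≤ C * ‖(y : LpI p)‖ ∧
      e =ᵐ[leb01] fun x => W x * L y (φ x) - L ⟨T y, hy⟩ x - (Real.log ‖W x‖ : ℂ) * T y x

theorem exists_hasBoundedCommutators_of_isCentralizer
    {U : disjointnessPreserving p →* Module.End ℂ L0}
    (hU : ∀ g : disjointnessPreserving p, IsContinuousExtension (g : IsomLp p) (U g))
    (hY₀ : ∀ g : disjointnessPreserving p, ∀ y ∈ Y₀, naturalAction _ g y ∈ Y₀)
    (h : IsCentralizer (toL0 p) U (restrictAction (naturalAction _) Y₀ hY₀)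
      fun y : Y₀ => kaltonPeck p (y : LpI p) + L y) :
    ∃ C, HasBoundedCommutators L C := by
  obtain ⟨-, C, hC⟩ := h
  refine ⟨C, fun T hT W φ hW y hy => ?_⟩
  obtain ⟨e, he, he_le⟩ := hC ⟨T, hT⟩ y
  refine ⟨e, he_le, ?_⟩
  have hV : IsContinuousExtension T (U ⟨T, hT⟩) := hU ⟨T, hT⟩
  set V := U ⟨T, hT⟩
  have h_split : (e : L0) = (V (kaltonPeck p y) - kaltonPeck p (T y)) +
      (V (L y) - L ⟨T y, hy⟩) := by
    refine he.trans (?_ : V (kaltonPeck p y + L y) - (kaltonPeck p (T y) + L ⟨T y, hy⟩) = _)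
    rw [map_add]
    abel
  filter_upwards [hV.coeFn_eq hW (L y), hV.kaltonPeck_sub hW y,
    AEEqFun.coeFn_add (V (kaltonPeck p y) - kaltonPeck p (T y)) (V (L y) - L ⟨T y, hy⟩),
    AEEqFun.coeFn_sub (V (L y)) (L ⟨T y, hy⟩)] with x h_V h_K h_add h_sub
  rw [h_split, h_add, Pi.add_apply, h_K, h_sub, Pi.sub_apply, h_V]
  ring

theorem HasBoundedCommutators.exists_rearrange (hp : p ≠ ∞) (hL : HasBoundedCommutators L C)
    {A : Set ℝ} (hA : MeasurableSet A) (hA₀ : leb01 A ≠ 0) (hA₁ : leb01 Aᶜ ≠ 0) {y w : Y₀}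
    (hy : (y : LpI p) = indLp p (measurableSet_Iio : MeasurableSet lowerHalf))
    (hw : (w : LpI p) = indLp p hA) :
    ∃ e : LpI p, ‖e‖ ≤ C * ‖indLp p hA‖ ∧ ∀ᵐ x ∂leb01, x ∈ A →
      e x = L y (rearrange A x) - L w x +
        ((1 / p.toReal * Real.log (2 * leb01.real A) : ℝ) : ℂ) := by
  have hA_pos : 0 < 2 * leb01.real A := mul_pos two_pos (leb01_real_pos hA₀)
  obtain ⟨T, hT, hTW⟩ := exists_isWeightedComp_rearrange (p := p) hp hA hA₀ hA₁
  set c : ℝ := (2 * leb01.real A)⁻¹ ^ (1 / p.toReal) with hc_def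
  have hc : 0 < c := Real.rpow_pos_of_pos (inv_pos.2 hA_pos) _
  have hc' : (c : ℂ) ≠ 0 := Complex.ofReal_ne_zero.2 hc.ne'
  have hTy : T y = ((c : ℂ) • w : Y₀) := by
    rw [hy, hTW.apply_indLp_lowerHalf hA hA₀ hA₁, Submodule.coe_smul, hw]
  have hTy_mem : T y ∈ Y₀ := hTy ▸ ((c : ℂ) • w).2
  obtain ⟨e, he, he_eq⟩ := hL T hT _ _ hTW y hTy_mem
  have hLT : L ⟨T y, hTy_mem⟩ = (c : ℂ) • L w := by
    rw [← map_smul]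
    exact congrArg L (Subtype.ext hTy)
  have h_norm : ‖(c : ℂ)⁻¹ • e‖ ≤ C * ‖indLp p hA‖ := by
    have h_isom : ‖(y : LpI p)‖ = c * ‖indLp p hA‖ := by
      rw [← T.norm_map, hTy, Submodule.coe_smul, hw, norm_smul, Complex.norm_real,
        Real.norm_of_nonneg hc.le]
    rw [norm_smul, norm_inv, Complex.norm_real, Real.norm_of_nonneg hc.le, inv_mul_le_iff₀ hc,
      mul_left_comm, ← h_isom]
    exact he
  refine ⟨(c : ℂ)⁻¹ • e, h_norm, ?_⟩
  rw [hLT] at he_eq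
  rw [hTy, Submodule.coe_smul, hw] at he_eq
  have h_log : Real.log c = -(1 / p.toReal * Real.log (2 * leb01.real A)) := by
    rw [hc_def, Real.log_rpow (inv_pos.2 hA_pos), Real.log_inv, mul_neg]
  filter_upwards [he_eq, Lp.coeFn_smul (c : ℂ)⁻¹ e, AEEqFun.coeFn_smul (c : ℂ) (L w),
    Lp.coeFn_smul (c : ℂ) (indLp p hA), coeFn_indLp p hA] with x h_e h_inv h_w h_ind_smul h_ind hx
  rw [h_inv, Pi.smul_apply, h_e, h_w, Pi.smul_apply, h_ind_smul, Pi.smul_apply, h_ind,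
    Set.indicator_of_mem hx, rearrangeWeight_of_mem p hx, ← hc_def, Complex.norm_real,
    Real.norm_of_nonneg hc.le, h_log]
  simp only [smul_eq_mul, Complex.ofReal_neg]
  field_simp
  ring

section Average

variable {Γ : Type*} [AddCommGroup Γ] [MeasurableSpace Γ] [MeasurableSingletonClass Γ]
  {φ : ℝ → Γ} {y : Y₀} {w : Γ → Y₀}

theorem HasBoundedCommutators.exists_addChar [Fintype Γ] (hp : p ≠ ∞)
    (hY : ∀ T ∈ disjointnessPreserving p, ∀ y ∈ Y₀, T y ∈ Y₀) (hL : HasBoundedCommutators L C)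
    (hφ : Measurable φ) (hw : ∀ i, w i =ᵐ[leb01] (φ ⁻¹' {i}).indicator (y : LpI p))
    (ψ : AddChar Γ ℂ) :
    ∃ e : LpI p, ‖e‖ ≤ C * ‖(y : LpI p)‖ ∧
      e =ᵐ[leb01] fun x => L y x - ∑ i, ψ (i - φ x) * L (w i) x := by
  obtain ⟨T, hT, hTW⟩ := exists_isWeightedComp_unimodular (p := p) hp (W := fun x => ψ (φ x))
    ((measurable_of_countable ψ).comp hφ) fun x => AddChar.norm_apply ψ (φ x)
  have hTy : T y = ∑ i, ψ i • (w i : LpI p) := by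
    refine Lp.ext ?_
    filter_upwards [hTW.coeFn_eq y, Lp.coeFn_finsetSum Finset.univ fun i => ψ i • (w i : LpI p),
      ae_all_iff.2 fun i => Lp.coeFn_smul (ψ i) (w i : LpI p), ae_all_iff.2 hw]
      with x h_T h_sum h_smul h_w
    classical
    simp only [h_T, h_sum, Finset.sum_apply, h_smul, Pi.smul_apply, h_w,
      Set.indicator_apply, Set.mem_preimage, Set.mem_singleton_iff, smul_eq_mul, mul_ite,
      mul_zero, Finset.sum_ite_eq, Finset.mem_univ, if_true, id]
  have hTy_mem : T y ∈ Y₀ := hY T hT y y.2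
  obtain ⟨e, he, he_eq⟩ := hL T hT _ _ hTW y hTy_mem
  have hLT : L ⟨T y, hTy_mem⟩ = ∑ i, ψ i • L (w i) := by
    simp only [← map_smul, ← map_sum]
    refine congrArg L (Subtype.ext (hTy.trans ?_))
    simp only [Submodule.coe_sum, Submodule.coe_smul]
  refine ⟨T.symm e, (T.symm.norm_map e).trans_le he, ?_⟩
  have h_symm := hTW.coeFn_eq (T.symm e)
  rw [T.apply_symm_apply] at h_symm
  rw [hLT] at he_eq
  filter_upwards [he_eq, h_symm, AEEqFun.coeFn_finsetSum Finset.univ fun i => ψ i • L (w i),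
    ae_all_iff.2 fun i => AEEqFun.coeFn_smul (ψ i) (L (w i))] with x h_e h_symm h_sum h_smul
  have hψ : ψ (φ x) ≠ 0 := norm_ne_zero_iff.1 ((AddChar.norm_apply ψ (φ x)).trans_ne one_ne_zero)
  rw [AddChar.norm_apply, Real.log_one, Complex.ofReal_zero, zero_mul, sub_zero, h_symm, h_sum]
    at h_e
  refine mul_left_cancel₀ hψ (h_e.trans ?_)
  simp only [Finset.sum_apply, h_smul, Pi.smul_apply, smul_eq_mul, mul_sub, Finset.mul_sum, id,
    AddChar.map_sub_eq_div]
  congr 1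
  refine Finset.sum_congr rfl fun i _ => ?_
  field_simp

-- By orthogonality, averaging over the characters of `Γ` isolates the term `i = φ x`.
theorem HasBoundedCommutators.exists_average [Finite Γ] (hp : p ≠ ∞)
    (hY : ∀ T ∈ disjointnessPreserving p, ∀ y ∈ Y₀, T y ∈ Y₀) (hL : HasBoundedCommutators L C)
    (hφ : Measurable φ) (hw : ∀ i, w i =ᵐ[leb01] (φ ⁻¹' {i}).indicator (y : LpI p)) :
    ∃ e : LpI p, ‖e‖ ≤ C * ‖(y : LpI p)‖ ∧
      e =ᵐ[leb01] fun x => L y x - L (w (φ x)) x := by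
  classical
  cases nonempty_fintype Γ
  choose e he he_eq using hL.exists_addChar hp hY hφ hw
  have h_card : (Fintype.card Γ : ℂ) ≠ 0 := Nat.cast_ne_zero.2 Fintype.card_ne_zero
  have h_card' : (0 : ℝ) < Fintype.card Γ := Nat.cast_pos.2 Fintype.card_pos
  refine ⟨(Fintype.card Γ : ℂ)⁻¹ • ∑ ψ, e ψ, ?_, ?_⟩
  · rw [norm_smul, norm_inv, Complex.norm_natCast, inv_mul_le_iff₀ h_card']
    refine (norm_sum_le_of_le _ fun ψ _ => he ψ).trans_eq ?_
    rw [Finset.sum_const, Finset.card_univ, AddChar.card_eq, nsmul_eq_mul]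
  · filter_upwards [ae_all_iff.2 he_eq, Lp.coeFn_smul (Fintype.card Γ : ℂ)⁻¹ (∑ ψ, e ψ),
      Lp.coeFn_finsetSum Finset.univ e] with x h_e h_smul h_sum
    have h_orth : ∑ ψ : AddChar Γ ℂ, ∑ i, ψ (i - φ x) * L (w i) x =
        Fintype.card Γ * L (w (φ x)) x := by
      rw [Finset.sum_comm]
      simp only [← Finset.sum_mul, AddChar.sum_apply_eq_ite, sub_eq_zero, ite_mul, zero_mul,
        Finset.sum_ite_eq', Finset.mem_univ, if_true]
    rw [h_smul, Pi.smul_apply, h_sum, Finset.sum_apply, Finset.sum_congr rfl fun ψ _ => h_e ψ,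
      Finset.sum_sub_distrib, h_orth, Finset.sum_const, Finset.card_univ, AddChar.card_eq,
      nsmul_eq_mul, ← mul_sub, smul_eq_mul, inv_mul_cancel_left₀ h_card]

end Average

end BoundedCommutators

section Contradiction

variable {p : ℝ≥0∞} [Fact (1 ≤ p)] {Y₀ : Submodule ℂ (LpI p)} {L : Y₀ →ₗ[ℂ] L0} {C : ℝ}

theorem HasBoundedCommutators.exists_piecewiseRearrange {ι : Type*} [Finite ι] [MeasurableSpace ι]
    [MeasurableSingletonClass ι] {φ : ℝ → ι} (hp : p ≠ ∞) (hL : HasBoundedCommutators L C)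
    (hφ : Measurable φ) (h₀ : ∀ i, leb01 (lowerHalf ∩ φ ⁻¹' {i}) ≠ 0) {y : Y₀} {w : ι → Y₀}
    (hy : (y : LpI p) = indLp p (measurableSet_Iio : MeasurableSet lowerHalf))
    (hw : ∀ i, (w i : LpI p) =
      indLp p ((measurableSet_Iio : MeasurableSet lowerHalf).inter
        (hφ (measurableSet_singleton i)))) :
    ∃ E : ℝ → ℂ, IntegrableOn E lowerHalf leb01 ∧
      ∫ x in lowerHalf, ‖E x‖ ∂leb01 ≤ C * leb01.real lowerHalf ∧
      ∀ᵐ x ∂leb01, x ∈ lowerHalf → E x = L y (piecewiseRearrange φ x) - L (w (φ x)) x +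
        ((1 / p.toReal * Real.log (2 * leb01.real (lowerHalf ∩ φ ⁻¹' {φ x})) : ℝ) : ℂ) := by
  cases nonempty_fintype ι
  have hA (i : ι) : MeasurableSet (lowerHalf ∩ φ ⁻¹' {i}) :=
    measurableSet_Iio.inter (hφ (measurableSet_singleton i))
  have h₁ (i : ι) : leb01 (lowerHalf ∩ φ ⁻¹' {i})ᶜ ≠ 0 := fun h => leb01_compl_lowerHalf_ne_zero
    (measure_mono_null (Set.compl_subset_compl.2 Set.inter_subset_left) h)
  choose e he he_eq using fun i => hL.exists_rearrange hp (hA i) (h₀ i) (h₁ i) hy (hw i)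
  have h_int (i : ι) : IntegrableOn (e i) (lowerHalf ∩ φ ⁻¹' {i}) leb01 :=
    ((Lp.memLp (e i)).integrable Fact.out).integrableOn
  refine ⟨fun x => e (φ x) x, integrableOn_fiberwise (f := fun i => ⇑(e i)) hφ measurableSet_Iio
    h_int, ?_, ?_⟩
  · calc ∫ x in lowerHalf, ‖e (φ x) x‖ ∂leb01
        = ∑ i, ∫ x in lowerHalf ∩ φ ⁻¹' {i}, ‖e i x‖ ∂leb01 :=
          setIntegral_fiberwise (f := fun i x => ‖e i x‖) hφ measurableSet_Iio
            fun i => (h_int i).norm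
      _ ≤ ∑ i, C * leb01.real (lowerHalf ∩ φ ⁻¹' {i}) := Finset.sum_le_sum fun i _ =>
          setIntegral_norm_le_mul_measureReal hp (hA i) (h₀ i) (he i)
      _ = C * leb01.real lowerHalf := by
          simpa [mul_comm C] using (setIntegral_fiberwise (μ := leb01) (f := fun _ _ => C)
            hφ (measurableSet_Iio (a := (2⁻¹ : ℝ))) fun i => integrableOn_const).symm
  · filter_upwards [ae_all_iff.2 he_eq] with x hx hx_mem
    exact hx (φ x) ⟨hx_mem, rfl⟩

section EqualPieces

variable {Γ : Type*} [AddCommGroup Γ] [Finite Γ] [MeasurableSpace Γ] [MeasurableSingletonClass Γ]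
  {φ : ℝ → Γ}

theorem HasBoundedCommutators.exists_comp_piecewiseRearrange_sub (hp : p ≠ ∞)
    (hY : ∀ T ∈ disjointnessPreserving p, ∀ y ∈ Y₀, T y ∈ Y₀) (hL : HasBoundedCommutators L C)
    (hφ : Measurable φ) (h₀ : ∀ i, leb01 (lowerHalf ∩ φ ⁻¹' {i}) ≠ 0)
    (h_card : ∀ i, 2 * leb01.real (lowerHalf ∩ φ ⁻¹' {i}) = (Nat.card Γ : ℝ)⁻¹)
    (y : Y₀) (hy : (y : LpI p) = indLp p (measurableSet_Iio : MeasurableSet lowerHalf)) :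
    ∃ D : ℝ → ℂ, IntegrableOn D lowerHalf leb01 ∧
      ∫ x in lowerHalf, ‖D x‖ ∂leb01 ≤ 2 * C * leb01.real lowerHalf ∧
      ∀ᵐ x ∂leb01, x ∈ lowerHalf → L y (piecewiseRearrange φ x) - L y x =
        ((1 / p.toReal * Real.log (Nat.card Γ) : ℝ) : ℂ) - D x := by
  let w (i : Γ) : Y₀ := ⟨_, indLp_mem_of_subset hp hY
    ((measurableSet_Iio : MeasurableSet lowerHalf).inter (hφ (measurableSet_singleton i))) _
    (hy ▸ y.2) Set.inter_subset_left⟩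
  have hw (i : Γ) : w i =ᵐ[leb01] (φ ⁻¹' {i}).indicator (y : LpI p) := by
    filter_upwards [coeFn_indLp p ((measurableSet_Iio : MeasurableSet lowerHalf).inter
      (hφ (measurableSet_singleton i))), coeFn_indLp p (measurableSet_Iio (a := (2⁻¹ : ℝ)))]
      with x h_w h_y
    rw [h_w, hy, Set.inter_comm, ← Set.indicator_indicator]
    by_cases hx : x ∈ φ ⁻¹' {i}
    · rw [Set.indicator_of_mem hx, Set.indicator_of_mem hx, h_y]
    · rw [Set.indicator_of_notMem hx, Set.indicator_of_notMem hx]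
  obtain ⟨E, hE_int, hE_le, hE⟩ := hL.exists_piecewiseRearrange hp hφ h₀ (w := w) hy fun i => rfl
  obtain ⟨e, he_le, he⟩ := hL.exists_average hp hY hφ hw
  have he_int : IntegrableOn e lowerHalf leb01 :=
    ((Lp.memLp e).integrable Fact.out).integrableOn
  refine ⟨fun x => e x - E x, he_int.sub hE_int, ?_, ?_⟩
  · calc ∫ x in lowerHalf, ‖e x - E x‖ ∂leb01
        ≤ ∫ x in lowerHalf, (‖e x‖ + ‖E x‖) ∂leb01 :=
          integral_mono (he_int.sub hE_int).norm (he_int.norm.add hE_int.norm)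
            fun x => norm_sub_le _ _
      _ = ∫ x in lowerHalf, ‖e x‖ ∂leb01 + ∫ x in lowerHalf, ‖E x‖ ∂leb01 :=
          integral_add he_int.norm hE_int.norm
      _ ≤ C * leb01.real lowerHalf + C * leb01.real lowerHalf :=
          add_le_add (setIntegral_norm_le_mul_measureReal hp measurableSet_Iio
            leb01_lowerHalf_ne_zero (hy ▸ he_le)) hE_le
      _ = 2 * C * leb01.real lowerHalf := by ring
  · filter_upwards [hE, he] with x hEx hex hx
    rw [hEx hx, hex, h_card, Real.log_inv]
    push_cast
    ring

-- `L y ∘ piecewiseRearrange φ - L y` is a difference of identically distributed functions, so its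
-- real part has mean zero.
theorem HasBoundedCommutators.log_card_le (hp : p ≠ ∞)
    (hY : ∀ T ∈ disjointnessPreserving p, ∀ y ∈ Y₀, T y ∈ Y₀) (hL : HasBoundedCommutators L C)
    (hφ : Measurable φ)
    (h_card : ∀ i, 2 * leb01.real (lowerHalf ∩ φ ⁻¹' {i}) = (Nat.card Γ : ℝ)⁻¹)
    (hH : indLp p (measurableSet_Iio : MeasurableSet lowerHalf) ∈ Y₀) :
    1 / p.toReal * Real.log (Nat.card Γ) ≤ 2 * C := by
  have h₀ (i : Γ) : leb01 (lowerHalf ∩ φ ⁻¹' {i}) ≠ 0 := fun h => by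
    have := h_card i
    rw [measureReal_def, h, ENNReal.toReal_zero, mul_zero] at this
    exact inv_ne_zero (Nat.cast_ne_zero.2 Nat.card_pos.ne') this.symm
  obtain ⟨D, hD_int, hD_le, hD⟩ :=
    hL.exists_comp_piecewiseRearrange_sub hp hY hφ h₀ h_card ⟨_, hH⟩ rfl
  set v : L0 := L ⟨_, hH⟩
  set κ : ℝ := 1 / p.toReal * Real.log (Nat.card Γ)
  have hv : Measurable fun x => (v x).re :=
    Complex.measurable_re.comp v.stronglyMeasurable.measurable
  have h_distrib : ProbabilityTheory.IdentDistrib (fun x => (v (piecewiseRearrange φ x)).re)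
      (fun x => (v x).re) (leb01.restrict lowerHalf) (leb01.restrict lowerHalf) := by
    have hR := measurePreserving_piecewiseRearrange hφ h₀
    exact ProbabilityTheory.IdentDistrib.comp (f := piecewiseRearrange φ) (g := id)
      ⟨hR.aemeasurable, aemeasurable_id, hR.map_eq.trans Measure.map_id.symm⟩ hv
  have h_diff : (fun x => (v (piecewiseRearrange φ x)).re - (v x).re)
      =ᵐ[leb01.restrict lowerHalf] fun x => κ - (D x).re := by
    filter_upwards [ae_restrict_of_ae hD, ae_restrict_mem measurableSet_Iio] with x hx hx_mem
    simpa only [Complex.sub_re, Complex.ofReal_re] using congrArg Complex.re (hx hx_mem)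
  have h_re : Integrable (fun x => (D x).re) (leb01.restrict lowerHalf) := hD_int.re
  have h_mean := integral_sub_eq_zero_of_identDistrib h_distrib
    ((integrable_congr h_diff).2 ((integrable_const κ).sub h_re))
  rw [integral_congr_ae h_diff, integral_sub (integrable_const κ) h_re, integral_const,
    measureReal_restrict_apply_univ, smul_eq_mul, sub_eq_zero, mul_comm] at h_mean
  refine le_of_mul_le_mul_right ?_ (leb01_real_pos leb01_lowerHalf_ne_zero)
  calc κ * leb01.real lowerHalf = ∫ x in lowerHalf, (D x).re ∂leb01 := h_mean
    _ ≤ ∫ x in lowerHalf, ‖D x‖ ∂leb01 :=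
        integral_mono h_re hD_int.norm fun x => Complex.re_le_norm _
    _ ≤ 2 * C * leb01.real lowerHalf := hD_le

end EqualPieces

theorem measureReal_lowerHalf_inter_preimage (N : ℕ) [NeZero N] (i : Fin N) :
    2 * leb01.real (lowerHalf ∩ (fun x => Fin.ofNat N ⌊2 * N * x⌋₊) ⁻¹' {i}) = (N : ℝ)⁻¹ := by
  have hN : (0 : ℝ) < N := Nat.cast_pos.2 (NeZero.pos N)
  have h_floor {x : ℝ} (hx : x ∈ Set.Ioo 0 2⁻¹) : Fin.ofNat N ⌊2 * N * x⌋₊ = i ↔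
      x ∈ Set.Ico (i / (2 * N) : ℝ) ((i + 1) / (2 * N)) := by
    have hx_lt : ⌊2 * N * x⌋₊ < N := (Nat.floor_lt' (NeZero.ne N)).2 (by nlinarith [hx.2])
    rw [Fin.ext_iff, Fin.val_ofNat, Nat.mod_eq_of_lt hx_lt, Nat.floor_eq_iff (by nlinarith [hx.1]),
      Set.mem_Ico, div_le_iff₀' (by positivity), lt_div_iff₀' (by positivity)]
  have h_le : ((i + 1) / (2 * N) : ℝ) ≤ 2⁻¹ := by
    rw [div_le_iff₀ (by positivity), inv_mul_cancel_left₀ two_ne_zero]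
    exact_mod_cast i.isLt
  have h_ae : (lowerHalf ∩ (fun x => Fin.ofNat N ⌊2 * N * x⌋₊) ⁻¹' {i} : Set ℝ) =ᵐ[leb01]
      Set.Ico (i / (2 * N) : ℝ) ((i + 1) / (2 * N)) := by
    filter_upwards [ae_restrict_mem measurableSet_Ioo] with x hx
    refine propext ⟨fun h => (h_floor ⟨hx.1, h.1⟩).1 h.2, fun h => ?_⟩
    have hx_lt : x < 2⁻¹ := h.2.trans_le h_le
    exact ⟨hx_lt, (h_floor ⟨hx.1, hx_lt⟩).2 h⟩
  have h_sub : Set.Ioo (i / (2 * N) : ℝ) ((i + 1) / (2 * N)) ⊆ Set.Ioo 0 1 :=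
    Set.Ioo_subset_Ioo (by positivity) (h_le.trans (inv_le_one_of_one_le₀ one_le_two))
  rw [measureReal_congr (h_ae.trans Ioo_ae_eq_Ico.symm), measureReal_restrict_apply
    measurableSet_Ioo, Set.inter_eq_left.2 h_sub, Real.volume_real_Ioo_of_le (by gcongr; linarith)]
  field_simp
  ring

theorem not_hasBoundedCommutators (hp : p ≠ ∞)
    (hY : ∀ T ∈ disjointnessPreserving p, ∀ y ∈ Y₀, T y ∈ Y₀) (hd : Dense (Y₀ : Set (LpI p))) :
    ¬ HasBoundedCommutators L C := by
  intro hL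
  have hp_pos : 0 < p.toReal :=
    ENNReal.toReal_pos (zero_lt_one.trans_le Fact.out).ne' hp
  obtain ⟨N, hN⟩ := exists_nat_gt (Real.exp (p.toReal * (2 * C)))
  have hN_pos : (0 : ℝ) < N := (Real.exp_pos _).trans hN
  have : NeZero N := ⟨Nat.cast_ne_zero.1 hN_pos.ne'⟩
  have h := hL.log_card_le hp hY (φ := fun x => Fin.ofNat N ⌊2 * N * x⌋₊)
    ((measurable_of_countable (Fin.ofNat N)).comp
      (Nat.measurable_floor.comp (measurable_const_mul (2 * N : ℝ))))
    (fun i => by rw [measureReal_lowerHalf_inter_preimage, Nat.card_fin])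
    (indLp_lowerHalf_mem hp hY hd)
  rw [Nat.card_fin, one_div, inv_mul_le_iff₀ hp_pos] at h
  exact h.not_gt ((Real.lt_log_iff_exp_lt hN_pos).2 hN)

end Contradiction

theorem theorem4p6 (p : ℝ≥0∞) [Fact (1 ≤ p)] (hp₁ : 1 < p) (hp₂ : p ≠ ∞)
    (G : Subgroup (IsomLp p))
    (hG : (p ≠ 2 ∧ G = ⊤) ∨ (p = 2 ∧ G = disjointnessPreserving p)) :
    ∃ (U : G →* Module.End ℂ L0) (d : G → (LpI p →ₗ[ℂ] L0)),
      -- `U` is the only extension of the natural action to `L₀` by continuous operators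
      (∀ (g : G) (V : Module.End ℂ L0), IsContinuousExtension (g : IsomLp p) V ↔ V = U g) ∧
      -- the commutators `[g, 𝒦]` are linear, `d g = -[g, 𝒦]`
      (∀ (g : G) (f : LpI p),
        d g f = -actionCommutator U (naturalAction G) (kaltonPeck p) g f) ∧
      -- compatibility with the Kalton-Peck map
      IsCompatibleVia (toL0 p) U (naturalAction G) (kaltonPeck p) d ∧
      -- compatibility with the differential of the scale of Lebesgue spaces
      (∀ B : LpI p → ℂ → LpI 1, IsCalderonSelection p B →
        IsCompatible (toL0 p) U (naturalAction G) (scaleDifferential p B)) ∧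
      -- extension to a bounded action on the Kalton-Peck space
      (∃ Λ : G →* Module.End ℂ (KaltonPeckSpace p),
        (∀ (g : G) (z : KaltonPeckSpace p),
          (Λ g z : L0 × LpI p) =
            (U g (z : L0 × LpI p).1 + d g (z : L0 × LpI p).2,
              naturalAction G g (z : L0 × LpI p).2)) ∧
        ∃ C : ℝ, ∀ (g : G) (z : KaltonPeckSpace p),
          twistedNorm (toL0 p) (kaltonPeck p) (Λ g z : L0 × LpI p) ≤
            C * twistedNorm (toL0 p) (kaltonPeck p) (z : L0 × LpI p)) ∧
      -- on no dense invariant subspace is it a linear perturbation of a centralizer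
      (∀ (Y₀ : Submodule ℂ (LpI p)), Dense (Y₀ : Set (LpI p)) →
        ∀ hY₀ : ∀ g : G, ∀ y ∈ Y₀, naturalAction G g y ∈ Y₀,
          ¬ IsLinearPerturbationOfCentralizer (toL0 p) U (restrictAction (naturalAction G) Y₀ hY₀)
            (fun y : Y₀ => kaltonPeck p (y : LpI p))) := by
  obtain rfl : G = disjointnessPreserving p := by
    rcases hG with ⟨hp, rfl⟩ | ⟨-, rfl⟩
    exacts [(disjointnessPreserving_eq_top hp₂ hp).symm, rfl]
  obtain ⟨U, hU⟩ := exists_extendedAction hp₂ le_rfl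
  obtain ⟨d, hd⟩ := exists_derivation hp₂ le_rfl hU
  have h_action (g) (e : L0) (r : ℝ) (h : NormLE (toL0 p) e r) :
      NormLE (toL0 p) (U g e) (1 * r) := (one_mul r).symm ▸ (hU g).normLE h
  have h_norm (g : disjointnessPreserving p) (f : LpI p) : ‖naturalAction _ g f‖ ≤ 1 * ‖f‖ :=
    ((g : IsomLp p).norm_map f).trans_le (one_mul _).ge
  have h_compat := isCompatibleVia_of_eq_neg_commutator (kaltonPeck_isQuasiLinear p) hd
  refine ⟨U, d, fun g V => ⟨fun hV => hV.unique (hU g), fun hV => hV ▸ hU g⟩, hd, h_compat,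
    fun B hB => ?_, h_compat.exists_action_twistedSum h_action h_norm Subtype.val_injective,
    fun Y₀ hY₀_dense hY₀ => ?_⟩
  · obtain ⟨K, hK₀, hK⟩ := exists_normLE_scaleDifferential_sub_kaltonPeck hp₁ hp₂ hB
    exact ⟨_, h_compat.of_bounded_sub_smul h_action h_norm (scaleDifferential_smul hp₁ hp₂ hB)
      p.toReal hK₀ hK⟩
  · rintro ⟨L, hL⟩
    obtain ⟨C, hLC⟩ := exists_hasBoundedCommutators_of_isCentralizer hU hY₀ hL
    exact not_hasBoundedCommutators hp₂ (fun T hT => hY₀ ⟨T, hT⟩) hY₀_dense hLC
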